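/- **Conventions.** All graphs are finite and simple with vertex set $\{0,\dots,n-1\}$. A matrix $M\in\mathbb R_{\ge 0}^{k\times k}$ is *reversible row stochastic* if its rows sum to $1$ and there is a probability vector $\pi$ with $\pi_aM_{ab}=\pi_bM_{ba}$ for all $a,b$. The *second eigenvalue* of a real square matrix is the second largest entry in the list of its real eigenvalues, counted with algebraic multiplicity. For a graph $G$ with adjacency matrix $A$ and diagonal degree matrix $D$ let $\tilde A=D^{-1/2}AD^{-1/2}$; $G$ is a *$\lambda$-one-sided expander* if the second eigenvalue of $\tilde A$ is at most $\lambda$. For $\chi:[n]\to[k]$ the *model* $M(\tilde A,\chi)\in\mathbb R^{k\times k}$ has entries $M(\tilde A,\chi)_{ab}=\frac1{|\chi^{-1}(a)|}\sum_{x\in\chi^{-1}(a)}\sum_{y\in\chi^{-1}(b)}\tilde A_{xy}$ (read as $0$ if $\chi^{-1}(a)=\emptyset$). $G$ is *$(M,\delta)$-colorable* if there is $\chi:[n]\to[k]$ with $|M_{ab}-M(\tilde A,\chi)_{ab}|\le\delta$ for all $a,b$ such that some set of at most $\delta n$ vertices covers all edges with both endpoints in the same part of $\chi$. A *$(k,\varepsilon)$-coloring*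 of $G$ is a list of $k$ pairwise disjoint independent sets covering at least $(1-\varepsilon)n$ vertices. *Algorithm* means a deterministic program for a random access machine with integer arrays, in which each elementary operation costs one time unit and multiplication and division are in addition charged the bit lengths of their operands; the input is $n$ and the adjacency matrix of $G$, and the output is the list of $0/1$ indicator vectors of the sets. **Theorem.** There is an absolute constant $c\in\mathbb N$ such that the following holds for every $k$ and every reversible row stochastic matrix $M\in\mathbb R_{\ge0}^{k\times k}$ with zero diagonal and nonpositive second eigenvalue. There are constants $C,\delta_0,\lambda_0>0$, depending only on $M$, such that for all $0<\delta\le\delta_0$ and $0<\lambda\le\lambda_0$ there are a constant $K=K(\delta,\lambda,M)$ and an algorithm which, given any $d$-regular $(M,\delta)$-colorable $\lambda$-one-sided expander $G$ on $n$ vertices (for any $n$ and $d$), halts in time at most $K\,n^{c}$ with an output satisfying the following. 1. Let $\pi$ be a stationary distribution of $M$ (a probability vector with $\pi M=\pi$), let $S_1,\dots,S_{k'}$ be the partition of $[k]$ in which two indices lie in the same class if and only if the corresponding rows of $M$ are equal, let $a_i^*\in S_i$ maximize $\pi$ over $S_i$, and let $$p_i=\max\Bigl(0,\ \pi(a_i^*)-\sum_{a\in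 S_i,\ a\ne a_i^*}\pi(a)\Bigr).$$ Then the output is a $\bigl(k',\ 1-\sum_{i=1}^{k'}p_i+C(\sqrt\delta+\lambda+\delta/\lambda)\bigr)$-coloring of $G$. 2. If the rows of $M$ are pairwise distinct, then the output is a $\bigl(k,\ C(\sqrt\delta+\lambda+\delta/\lambda)\bigr)$-coloring of $G$. -/

import Mathlib

/-! ### Models and spectra -/

/-- The second largest real eigenvalue of a real square matrix, eigenvalues being listed with
multiplicity (as roots of the characteristic polynomial) in nonincreasing order.
(If there are fewer than two real eigenvalues the value is `0`.) -/
noncomputable def secondEigenvalue {V : Type*} [Fintype V] [DecidableEq V]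
    (A : Matrix V V ℝ) : ℝ :=
  (A.charpoly.roots.sort (· ≥ ·)).getD 1 0

/-- Nonnegative entries, every row sums to one. -/
structure IsRowStochastic {k : ℕ} (M : Matrix (Fin k) (Fin k) ℝ) : Prop where
  nonneg : ∀ a b, 0 ≤ M a b
  row_sum : ∀ a, ∑ b, M a b = 1

/-- A probability vector. -/
structure IsDistribution {k : ℕ} (π : Fin k → ℝ) : Prop where
  nonneg : ∀ a, 0 ≤ π a
  sum_eq_one : ∑ a, π a = 1

/-- Row stochastic and satisfying detailed balance with respect to some probability vector. -/
structure IsReversibleRowStochastic {k : ℕ} (M : Matrix (Fin k) (Fin k) ℝ) : Prop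
    extends IsRowStochastic M where
  detailed_balance : ∃ π : Fin k → ℝ, IsDistribution π ∧ ∀ a b, π a * M a b = π b * M b a

/-- `π` is a stationary distribution of `M`: a probability vector with `π M = π`. -/
structure IsStationaryDistribution {k : ℕ} (M : Matrix (Fin k) (Fin k) ℝ) (π : Fin k → ℝ) :
    Prop extends IsDistribution π where
  stationary : Matrix.vecMul π M = π

/-- `S 0, …, S (k' - 1)` is the partition of the index set of `M` into classes of equal rows. -/
structure IsRowPartition {k k' : ℕ} (M : Matrix (Fin k) (Fin k) ℝ)
    (S : Fin k' → Finset (Fin k)) : Prop where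
  nonempty : ∀ i, (S i).Nonempty
  cover : ∀ a, ∃ i, a ∈ S i
  row_eq : ∀ i, ∀ a ∈ S i, ∀ b ∈ S i, M.row a = M.row b
  row_ne : ∀ i j, i ≠ j → ∀ a ∈ S i, ∀ b ∈ S j, M.row a ≠ M.row b

/-! ### Graphs and colorings -/

/-- The normalized adjacency matrix `D^{-1/2} A D^{-1/2}`. -/
noncomputable def normAdj {n : ℕ} (G : SimpleGraph (Fin n)) [DecidableRel G.Adj] :
    Matrix (Fin n) (Fin n) ℝ :=
  Matrix.diagonal (fun x => (√(G.degree x : ℝ))⁻¹) * G.adjMatrix ℝ *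
    Matrix.diagonal (fun x => (√(G.degree x : ℝ))⁻¹)

/-- `G` is a `lam`-one-sided expander: the second largest eigenvalue of the normalized adjacency
matrix is at most `lam`. -/
def IsOneSidedExpander {n : ℕ} (G : SimpleGraph (Fin n)) [DecidableRel G.Adj] (lam : ℝ) : Prop :=
  secondEigenvalue (normAdj G) ≤ lam

/-- The color class `χ⁻¹(a)`. -/
def colorClass {n k : ℕ} (χ : Fin n → Fin k) (a : Fin k) : Finset (Fin n) :=
  Finset.univ.filter fun x => χ x = a

/-- The model `M(A, χ)`: the `(a, b)` entry is the average over `x ∈ χ⁻¹(a)` of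
`∑_{y ∈ χ⁻¹(b)} A x y` (the row of an empty class is `0`). -/
noncomputable def model {n k : ℕ} (A : Matrix (Fin n) (Fin n) ℝ) (χ : Fin n → Fin k) :
    Matrix (Fin k) (Fin k) ℝ :=
  Matrix.of fun a b =>
    (∑ x ∈ colorClass χ a, ∑ y ∈ colorClass χ b, A x y) / ((colorClass χ a).card : ℝ)

/-- `G` is `(M, δ)`-colorable: some `k`-partition `χ` has a model that is entrywise `δ`-close
to `M`, and at most `δ n` vertices cover all the edges inside the parts of `χ`. -/
def IsModelColorable {n k : ℕ} (G : SimpleGraph (Fin n)) [DecidableRel G.Adj]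
    (M : Matrix (Fin k) (Fin k) ℝ) (δ : ℝ) : Prop :=
  ∃ χ : Fin n → Fin k,
    (∀ a b, |M a b - model (normAdj G) χ a b| ≤ δ) ∧
    ∃ U : Finset (Fin n), (U.card : ℝ) ≤ δ * n ∧
      ∀ x y, G.Adj x y → χ x = χ y → x ∈ U ∨ y ∈ U

/-- `I` is a `(k, ε)`-coloring of `G`: `k` pairwise disjoint independent sets which cover at least
`(1 - ε) n` vertices. -/
structure IsKColoring {n k : ℕ} (G : SimpleGraph (Fin n)) (ε : ℝ)
    (I : Fin k → Finset (Fin n)) : Prop where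
  disjoint : ∀ i j, i ≠ j → Disjoint (I i) (I j)
  indep : ∀ i, ∀ x ∈ I i, ∀ y ∈ I i, ¬ G.Adj x y
  cover : (1 - ε) * n ≤ ((Finset.univ.biUnion I).card : ℝ)

/-! ### Machine model

Algorithms are structured programs for a random access machine whose memory consists of
integer arrays.  A program is a finite object, so that it names finitely many arrays and finitely
many integer constants.  Every elementary operation takes one time unit, except that
multiplication and division are charged the bit lengths of their operands in addition.  Hence in
time `t` only numbers with `O(t)` more bits than the input and the constants can be created, and
the running time is polynomially related to that of a Turing machine. -/

/-- Memory: the content of cell `i` of array number `a` is `s a i`. -/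
abbrev Memory := ℕ → ℤ → ℤ

/-- Integer expressions. -/
inductive Expr where
  | const (z : ℤ)
  | read (a : ℕ) (i : Expr)
  | add (e f : Expr)
  | sub (e f : Expr)
  | mul (e f : Expr)
  | div (e f : Expr)
  | lt (e f : Expr)

/-- Value of an expression.  Division is integer division with nonnegative remainder (and value
`0` for divisor `0`); a comparison has value `1` or `0`. -/
def Expr.eval (s : Memory) : Expr → ℤ
  | .const z => z
  | .read a i => s a (i.eval s)
  | .add e f => e.eval s + f.eval s
  | .sub e f => e.eval s - f.eval s
  | .mul e f => e.eval s * f.eval s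
  | .div e f => e.eval s / f.eval s
  | .lt e f => if e.eval s < f.eval s then 1 else 0

/-- The number of binary digits of `|z|`. -/
def bitLength (z : ℤ) : ℕ := z.natAbs.size

/-- Time taken by the evaluation of an expression. -/
def Expr.time (s : Memory) : Expr → ℕ
  | .const _ => 1
  | .read _ i => i.time s + 1
  | .add e f => e.time s + f.time s + 1
  | .sub e f => e.time s + f.time s + 1
  | .mul e f => e.time s + f.time s + 1 + bitLength (e.eval s) + bitLength (f.eval s)
  | .div e f => e.time s + f.time s + 1 + bitLength (e.eval s) + bitLength (f.eval s)
  | .lt e f => e.time s + f.time s + 1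

/-- Programs. -/
inductive Program where
  | nop
  | assign (a : ℕ) (i e : Expr)
  | seq (p q : Program)
  | cond (e : Expr) (p q : Program)
  | loop (e : Expr) (p : Program)

/-- Overwrite cell `i` of array `a` by `z`. -/
def Memory.write (s : Memory) (a : ℕ) (i z : ℤ) : Memory :=
  fun a' i' => if a' = a ∧ i' = i then z else s a' i'

/-- `Exec p s t s'`: the program `p`, started with memory `s`, halts after `t` time units with
memory `s'`.  `cond e p q` is "if `e ≠ 0` then `p` else `q`", `loop e p` is
"while `e ≠ 0` do `p`". -/
inductive Exec : Program → Memory → ℕ → Memory → Prop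
  | nop (s : Memory) : Exec .nop s 1 s
  | assign (a : ℕ) (i e : Expr) (s : Memory) :
      Exec (.assign a i e) s (i.time s + e.time s + 1) (s.write a (i.eval s) (e.eval s))
  | seq {p q : Program} {s s' s'' : Memory} {t t' : ℕ} :
      Exec p s t s' → Exec q s' t' s'' → Exec (.seq p q) s (t + t') s''
  | cond_true {e : Expr} {p q : Program} {s s' : Memory} {t : ℕ} :
      e.eval s ≠ 0 → Exec p s t s' → Exec (.cond e p q) s (e.time s + 1 + t) s'
  | cond_false {e : Expr} {p q : Program} {s s' : Memory} {t : ℕ} :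
      e.eval s = 0 → Exec q s t s' → Exec (.cond e p q) s (e.time s + 1 + t) s'
  | loop_true {e : Expr} {p : Program} {s s' s'' : Memory} {t t' : ℕ} :
      e.eval s ≠ 0 → Exec p s t s' → Exec (.loop e p) s' t' s'' →
      Exec (.loop e p) s (e.time s + 1 + t + t') s''
  | loop_false {e : Expr} {p : Program} {s : Memory} :
      e.eval s = 0 → Exec (.loop e p) s (e.time s + 1) s

/-- Encoding of an input graph: cell `0` of array `0` holds the number `n` of vertices, cell
`x n + y` of array `1` holds the `(x, y)` entry of the adjacency matrix, and all other cells
hold `0`. -/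
def inputMemory {n : ℕ} (G : SimpleGraph (Fin n)) [DecidableRel G.Adj] : Memory :=
  fun a i =>
    if a = 0 then (if i = 0 then (n : ℤ) else 0)
    else if a = 1 then
      (if ∃ x y : Fin n, G.Adj x y ∧ i = (x : ℤ) * (n : ℤ) + (y : ℤ) then 1 else 0)
    else 0

/-- The list of `m` vertex sets that is read off the final memory: vertex `x` belongs to the
`i`-th set exactly if cell `i n + x` of array `2` holds `1`. -/
def outputSets (n m : ℕ) (s : Memory) (i : Fin m) : Finset (Fin n) :=
  Finset.univ.filter fun x : Fin n => s 2 ((i : ℤ) * (n : ℤ) + (x : ℤ)) = 1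

/-! ### Second eigenvalues and orthogonal diagonalization -/

/-! Let `A` be the normalized adjacency matrix; by regularity it is symmetric and doubly stochastic.
On vectors of sum zero its quadratic form is at most `λ`, but eigenvalues down to `-1` are allowed,
and these carry the hidden partition `χ`. Three facts make the partition recoverable.

Few eigenvalues are very negative. Let `B` be the projection onto the eigenspaces below `-t`. The
entrywise square of `B`, with rows and columns divided by the square roots of the diagonal of `B`,
is positive semidefinite. Pairing it with `A` gives at most `1 + λ tr B` by the one-sided hypothesis
and at least `t² tr B` by the inequality of arithmetic and geometric means, so `(t² - λ) tr B ≤ 1`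
(`IsExpanderMatrix.trace_le_of_negative`). Hence only `O(1/λ)` eigenvalues have square above `2λ`.

The partition is nearly equitable. Let `f_b = A 1_b`, so that `f_b x` is the weight sent from `x` to
class `b`, and let `u` be the deviation of `f_b` from its mean on class `a`, extended by zero.
Testing `A` on the centred indicator of `b` plus a multiple of `u` works because the cross term is
`‖u‖²`, while `⟨u, A u⟩ ≥ -2δn` as class `a` is almost independent. The result is `‖u‖² = O(λ + δ/λ)
n` (`IsExpanderMatrix.sum_sq_classWeight_sub_le`), so for most `x` the numbers `f_b x` are close to
the row of `M` with index `χ x`.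

The vectors `f_b` are nearly spanned by the few large eigenvectors. A polynomial filter suppresses
small eigenvalues and preserves large ones. It hardly moves `f_b`, and its matrix is the Gram matrix
of an embedding of the vertices in which near points have nearly equal filtered values of every
`f_b`. The embedding is essentially of bounded dimension, so by pigeonhole greedy clustering leaves
few vertices unlabelled (`exists_card_le_of_near`), with a bounded number of clusters. Most vertices
of one cluster then have colors with equal rows, so some table from clusters to classes of equal
rows is right for most vertices (`exists_table`).

The algorithm tries all tables. For each it deletes the vertices of a maximal matching of
monochromatic edges, and it keeps the largest remaining set. For the right table, the bad vertices
and the non-maximal colors of each class cover the monochromatic edges, and a matching costs at most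
twice a cover; this produces the `p_i` (`IsRounding.le_card`). The class frequencies are nearly
stationary for `M`, hence close to `π` since `1` is a simple eigenvalue
(`exists_stationary_stability`). If all rows differ, then `p_i = π_i` and the sum is `1`.

For the running time, the filter is evaluated in exact integer arithmetic with a common denominator.
Its degree is polynomial in `n`, hence so are the digit counts, and the number of tables depends
only on the parameters. -/

theorem lt_getD_one_of_two_le_countP {l : List ℝ} (hl : l.Pairwise (· ≥ ·)) {c : ℝ}
    (h : 2 ≤ l.countP (fun x => decide (c < x))) : c < l.getD 1 0 := by
  match l, hl, h with
  | [], _, h => simp at h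
  | [a], _, h => 
    have := List.countP_le_length (p := fun x => decide (c < x)) (l := [a])
    simp at this; simp at h; omega
  | a :: b :: t, hl, h =>
    by_contra hb
    simp only [List.getD_cons_succ, List.getD_cons_zero, not_lt] at hb
    have h0 : (b :: t).countP (fun x => decide (c < x)) = 0 := by
      rw [List.countP_eq_zero]
      intro x hx
      rw [List.pairwise_cons, List.pairwise_cons] at hl
      rcases List.mem_cons.1 hx with rfl | hx
      · simpa using hb
      · simpa using (hl.2.1 x hx).le.trans hb
    rw [List.countP_cons, h0] at h
    split_ifs at h <;> omega

theorem lt_secondEigenvalue_of_two_le_countP {V : Type*} [Fintype V] [DecidableEq V]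
    {A : Matrix V V ℝ} {c : ℝ} (h : 2 ≤ A.charpoly.roots.countP (c < ·)) :
    c < secondEigenvalue A := by
  apply lt_getD_one_of_two_le_countP (Multiset.pairwise_sort _ _)
  rw [← Multiset.coe_countP, Multiset.sort_eq]
  exact h

/-- If `1` is a double eigenvalue (in the geometric sense) then the second eigenvalue is
positive. -/
theorem eq_smul_of_secondEigenvalue_nonpos {V : Type*} [Fintype V] [DecidableEq V]
    {A : Matrix V V ℝ} (h : secondEigenvalue A ≤ 0) {u v : V → ℝ} (hu : Matrix.vecMul u A = u)
    (hv : Matrix.vecMul v A = v) (hu0 : u ≠ 0) : ∃ c : ℝ, v = c • u := by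
  by_contra hcon
  push Not at hcon
  set φ : Module.End ℝ (V → ℝ) := Matrix.toLin' A.transpose with hφ
  have hmem : ∀ w, Matrix.vecMul w A = w → w ∈ φ.eigenspace 1 := by
    intro w hw
    rw [Module.End.mem_eigenspace_iff, hφ, Matrix.toLin'_apply, Matrix.mulVec_transpose, hw,
      one_smul]
  have h2 : 2 ≤ Module.finrank ℝ (φ.eigenspace 1) := by
    have hli' : LinearIndependent ℝ
        ![(⟨u, hmem u hu⟩ : φ.eigenspace 1), ⟨v, hmem v hv⟩] := by
      rw [LinearIndependent.pair_iff' (by simpa [Subtype.ext_iff] using hu0)]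
      exact fun c hc => hcon c (congrArg Subtype.val hc).symm
    simpa using hli'.fintype_card_le_finrank
  -- The geometric multiplicity is at most the algebraic one, so `1` is at least a double root. Two
  -- roots above `0` make the second eigenvalue positive.
  have h3 := LinearMap.finrank_eigenspace_le φ (1 : ℝ)
  have h4 : φ.charpoly = A.charpoly := by
    rw [hφ, Matrix.charpoly_toLin', Matrix.charpoly_transpose]
  rw [h4, ← Polynomial.count_roots] at h3
  have h5 : A.charpoly.roots.count 1 ≤ A.charpoly.roots.countP ((0 : ℝ) < ·) := by
    rw [Multiset.count, Multiset.countP_eq_card_filter, Multiset.countP_eq_card_filter]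
    refine Multiset.card_le_card (Multiset.monotone_filter_right _ ?_)
    rintro b rfl
    exact one_pos
  exact absurd (lt_secondEigenvalue_of_two_le_countP (h2.trans (h3.trans h5))) (not_lt.2 h)

/-- An orthogonal diagonalization of a real matrix. -/
structure IsDiagonalization {V : Type*} [Fintype V] [DecidableEq V] (A O : Matrix V V ℝ)
    (μ : V → ℝ) : Prop where
  mul_transpose : O * O.transpose = 1
  transpose_mul : O.transpose * O = 1
  eq : A = O * Matrix.diagonal μ * O.transpose

theorem Matrix.IsHermitian.exists_isDiagonalization {V : Type*} [Fintype V] [DecidableEq V]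
    {A : Matrix V V ℝ} (hA : A.IsHermitian) : ∃ O, IsDiagonalization A O hA.eigenvalues := by
  have hstar : star (hA.eigenvectorUnitary : Matrix V V ℝ) =
      (hA.eigenvectorUnitary : Matrix V V ℝ).transpose := by
    rw [Matrix.star_eq_conjTranspose, Matrix.conjTranspose_eq_transpose_of_trivial]
  refine ⟨hA.eigenvectorUnitary, ?_, ?_, ?_⟩
  · rw [← hstar]; exact Unitary.mul_star_self_of_mem hA.eigenvectorUnitary.2
  · rw [← hstar]; exact Unitary.star_mul_self_of_mem hA.eigenvectorUnitary.2
  · rw [← hstar]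
    have := hA.spectral_theorem
    rw [Unitary.conjStarAlgAut_apply] at this
    exact this

/-- The matrix with eigenvectors the columns of `O` and eigenvalues `g`. -/
def specMatrix {V : Type*} [Fintype V] [DecidableEq V] (O : Matrix V V ℝ) (g : V → ℝ) :
    Matrix V V ℝ :=
  O * Matrix.diagonal g * O.transpose

section Spec

variable {V : Type*} [Fintype V] [DecidableEq V] {A O : Matrix V V ℝ} {μ : V → ℝ}

theorem specMatrix_apply (O : Matrix V V ℝ) (g : V → ℝ) (x y : V) :
    specMatrix O g x y = ∑ i, g i * O x i * O y i := by
  rw [specMatrix, Matrix.mul_apply]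
  refine Finset.sum_congr rfl fun i _ => ?_
  rw [Matrix.mul_diagonal, Matrix.transpose_apply]
  ring

theorem specMatrix_mulVec (O : Matrix V V ℝ) (g f : V → ℝ) (x : V) :
    (specMatrix O g).mulVec f x = ∑ i, g i * O x i * O.transpose.mulVec f i := by
  rw [specMatrix, ← Matrix.mulVec_mulVec, ← Matrix.mulVec_mulVec, Matrix.mulVec, dotProduct]
  refine Finset.sum_congr rfl fun i _ => ?_
  rw [Matrix.mulVec_diagonal]
  ring

theorem IsDiagonalization.specMatrix_mul (h : IsDiagonalization A O μ) (f g : V → ℝ) :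
    specMatrix O f * specMatrix O g = specMatrix O (fun i => f i * g i) := by
  have h1 : specMatrix O f * specMatrix O g =
      O * Matrix.diagonal f * (O.transpose * O) * Matrix.diagonal g * O.transpose := by
    simp only [specMatrix, Matrix.mul_assoc]
  rw [h1, h.transpose_mul, Matrix.mul_one, Matrix.mul_assoc O, Matrix.diagonal_mul_diagonal,
    specMatrix]

theorem IsDiagonalization.sum_mul_self (h : IsDiagonalization A O μ) (i j : V) :
    ∑ x, O x i * O x j = if i = j then 1 else 0 := by
  have := congrFun (congrFun h.transpose_mul i) j
  rw [Matrix.mul_apply, Matrix.one_apply] at this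
  simpa using this

theorem IsDiagonalization.sum_mul_self' (h : IsDiagonalization A O μ) (x y : V) :
    ∑ i, O x i * O y i = if x = y then 1 else 0 := by
  have := congrFun (congrFun h.mul_transpose x) y
  rw [Matrix.mul_apply, Matrix.one_apply] at this
  simpa using this

theorem IsDiagonalization.sum_sq_transpose_mulVec (h : IsDiagonalization A O μ) (f : V → ℝ) :
    ∑ i, (O.transpose.mulVec f i) ^ 2 = ∑ x, f x ^ 2 := by
  have h1 : O.transpose.mulVec f ⬝ᵥ O.transpose.mulVec f = f ⬝ᵥ f := by
    rw [Matrix.dotProduct_mulVec, Matrix.vecMul_transpose, Matrix.mulVec_mulVec,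
      h.mul_transpose, Matrix.one_mulVec]
  simpa [dotProduct, sq] using h1

theorem IsDiagonalization.sum_sq_mulVec (h : IsDiagonalization A O μ) (f : V → ℝ) :
    ∑ i, (O.mulVec f i) ^ 2 = ∑ x, f x ^ 2 := by
  have h1 : O.mulVec f ⬝ᵥ O.mulVec f = f ⬝ᵥ f := by
    rw [Matrix.dotProduct_mulVec, Matrix.vecMul_mulVec, h.transpose_mul, Matrix.vecMul_one]
  simpa [dotProduct, sq] using h1

theorem IsDiagonalization.sum_sq_specMatrix_mulVec (h : IsDiagonalization A O μ) (g f : V → ℝ) :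
    ∑ x, ((specMatrix O g).mulVec f x) ^ 2 = ∑ i, g i ^ 2 * (O.transpose.mulVec f i) ^ 2 := by
  rw [specMatrix, ← Matrix.mulVec_mulVec, ← Matrix.mulVec_mulVec, h.sum_sq_mulVec]
  refine Finset.sum_congr rfl fun i _ => ?_
  rw [Matrix.mulVec_diagonal]
  ring

theorem IsDiagonalization.quadratic (h : IsDiagonalization A O μ) (u : V → ℝ) :
    u ⬝ᵥ A.mulVec u = ∑ i, μ i * (O.transpose.mulVec u i) ^ 2 := by
  have h1 : A.mulVec u = O.mulVec ((Matrix.diagonal μ).mulVec (O.transpose.mulVec u)) := by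
    rw [Matrix.mulVec_mulVec, Matrix.mulVec_mulVec, ← h.eq]
  rw [h1, Matrix.dotProduct_mulVec, ← Matrix.mulVec_transpose, dotProduct]
  refine Finset.sum_congr rfl fun i _ => ?_
  rw [Matrix.mulVec_diagonal]
  ring

theorem IsDiagonalization.transpose_mulVec_mulVec (h : IsDiagonalization A O μ) (u : V → ℝ)
    (i : V) : O.transpose.mulVec (A.mulVec u) i = μ i * O.transpose.mulVec u i := by
  rw [h.eq, Matrix.mulVec_mulVec, ← Matrix.mul_assoc, ← Matrix.mul_assoc, h.transpose_mul,
    Matrix.one_mul, ← Matrix.mulVec_mulVec, Matrix.mulVec_diagonal]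

/-- Two indices with eigenvalues above `c` would give two roots above `c`. This form, that at most
one index is exceptional, avoids ordering the eigenvalues. -/
theorem Matrix.IsHermitian.eigenvalues_le_or_le (hA : A.IsHermitian) {c : ℝ}
    (hc : secondEigenvalue A ≤ c) {i j : V} (hij : i ≠ j) :
    hA.eigenvalues i ≤ c ∨ hA.eigenvalues j ≤ c := by
  by_contra! hcon
  refine absurd (lt_secondEigenvalue_of_two_le_countP (A := A) (c := c) ?_) (not_lt.2 hc)
  have hr : A.charpoly.roots = Multiset.map hA.eigenvalues Finset.univ.val := by
    simpa using hA.roots_charpoly_eq_eigenvalues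
  rw [hr, Multiset.countP_map]
  have : ({i, j} : Finset V).val ≤ Multiset.filter (fun a => c < hA.eigenvalues a)
      Finset.univ.val := by
    change _ ≤ (Finset.univ.filter fun a => c < hA.eigenvalues a).val
    rw [Finset.val_le_iff]
    intro a ha
    simp only [Finset.mem_insert, Finset.mem_singleton] at ha
    simp only [Finset.mem_filter, Finset.mem_univ, true_and]
    rcases ha with rfl | rfl
    exacts [hcon.1, hcon.2]
  have h2 := Multiset.card_le_card this
  rwa [Finset.card_val, Finset.card_pair hij] at h2

/-- If all but at most one eigenvalue are at most `c < 1` and the constants are fixed by `A` then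
the quadratic form of `A` is at most `c` on the vectors of sum zero. -/
theorem IsDiagonalization.quadratic_le (h : IsDiagonalization A O μ) {c : ℝ} (hc : c < 1)
    (hμ : ∀ i j, i ≠ j → μ i ≤ c ∨ μ j ≤ c) (h1 : A.mulVec 1 = 1) {u : V → ℝ}
    (hu : ∑ x, u x = 0) : u ⬝ᵥ A.mulVec u ≤ c * (u ⬝ᵥ u) := by
  have hdot : u ⬝ᵥ u = ∑ i, (O.transpose.mulVec u i) ^ 2 := by
    rw [h.sum_sq_transpose_mulVec]; simp [dotProduct, sq]
  rw [h.quadratic, hdot, Finset.mul_sum]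
  refine Finset.sum_le_sum fun i _ => ?_
  rcases le_or_gt (μ i) c with hi | hi
  · exact mul_le_mul_of_nonneg_right hi (sq_nonneg _)
  -- All other eigenvalues are at most `c < 1`, while the constants have eigenvalue `1`. So the
  -- constant vector is a multiple of column `i`, and a vector of sum zero has no component along
  -- it.
  · have hone : ∀ j, j ≠ i → O.transpose.mulVec 1 j = 0 := by
      intro j hj
      have := h.transpose_mulVec_mulVec 1 j
      rw [h1] at this
      have hj' : μ j ≤ c := (hμ i j hj.symm).resolve_left (not_le.2 hi)
      have h3 : (1 - μ j) * O.transpose.mulVec 1 j = 0 := by linarith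
      rcases mul_eq_zero.1 h3 with h4 | h4
      · linarith
      · exact h4
    have hrec : ∀ x, (1 : V → ℝ) x = O x i * O.transpose.mulVec 1 i := by
      intro x
      have h4 : O.mulVec (O.transpose.mulVec 1) x = (1 : V → ℝ) x := by
        rw [Matrix.mulVec_mulVec, h.mul_transpose, Matrix.one_mulVec]
      rw [← h4, Matrix.mulVec, dotProduct]
      exact Finset.sum_eq_single i (fun j _ hj => by rw [hone j hj, mul_zero]) (by simp)
    have hz : O.transpose.mulVec u i = 0 := by
      by_cases hV : O.transpose.mulVec 1 i = 0
      · exfalso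
        have := hrec i
        rw [hV] at this
        simp at this
      · have h5 : O.transpose.mulVec 1 i * O.transpose.mulVec u i = ∑ x, u x := by
          have h6 : O.transpose.mulVec u i = ∑ x, O x i * u x := rfl
          rw [h6, Finset.mul_sum]
          refine Finset.sum_congr rfl fun x _ => ?_
          have := hrec x
          rw [Pi.one_apply] at this
          linear_combination (-u x) * this
        rw [hu] at h5
        exact (mul_eq_zero.1 h5).resolve_left hV
    rw [hz]; simp

end Spec

/-! ### Few very negative eigenvalues -/

/-- A symmetric doubly stochastic matrix whose quadratic form is at most `c` on the vectors of
sum zero. -/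
structure IsExpanderMatrix {V : Type*} [Fintype V] (A : Matrix V V ℝ) (c : ℝ) : Prop where
  symm : ∀ x y, A x y = A y x
  nonneg : ∀ x y, 0 ≤ A x y
  row_sum : ∀ x, ∑ y, A x y = 1
  quadratic_le : ∀ u : V → ℝ, ∑ x, u x = 0 → ∑ x, ∑ y, A x y * u x * u y ≤ c * ∑ x, u x ^ 2

section Expander

variable {V : Type*} [Fintype V] {A : Matrix V V ℝ} {c : ℝ}

theorem IsExpanderMatrix.col_sum (hA : IsExpanderMatrix A c) (y : V) : ∑ x, A x y = 1 := by
  rw [← hA.row_sum y]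
  exact Finset.sum_congr rfl fun x _ => hA.symm x y

theorem IsExpanderMatrix.sum_left (hA : IsExpanderMatrix A c) (w : V → ℝ) :
    ∑ x, ∑ y, A x y * w x = ∑ x, w x := by
  refine Finset.sum_congr rfl fun x _ => ?_
  rw [← Finset.sum_mul, hA.row_sum, one_mul]

theorem IsExpanderMatrix.sum_right (hA : IsExpanderMatrix A c) (w : V → ℝ) :
    ∑ x, ∑ y, A x y * w y = ∑ x, w x := by
  rw [Finset.sum_comm]
  refine Finset.sum_congr rfl fun x _ => ?_
  rw [← Finset.sum_mul, hA.col_sum, one_mul]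

/-- Split off the mean of `w`: the cross terms vanish because `A` fixes the constants, and the mean
contributes exactly the first term. -/
theorem IsExpanderMatrix.quadratic_le_add (hA : IsExpanderMatrix A c) (hc : 0 ≤ c)
    (w : V → ℝ) : ∑ x, ∑ y, A x y * w x * w y ≤
      (∑ x, w x) ^ 2 / Fintype.card V + c * ∑ x, w x ^ 2 := by
  rcases isEmpty_or_nonempty V with hV | hV
  · simp
  have hn : (0 : ℝ) < Fintype.card V := by exact_mod_cast Fintype.card_pos
  set n : ℝ := (Fintype.card V : ℝ) with hn'
  set m := (∑ x, w x) / n with hm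
  have hmn : ∑ x, w x = m * n := by rw [hm]; field_simp
  have hconst : ∀ r : ℝ, ∑ _x : V, r = r * n := fun r => by
    rw [Finset.sum_const, Finset.card_univ, nsmul_eq_mul, mul_comm]
  have h0 : ∑ x, (w x - m) = 0 := by
    rw [Finset.sum_sub_distrib, hconst, hmn, sub_self]
  have h1 := hA.quadratic_le (fun x => w x - m) h0
  have h2 : ∑ x, ∑ y, A x y * (w x - m) * (w y - m) =
      ∑ x, ∑ y, A x y * w x * w y - m ^ 2 * n := by
    have : ∀ x, ∑ y, A x y * (w x - m) * (w y - m) = ∑ y, A x y * w x * w y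
        - m * ∑ y, A x y * w x - m * ∑ y, A x y * w y + m ^ 2 * ∑ y, A x y := by
      intro x
      simp only [Finset.mul_sum, ← Finset.sum_sub_distrib, ← Finset.sum_add_distrib]
      exact Finset.sum_congr rfl fun y _ => by ring
    simp only [this, Finset.sum_add_distrib, Finset.sum_sub_distrib, ← Finset.mul_sum]
    rw [hA.sum_left, hA.sum_right, Finset.sum_congr rfl fun x _ => hA.row_sum x, hconst, hmn]
    ring
  have h3 : ∑ x, (w x - m) ^ 2 = ∑ x, w x ^ 2 - m ^ 2 * n := by
    have : ∀ x, (w x - m) ^ 2 = w x ^ 2 - 2 * m * w x + m ^ 2 := fun x => by ring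
    simp only [this, Finset.sum_add_distrib, Finset.sum_sub_distrib, ← Finset.mul_sum]
    rw [hconst, hmn]; ring
  rw [h2, h3] at h1
  have h4 : (∑ x, w x) ^ 2 / n = m ^ 2 * n := by rw [hmn]; field_simp
  rw [h4]
  have : 0 ≤ c * (m ^ 2 * n) := by positivity
  linarith

/-- Expand the nonnegative sums of `A x y * (w x ± w y) ^ 2`. -/
theorem IsExpanderMatrix.abs_quadratic_le (hA : IsExpanderMatrix A c) (w : V → ℝ) :
    |∑ x, ∑ y, A x y * w x * w y| ≤ ∑ x, w x ^ 2 := by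
  have key : ∀ e : ℝ, e ^ 2 = 1 → 0 ≤ 2 * ∑ x, w x ^ 2 + 2 * e * ∑ x, ∑ y, A x y * w x * w y := by
    intro e he
    have h0 : 0 ≤ ∑ x, ∑ y, A x y * (w x + e * w y) ^ 2 :=
      Finset.sum_nonneg fun x _ => Finset.sum_nonneg fun y _ =>
        mul_nonneg (hA.nonneg x y) (sq_nonneg _)
    have h1 : ∑ x, ∑ y, A x y * (w x + e * w y) ^ 2 = ∑ x, ∑ y, A x y * w x ^ 2 +
        2 * e * ∑ x, ∑ y, A x y * w x * w y + ∑ x, ∑ y, A x y * w y ^ 2 := by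
      simp only [Finset.mul_sum, ← Finset.sum_add_distrib]
      refine Finset.sum_congr rfl fun x _ => Finset.sum_congr rfl fun y _ => ?_
      linear_combination (A x y * w y ^ 2) * he
    rw [h1, hA.sum_left (fun x => w x ^ 2), hA.sum_right (fun x => w x ^ 2)] at h0
    linarith
  rw [abs_le]
  constructor
  · have := key 1 (by norm_num); linarith
  · have := key (-1) (by norm_num); linarith

/-- A symmetric idempotent matrix on whose range `A` is at most `-t` on average has small
trace. -/
theorem IsExpanderMatrix.trace_le_of_negative (hA : IsExpanderMatrix A c) (hc : 0 ≤ c)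
    {B : Matrix V V ℝ} (hB : ∀ x y, B x y = B y x) (hBB : B * B = B) {t : ℝ} (ht : 0 < t)
    (hneg : ∑ x, ∑ y, A x y * B x y ≤ -t * ∑ x, B x x) :
    (t ^ 2 - c) * ∑ x, B x x ≤ 1 := by
  rcases isEmpty_or_nonempty V with hV | hV
  · simp
  have hn : (0 : ℝ) < Fintype.card V := by exact_mod_cast Fintype.card_pos
  have hmul : ∀ x y, ∑ p, B x p * B p y = B x y := fun x y => by
    rw [← Matrix.mul_apply, hBB]
  have hsq : ∀ x, ∑ p, B x p ^ 2 = B x x := fun x => by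
    rw [← hmul x x]
    exact Finset.sum_congr rfl fun p _ => by rw [hB p x, sq]
  have hdiag : ∀ x, 0 ≤ B x x := fun x => by
    rw [← hsq]; exact Finset.sum_nonneg fun p _ => sq_nonneg _
  set h : V → ℝ := fun x => √(B x x) with hh
  have hh0 : ∀ x, 0 ≤ h x := fun x => Real.sqrt_nonneg _
  have hh2 : ∀ x, h x ^ 2 = B x x := fun x => Real.sq_sqrt (hdiag x)
  have hzero : ∀ x, h x = 0 → ∀ y, B x y = 0 := by
    intro x hx y
    have h1 := hsq x
    rw [← hh2, hx, zero_pow two_ne_zero,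
      Finset.sum_eq_zero_iff_of_nonneg fun p _ => sq_nonneg _] at h1
    exact pow_eq_zero_iff two_ne_zero |>.1 (h1 y (Finset.mem_univ _))
  set r := ∑ x, B x x with hr
  -- the Hadamard square of `B` with rows and columns rescaled
  set Z : V → V → ℝ := fun x y => B x y ^ 2 * (h x)⁻¹ * (h y)⁻¹ with hZ
  -- Pointwise `-B ≤ Z / (2t) + (t/2) h x h y`, by completing a square, and `h x h y ≤ (h x ² + h y
  -- ²) / 2`. Summed against `A`, the last terms give `t r / 2`, half of the lower bound `t r` for
  -- the left side. Where `h` vanishes, so does the row of `B`, and the inverse with value `0` is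
  -- harmless.
  have hlow : t ^ 2 * r ≤ ∑ x, ∑ y, A x y * Z x y := by
    have hpt : ∀ x y, -(A x y * B x y) ≤ (2 * t)⁻¹ * (A x y * Z x y) +
        t / 4 * (A x y * h x ^ 2) + t / 4 * (A x y * h y ^ 2) := by
      intro x y
      have hpt' : -B x y ≤ (2 * t)⁻¹ * Z x y + t / 4 * h x ^ 2 + t / 4 * h y ^ 2 := by
        rcases eq_or_ne (h x) 0 with hx | hx
        · rw [hzero x hx y]; simp only [hZ, hzero x hx y]; simp; positivity
        rcases eq_or_ne (h y) 0 with hy | hy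
        · simp only [hZ, hB x y, hzero y hy x]; simp; positivity
        have hx' : 0 < h x := lt_of_le_of_ne (hh0 x) hx.symm
        have hy' : 0 < h y := lt_of_le_of_ne (hh0 y) hy.symm
        have e1 : (2 * t)⁻¹ * Z x y + t / 2 * (h x * h y) + B x y =
            (2 * t * h x * h y)⁻¹ * (B x y + t * (h x * h y)) ^ 2 := by
          simp only [hZ]; field_simp; ring
        have e2 : 0 ≤ (2 * t * h x * h y)⁻¹ * (B x y + t * (h x * h y)) ^ 2 := by positivity
        nlinarith [sq_nonneg (h x - h y)]
      have := mul_le_mul_of_nonneg_left hpt' (hA.nonneg x y)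
      linarith
    have hsum := Finset.sum_le_sum fun x (_ : x ∈ Finset.univ) =>
      Finset.sum_le_sum fun y (_ : y ∈ Finset.univ) => hpt x y
    simp only [Finset.sum_add_distrib, ← Finset.mul_sum, Finset.sum_neg_distrib] at hsum
    rw [hA.sum_left (fun x => h x ^ 2), hA.sum_right (fun x => h x ^ 2),
      Finset.sum_congr rfl fun x _ => hh2 x, ← hr] at hsum
    have h5 : t / 2 * r ≤ (2 * t)⁻¹ * ∑ x, ∑ y, A x y * Z x y := by linarith
    have h6 := mul_le_mul_of_nonneg_left h5 (by positivity : 0 ≤ 2 * t)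
    have h7 : ∀ b : ℝ, 2 * t * ((2 * t)⁻¹ * b) = b := fun b => by field_simp
    rw [h7] at h6
    linarith
  -- As `B` is idempotent, `Z` is the sum over `p, q` of the rank one matrices with entries `w p q x
  -- * w p q y`; this is the Schur product theorem made explicit. The one-sided bound applies to
  -- each summand.
  set w : V → V → V → ℝ := fun p q x => (h x)⁻¹ * B p x * B x q with hw
  set H : V → V → ℝ := fun p q => ∑ x, w p q x with hH
  have hZw : ∀ x y, Z x y = ∑ p, ∑ q, w p q x * w p q y := by
    intro x y
    have e : ∀ p q, w p q x * w p q y =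
        (h x)⁻¹ * (h y)⁻¹ * ((B x p * B p y) * (B x q * B q y)) := by
      intro p q
      simp only [hw, hB p x, hB y q]; ring
    simp only [e, ← Finset.mul_sum, hmul, ← Finset.sum_mul]
    simp only [hZ]; ring
  have hup : ∑ x, ∑ y, A x y * Z x y ≤
      (∑ p, ∑ q, H p q ^ 2) / Fintype.card V + c * ∑ p, ∑ q, ∑ x, w p q x ^ 2 := by
    have e : ∑ x, ∑ y, A x y * Z x y = ∑ p, ∑ q, ∑ x, ∑ y, A x y * w p q x * w p q y := by
      have e1 : ∀ x y, A x y * Z x y = ∑ p, ∑ q, A x y * w p q x * w p q y := by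
        intro x y
        simp only [hZw, Finset.mul_sum, mul_assoc]
      simp only [e1]
      have e2 : ∀ F : V → V → V → V → ℝ, ∑ x, ∑ y, ∑ p, ∑ q, F x y p q =
          ∑ p, ∑ q, ∑ x, ∑ y, F x y p q := by
        intro F
        calc ∑ x, ∑ y, ∑ p, ∑ q, F x y p q = ∑ x, ∑ p, ∑ y, ∑ q, F x y p q :=
              Finset.sum_congr rfl fun x _ => Finset.sum_comm
          _ = ∑ p, ∑ x, ∑ y, ∑ q, F x y p q := Finset.sum_comm
          _ = ∑ p, ∑ x, ∑ q, ∑ y, F x y p q := Finset.sum_congr rfl fun p _ =>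
              Finset.sum_congr rfl fun x _ => Finset.sum_comm
          _ = _ := Finset.sum_congr rfl fun p _ => Finset.sum_comm
      rw [e2]
    rw [e, Finset.sum_div, Finset.mul_sum, ← Finset.sum_add_distrib]
    refine Finset.sum_le_sum fun p _ => ?_
    rw [Finset.sum_div, Finset.mul_sum, ← Finset.sum_add_distrib]
    exact Finset.sum_le_sum fun q _ => hA.quadratic_le_add hc _
  have hnorm : ∑ p, ∑ q, ∑ x, w p q x ^ 2 = r := by
    have e : ∀ x, ∑ p, ∑ q, w p q x ^ 2 = B x x := by
      intro x
      have e1 : ∀ p q, w p q x ^ 2 = (h x)⁻¹ ^ 2 * (B x p ^ 2 * B x q ^ 2) := fun p q => by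
        simp only [hw, hB p x]; ring
      simp only [e1, ← Finset.mul_sum, hsq, ← Finset.sum_mul]
      rw [← hh2]
      rcases eq_or_ne (h x) 0 with hx | hx
      · simp [hx]
      · field_simp
    calc ∑ p, ∑ q, ∑ x, w p q x ^ 2 = ∑ p, ∑ x, ∑ q, w p q x ^ 2 :=
          Finset.sum_congr rfl fun p _ => Finset.sum_comm
      _ = ∑ x, ∑ p, ∑ q, w p q x ^ 2 := Finset.sum_comm
      _ = r := Finset.sum_congr rfl fun x _ => e x
  -- By `H = H * B` the squared norm of `H` is a sum over `x` of inner products of column `x` of `H`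
  -- with the row `x` of `B` divided by `h x`. These scaled rows have norm at most one, so `‖H‖² ≤
  -- n/2 + ‖H‖²/2`.
  have hHn : ∑ p, ∑ q, H p q ^ 2 ≤ Fintype.card V := by
    -- `H = H * B`
    have hHB : ∀ p x, ∑ q, B x q * H p q = H p x := by
      intro p x
      simp only [hH, Finset.mul_sum]
      rw [Finset.sum_comm]
      refine Finset.sum_congr rfl fun y _ => ?_
      have e1 : ∀ q, B x q * w p q y = (h y)⁻¹ * B p y * (B x q * B q y) := fun q => by
        simp only [hw, hB y q]; ring
      simp only [e1, ← Finset.mul_sum, hmul]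
      simp only [hw, hB x y]
    have e : ∑ p, ∑ q, H p q ^ 2 = ∑ x, ∑ p, (h x)⁻¹ * B x p * H p x := by
      have e1 : ∀ p q, H p q ^ 2 = ∑ x, (h x)⁻¹ * B x p * (B x q * H p q) := by
        intro p q
        rw [sq]
        nth_rewrite 1 [hH]
        simp only [Finset.sum_mul]
        exact Finset.sum_congr rfl fun x _ => by simp only [hw, hB p x]; ring
      simp only [e1]
      calc ∑ p, ∑ q, ∑ x, (h x)⁻¹ * B x p * (B x q * H p q)
          = ∑ p, ∑ x, ∑ q, (h x)⁻¹ * B x p * (B x q * H p q) :=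
            Finset.sum_congr rfl fun p _ => Finset.sum_comm
        _ = ∑ x, ∑ p, ∑ q, (h x)⁻¹ * B x p * (B x q * H p q) := Finset.sum_comm
        _ = _ := by simp only [← Finset.mul_sum, hHB]
    have hle : ∑ p, ∑ q, H p q ^ 2 ≤ Fintype.card V * (1 / 2) + (∑ p, ∑ q, H p q ^ 2) / 2 := by
      conv_lhs => rw [e]
      rw [Finset.sum_comm (f := fun p q => H p q ^ 2), Finset.sum_div, ← Finset.card_univ,
        ← nsmul_eq_mul, ← Finset.sum_const, ← Finset.sum_add_distrib]
      refine Finset.sum_le_sum fun x _ => ?_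
      have e2 : ∑ p, ((h x)⁻¹ * B x p) ^ 2 ≤ 1 := by
        simp only [mul_pow, ← Finset.mul_sum, hsq]
        rw [← hh2]
        rcases eq_or_ne (h x) 0 with hx | hx
        · simp [hx]
        · exact le_of_eq (by field_simp)
      have e3 : ∑ p, (h x)⁻¹ * B x p * H p x ≤
          ∑ p, (((h x)⁻¹ * B x p) ^ 2 / 2 + H p x ^ 2 / 2) :=
        Finset.sum_le_sum fun p _ => by nlinarith [sq_nonneg ((h x)⁻¹ * B x p - H p x)]
      rw [Finset.sum_add_distrib, ← Finset.sum_div, ← Finset.sum_div] at e3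
      linarith
    linarith
  rw [hnorm] at hup
  have : (∑ p, ∑ q, H p q ^ 2) / Fintype.card V ≤ 1 := by
    rw [div_le_one hn]; exact hHn
  linarith

end Expander

/-! ### A polynomial filter -/

/-- `t ↦ 1 - (1 - t)²`. -/
def boost (t : ℝ) : ℝ := 2 * t - t ^ 2

/-- A polynomial of degree `2 ^ (i + 1) * 4 ^ j` that is small at small arguments and close to one
at large arguments. -/
def filterFun (i j : ℕ) (t : ℝ) : ℝ := (fun t => boost (t ^ 2))^[j] (boost^[i] (t ^ 2))

theorem boost_iterate (i : ℕ) (t : ℝ) : boost^[i] t = 1 - (1 - t) ^ 2 ^ i := by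
  induction i with
  | zero => simp
  | succ i ih => rw [Function.iterate_succ_apply', ih, pow_succ 2, pow_mul, boost]; ring

theorem boost_sq_mem {t : ℝ} (ht : t ∈ Set.Icc (0 : ℝ) 1) : boost (t ^ 2) ∈ Set.Icc (0 : ℝ) 1 := by
  obtain ⟨h0, h1⟩ := ht
  have h2 : t ^ 2 ≤ 1 := pow_le_one₀ h0 h1
  constructor
  · rw [boost]; nlinarith [sq_nonneg t]
  · rw [boost]; nlinarith [sq_nonneg (1 - t ^ 2)]

theorem boost_sq_iterate_mem {t : ℝ} (ht : t ∈ Set.Icc (0 : ℝ) 1) (j : ℕ) :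
    (fun t => boost (t ^ 2))^[j] t ∈ Set.Icc (0 : ℝ) 1 := by
  induction j with
  | zero => exact ht
  | succ j ih => rw [Function.iterate_succ_apply']; exact boost_sq_mem ih

theorem boost_iterate_mem {t : ℝ} (ht : t ∈ Set.Icc (0 : ℝ) 1) (i : ℕ) :
    boost^[i] t ∈ Set.Icc (0 : ℝ) 1 := by
  rw [boost_iterate]
  have h0 : 0 ≤ 1 - t := by linarith [ht.2]
  exact ⟨by linarith [pow_le_one₀ (n := 2 ^ i) h0 (by linarith [ht.1])],
    by linarith [pow_nonneg h0 (2 ^ i)]⟩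

theorem sq_mem_Icc {t : ℝ} (ht : |t| ≤ 1) : t ^ 2 ∈ Set.Icc (0 : ℝ) 1 :=
  ⟨sq_nonneg _, by rw [← sq_abs]; exact pow_le_one₀ (abs_nonneg _) ht⟩

theorem filterFun_mem (i j : ℕ) {t : ℝ} (ht : |t| ≤ 1) : filterFun i j t ∈ Set.Icc (0 : ℝ) 1 :=
  boost_sq_iterate_mem (boost_iterate_mem (sq_mem_Icc ht) i) j

/-- `0` is superattracting: `2 * boost (a ^ 2) ≤ (2 * a) ^ 2`, so twice the value is squared at each
step, starting from at most `1 / 2`. -/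
theorem boost_sq_iterate_le {t : ℝ} (h0 : 0 ≤ t) (h1 : t ≤ 1 / 4) (j : ℕ) :
    2 * (fun t => boost (t ^ 2))^[j] t ≤ (1 / 2) ^ 2 ^ j := by
  have hm : t ∈ Set.Icc (0 : ℝ) 1 := ⟨h0, by linarith⟩
  induction j with
  | zero => simp; linarith
  | succ j ih =>
    rw [Function.iterate_succ_apply']
    have h2 := (boost_sq_iterate_mem hm j).1
    set a := (fun t => boost (t ^ 2))^[j] t
    calc 2 * boost (a ^ 2) ≤ (2 * a) ^ 2 := by rw [boost]; nlinarith [sq_nonneg (a ^ 2)]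
      _ ≤ ((1 / 2) ^ 2 ^ j) ^ 2 := by gcongr
      _ = _ := by rw [← pow_mul, pow_succ]

/-- `1` is superattracting too: `1 - boost (a ^ 2) = (1 - a ^ 2) ^ 2 ≤ 4 * (1 - a) ^ 2`, so four
times the error is squared at each step. -/
theorem le_boost_sq_iterate {t : ℝ} (h0 : 7 / 8 ≤ t) (h1 : t ≤ 1) (j : ℕ) :
    4 * (1 - (fun t => boost (t ^ 2))^[j] t) ≤ (1 / 2) ^ 2 ^ j := by
  have hm : t ∈ Set.Icc (0 : ℝ) 1 := ⟨by linarith, by linarith⟩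
  induction j with
  | zero => simp; linarith
  | succ j ih =>
    rw [Function.iterate_succ_apply']
    have h2 := boost_sq_iterate_mem hm j
    set a := (fun t => boost (t ^ 2))^[j] t
    have h3 : 0 ≤ 1 - a := by linarith [h2.2]
    calc 4 * (1 - boost (a ^ 2)) = 4 * ((1 - a) * (1 + a)) ^ 2 := by rw [boost]; ring
      _ ≤ 4 * ((1 - a) * 2) ^ 2 := by
        have := h2.1
        gcongr; linarith [h2.2]
      _ = (4 * (1 - a)) ^ 2 := by ring
      _ ≤ ((1 / 2) ^ 2 ^ j) ^ 2 := by gcongr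
      _ = _ := by rw [← pow_mul, pow_succ]

/-- The cruder rate is enough: with `2 ^ j` of order `n` the error is of order `1 / n` and the
degree is still polynomial in `n`. -/
theorem half_pow_two_pow_le (j : ℕ) : (1 / 2 : ℝ) ^ 2 ^ j ≤ 1 / 2 ^ j := by
  rw [one_div_pow]
  gcongr
  · norm_num
  · exact Nat.lt_two_pow_self.le

/-- By Bernoulli `1 - (1 - t²) ^ 2 ^ i ≤ 2 ^ i * 2c ≤ 1 / 4`, which is in the basin of `0`. -/
theorem filterFun_le {c : ℝ} {i : ℕ} (hi : 8 * c * 2 ^ i ≤ 1) (j : ℕ) {t : ℝ} (ht : |t| ≤ 1)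
    (htc : t ^ 2 ≤ 2 * c) : filterFun i j t ≤ 1 / 2 ^ j := by
  have hm := boost_iterate_mem (sq_mem_Icc ht) i
  have h1 : boost^[i] (t ^ 2) ≤ 1 / 4 := by
    rw [boost_iterate]
    have := one_add_mul_le_pow (a := -t ^ 2) (by linarith [(sq_mem_Icc ht).2]) (2 ^ i)
    push_cast at this
    have h2 : (2 : ℝ) ^ i * t ^ 2 ≤ 2 ^ i * (2 * c) := by gcongr
    rw [sub_eq_add_neg (1 : ℝ) (t ^ 2), ← neg_sq]
    rw [neg_sq]
    linarith
  have h3 := boost_sq_iterate_le hm.1 h1 j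
  have h4 := half_pow_two_pow_le j
  have h5 := (filterFun_mem i j ht).1
  rw [filterFun] at *
  linarith

/-- Since `(1 - t²)(1 + t²) ≤ 1` and `(1 + t²) ^ 2 ^ i ≥ 1 + 112 c 2 ^ i ≥ 1 + 112 / 16 = 8`, the
first phase ends at `7 / 8` or above, in the basin of `1`. -/
theorem le_filterFun {c : ℝ} {i : ℕ} (hi : 1 ≤ 16 * c * 2 ^ i) (j : ℕ) {t : ℝ}
    (ht : |t| ≤ 1) (htc : 112 * c ≤ t ^ 2) : 1 - filterFun i j t ≤ 1 / 2 ^ j := by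
  have hm := boost_iterate_mem (sq_mem_Icc ht) i
  have h1 : 7 / 8 ≤ boost^[i] (t ^ 2) := by
    rw [boost_iterate]
    have h2 := sq_mem_Icc ht
    have h3 := one_add_mul_le_pow (a := t ^ 2) (by linarith [h2.1]) (2 ^ i)
    push_cast at h3
    have h4 : (1 - t ^ 2) ^ 2 ^ i * (1 + t ^ 2) ^ 2 ^ i ≤ 1 := by
      rw [← mul_pow]
      exact pow_le_one₀ (mul_nonneg (by linarith [h2.2]) (by linarith [h2.1]))
        (by nlinarith [h2.1])
    have h5 : (2 : ℝ) ^ i * (112 * c) ≤ 2 ^ i * t ^ 2 := by gcongr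
    have h6 : 8 ≤ (1 + t ^ 2) ^ 2 ^ i := by linarith
    have h7 : 0 ≤ (1 - t ^ 2) ^ 2 ^ i := pow_nonneg (by linarith [h2.2]) _
    nlinarith
  have h3 := le_boost_sq_iterate h1 hm.2 j
  have h4 := half_pow_two_pow_le j
  have h5 := (filterFun_mem i j ht).2
  rw [filterFun] at *
  linarith

/-! ### The filter applied to integer matrices -/

section IntFilter

variable {V : Type*} [Fintype V]

/-- Squaring of `p.1 / p.2`. -/
def intSq (p : Matrix V V ℤ × ℤ) : Matrix V V ℤ × ℤ := (p.1 * p.1, p.2 * p.2)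

/-- The operation `boost` applied to `p.1 / p.2`. -/
def intBoost (p : Matrix V V ℤ × ℤ) : Matrix V V ℤ × ℤ :=
  ((2 * p.2) • p.1 - p.1 * p.1, p.2 * p.2)

/-- The filter applied to `p.1 / p.2`. -/
def intFilter (i j : ℕ) (p : Matrix V V ℤ × ℤ) : Matrix V V ℤ × ℤ :=
  (fun p => intBoost (intSq p))^[j] (intBoost^[i] (intSq p))

variable [DecidableEq V]

/-- `p.1 / p.2` has eigenvectors the columns of `O` and eigenvalues `g`. -/
def Represents (O : Matrix V V ℝ) (p : Matrix V V ℤ × ℤ) (g : V → ℝ) : Prop :=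
  0 < p.2 ∧ ∀ x y, (p.1 x y : ℝ) = p.2 * specMatrix O g x y

variable {A O : Matrix V V ℝ} {μ : V → ℝ}

theorem IsDiagonalization.sum_represents (h : IsDiagonalization A O μ) {p : Matrix V V ℤ × ℤ}
    {g : V → ℝ} (hp : Represents O p g) (x y : V) :
    (((p.1 * p.1) x y : ℤ) : ℝ) = (p.2 * p.2) * specMatrix O (fun i => g i ^ 2) x y := by
  have h1 : specMatrix O (fun i => g i ^ 2) = specMatrix O g * specMatrix O g := by
    rw [h.specMatrix_mul]; simp only [sq]
  rw [h1, Matrix.mul_apply, Matrix.mul_apply, Finset.mul_sum]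
  push_cast
  refine Finset.sum_congr rfl fun z _ => ?_
  rw [hp.2, hp.2]; ring

theorem IsDiagonalization.represents_intSq (h : IsDiagonalization A O μ)
    {p : Matrix V V ℤ × ℤ} {g : V → ℝ} (hp : Represents O p g) :
    Represents O (intSq p) (fun i => g i ^ 2) := by
  refine ⟨mul_pos hp.1 hp.1, fun x y => ?_⟩
  simp only [intSq]
  rw [h.sum_represents hp]; push_cast; ring

theorem IsDiagonalization.represents_intBoost (h : IsDiagonalization A O μ)
    {p : Matrix V V ℤ × ℤ} {g : V → ℝ} (hp : Represents O p g) :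
    Represents O (intBoost p) (fun i => boost (g i)) := by
  refine ⟨mul_pos hp.1 hp.1, fun x y => ?_⟩
  have h1 : specMatrix O (fun i => boost (g i)) x y =
      2 * specMatrix O g x y - specMatrix O (fun i => g i ^ 2) x y := by
    simp only [specMatrix_apply, Finset.mul_sum, ← Finset.sum_sub_distrib, boost]
    exact Finset.sum_congr rfl fun i _ => by ring
  simp only [intBoost, Matrix.sub_apply, Matrix.smul_apply, smul_eq_mul]
  push_cast
  rw [h.sum_represents hp, h1, hp.2]; ring

theorem IsDiagonalization.represents_intFilter (h : IsDiagonalization A O μ)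
    {p : Matrix V V ℤ × ℤ} (hp : Represents O p μ) (i j : ℕ) :
    Represents O (intFilter i j p) (fun a => filterFun i j (μ a)) := by
  have h1 : ∀ i, Represents O (intBoost^[i] (intSq p)) (fun a => boost^[i] (μ a ^ 2)) := by
    intro i
    induction i with
    | zero => exact h.represents_intSq hp
    | succ i ih =>
      simp only [Function.iterate_succ_apply']
      exact h.represents_intBoost ih
  rw [intFilter]
  induction j with
  | zero => exact h1 i
  | succ j ih =>
    simp only [Function.iterate_succ_apply', filterFun]
    exact h.represents_intBoost (h.represents_intSq ih)

end IntFilter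

/-! ### Low dimensional embeddings and clusters -/

section Cluster

variable {V : Type*} [Fintype V] [DecidableEq V] {A O : Matrix V V ℝ} {μ : V → ℝ}

theorem IsDiagonalization.mul_col (h : IsDiagonalization A O μ) (x i : V) :
    ∑ y, A x y * O y i = μ i * O x i := by
  have h1 : A * O = O * Matrix.diagonal μ := by
    rw [h.eq, Matrix.mul_assoc, h.transpose_mul, Matrix.mul_one]
  have := congrFun (congrFun h1 x) i
  rw [Matrix.mul_apply, Matrix.mul_diagonal] at this
  rw [this]; ring

theorem IsDiagonalization.sum_sq_col (h : IsDiagonalization A O μ) (i : V) :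
    ∑ x, O x i ^ 2 = 1 := by
  have := h.sum_mul_self i i
  simpa [sq] using this

theorem IsDiagonalization.sum_sq_row (h : IsDiagonalization A O μ) (x : V) :
    ∑ i, O x i ^ 2 = 1 := by
  have := h.sum_mul_self' x x
  simpa [sq] using this

/-- The quadratic form of `A` takes the value `μ i` at the unit eigenvector in column `i`. -/
theorem IsDiagonalization.abs_le_one (h : IsDiagonalization A O μ) {c : ℝ}
    (hA : IsExpanderMatrix A c) (i : V) : |μ i| ≤ 1 := by
  have h1 := hA.abs_quadratic_le (fun x => O x i)
  have h2 : ∑ x, ∑ y, A x y * O x i * O y i = μ i := by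
    have : ∀ x, ∑ y, A x y * O x i * O y i = μ i * O x i ^ 2 := by
      intro x
      have e : ∀ y, A x y * O x i * O y i = O x i * (A x y * O y i) := fun y => by ring
      simp only [e, ← Finset.mul_sum, h.mul_col]; ring
    simp only [this, ← Finset.mul_sum, h.sum_sq_col, mul_one]
  rwa [h2, h.sum_sq_col] at h1

/-- The eigenvalues below `-t` are counted by the trace of their spectral projection, to which
`IsExpanderMatrix.trace_le_of_negative` applies. -/
theorem IsDiagonalization.card_neg_le (h : IsDiagonalization A O μ) {c t : ℝ} (hc : 0 ≤ c)
    (ht : 0 < t) (hA : IsExpanderMatrix A c) :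
    (t ^ 2 - c) * ((Finset.univ.filter fun i => μ i < -t).card : ℝ) ≤ 1 := by
  set g : V → ℝ := fun i => if μ i < -t then 1 else 0 with hg
  have hgg : (fun i => g i * g i) = g := by
    funext i; simp only [hg]; split_ifs <;> simp
  have htr : ∑ x, specMatrix O g x x = ((Finset.univ.filter fun i => μ i < -t).card : ℝ) := by
    simp only [specMatrix_apply]
    rw [Finset.sum_comm, Finset.card_filter]
    push_cast
    refine Finset.sum_congr rfl fun i _ => ?_
    have e : ∀ x, g i * O x i * O x i = g i * O x i ^ 2 := fun x => by ring
    rw [Finset.sum_congr rfl fun x _ => e x, ← Finset.mul_sum, h.sum_sq_col, mul_one]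
  have hAB : ∑ x, ∑ y, A x y * specMatrix O g x y = ∑ i, g i * μ i := by
    have e : ∀ x, ∑ y, A x y * specMatrix O g x y = ∑ i, g i * μ i * O x i ^ 2 := by
      intro x
      simp only [specMatrix_apply, Finset.mul_sum]
      rw [Finset.sum_comm]
      refine Finset.sum_congr rfl fun i _ => ?_
      have e : ∀ y, A x y * (g i * O x i * O y i) = g i * O x i * (A x y * O y i) :=
        fun y => by ring
      simp only [e, ← Finset.mul_sum, h.mul_col]; ring
    simp only [e]
    rw [Finset.sum_comm]
    simp only [← Finset.mul_sum, h.sum_sq_col, mul_one]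
  rw [← htr]
  refine hA.trace_le_of_negative hc (fun x y => ?_) ?_ ht ?_
  · simp only [specMatrix_apply]
    exact Finset.sum_congr rfl fun i _ => by ring
  · rw [h.specMatrix_mul, hgg]
  · rw [hAB, htr, Finset.card_filter]
    push_cast
    rw [Finset.mul_sum]
    refine Finset.sum_le_sum fun i _ => ?_
    simp only [hg]
    split_ifs with hi <;> linarith

/-- For `t = √(2c)` one has `t² - c = c`, so at most `1 / c` eigenvalues are below `-t`. At most one
exceeds `c`, and `c ≤ t` because `c < 2`. -/
theorem IsDiagonalization.card_large_le (h : IsDiagonalization A O μ) {c : ℝ} (hc : 0 < c)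
    (hc1 : c < 2) (hA : IsExpanderMatrix A c) (hμ : ∀ i j, i ≠ j → μ i ≤ c ∨ μ j ≤ c) :
    ((Finset.univ.filter fun i => 2 * c < μ i ^ 2).card : ℝ) ≤ 1 / c + 1 := by
  set t := √(2 * c) with ht
  have ht0 : 0 < t := Real.sqrt_pos.2 (by linarith)
  have ht2 : t ^ 2 = 2 * c := Real.sq_sqrt (by linarith)
  have h1 := h.card_neg_le hc.le ht0 hA
  have h2 : (Finset.univ.filter fun i => c < μ i).card ≤ 1 := by
    rw [Finset.card_le_one]
    intro i hi j hj
    by_contra hij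
    simp only [Finset.mem_filter, Finset.mem_univ, true_and] at hi hj
    rcases hμ i j hij with h | h <;> linarith
  have h3 : (Finset.univ.filter fun i => 2 * c < μ i ^ 2) ⊆
      (Finset.univ.filter fun i => μ i < -t) ∪ (Finset.univ.filter fun i => c < μ i) := by
    intro i hi
    simp only [Finset.mem_filter, Finset.mem_univ, true_and, Finset.mem_union] at hi ⊢
    by_contra! hcon
    have hct : c ≤ t := Real.le_sqrt_of_sq_le (by nlinarith)
    have := sq_le_sq' hcon.1 (hcon.2.trans hct)
    linarith
  have h4 := (Finset.card_le_card h3).trans (Finset.card_union_le _ _)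
  have h5 : ((Finset.univ.filter fun i => 2 * c < μ i ^ 2).card : ℝ) ≤
      ((Finset.univ.filter fun i => μ i < -t).card : ℝ) + 1 := by
    exact_mod_cast h4.trans (Nat.add_le_add_left h2 _)
  have h6 : ((Finset.univ.filter fun i => μ i < -t).card : ℝ) ≤ 1 / c := by
    rw [le_div_iff₀ hc]
    rw [ht2] at h1
    linarith
  linarith

/-- The points `x` and `y` are close in the embedding with Gram matrix `F`, scaled by `P`. -/
def Near (F : Matrix V V ℝ) (P : ℝ) (x y : V) : Prop :=
  Fintype.card V * P * (F x x + F y y - 2 * F x y) ≤ 1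

/-- For `g ≥ 0` this is the squared distance of the points with coordinates `√(g i) * O x i` and
`√(g i) * O y i`, which explains `Near`. -/
theorem specMatrix_dist (g : V → ℝ) (x y : V) :
    specMatrix O g x x + specMatrix O g y y - 2 * specMatrix O g x y =
      ∑ i, g i * (O x i - O y i) ^ 2 := by
  simp only [specMatrix_apply, Finset.mul_sum, ← Finset.sum_sub_distrib, ← Finset.sum_add_distrib]
  exact Finset.sum_congr rfl fun i _ => by ring

/-- Cauchy–Schwarz with `g i` split into two square roots: one factor is the squared distance in the
embedding, the other is at most the squared norm of `f` because `g ≤ 1`. -/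
theorem IsDiagonalization.sq_sub_le_of_near (h : IsDiagonalization A O μ) {g : V → ℝ}
    (hg : ∀ i, g i ∈ Set.Icc (0 : ℝ) 1) {P : ℝ} (hP : 0 < P) {x y : V}
    (hxy : Near (specMatrix O g) P x y) {f : V → ℝ} (hf : ∑ z, f z ^ 2 ≤ Fintype.card V) :
    P * ((specMatrix O g).mulVec f x - (specMatrix O g).mulVec f y) ^ 2 ≤ 1 := by
  have hn : (0 : ℝ) < Fintype.card V := by
    exact_mod_cast Fintype.card_pos_iff.2 ⟨x⟩
  rw [Near, specMatrix_dist] at hxy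
  have h1 : (specMatrix O g).mulVec f x - (specMatrix O g).mulVec f y =
      ∑ i, (√(g i) * (O x i - O y i)) * (√(g i) * O.transpose.mulVec f i) := by
    rw [specMatrix_mulVec, specMatrix_mulVec, ← Finset.sum_sub_distrib]
    refine Finset.sum_congr rfl fun i _ => ?_
    have := Real.mul_self_sqrt (hg i).1
    linear_combination (-(O x i - O y i) * O.transpose.mulVec f i) * this
  have h2 := Finset.sum_mul_sq_le_sq_mul_sq Finset.univ
    (fun i => √(g i) * (O x i - O y i)) (fun i => √(g i) * O.transpose.mulVec f i)
  simp only [mul_pow, Real.sq_sqrt (hg _).1] at h2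
  rw [← h1] at h2
  have h3 : ∑ i, g i * O.transpose.mulVec f i ^ 2 ≤ Fintype.card V := by
    refine le_trans (Finset.sum_le_sum fun i _ => ?_) ((h.sum_sq_transpose_mulVec f).trans_le hf)
    nlinarith [(hg i).2, sq_nonneg (O.transpose.mulVec f i)]
  have h4 : 0 ≤ ∑ i, g i * (O x i - O y i) ^ 2 :=
    Finset.sum_nonneg fun i _ => mul_nonneg (hg i).1 (sq_nonneg _)
  calc P * ((specMatrix O g).mulVec f x - (specMatrix O g).mulVec f y) ^ 2
      ≤ P * ((∑ i, g i * (O x i - O y i) ^ 2) * Fintype.card V) := by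
        refine mul_le_mul_of_nonneg_left (h2.trans ?_) hP.le
        exact mul_le_mul_of_nonneg_left h3 h4
    _ ≤ 1 := by linarith

/-- A set in which no point has many near points is small. -/
theorem exists_card_le_of_near {c : ℝ} (hc : 0 < c) (hc1 : c < 2) {P : ℝ} (hP : 0 < P) :
    ∃ N κ : ℕ, 0 < N ∧ 0 < κ ∧ ∀ {V : Type} [Fintype V] [DecidableEq V] {A O : Matrix V V ℝ}
      {μ g : V → ℝ}, IsDiagonalization A O μ → IsExpanderMatrix A c →
      (∀ i j, i ≠ j → μ i ≤ c ∨ μ j ≤ c) → (∀ i, g i ∈ Set.Icc (0 : ℝ) 1) →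
      (∀ i, μ i ^ 2 ≤ 2 * c → Fintype.card V * N * g i ≤ 1) →
      ∀ Z : Finset V, (∀ x ∈ Z, ∀ Y ⊆ Z, (∀ y ∈ Y, Near (specMatrix O g) P x y) →
        κ * Y.card ≤ Fintype.card V) →
      (Z.card : ℝ) ≤ 2 * c * Fintype.card V := by
  obtain ⟨R, hR⟩ := exists_nat_ge (1 / c + 1)
  have hR0 : (0 : ℝ) < R := lt_of_lt_of_le (by positivity) hR
  -- The suppressed eigenvalues then satisfy `n * P * g i ≤ 1 / 4`. Two orthonormal rows have
  -- squared distance at most `2`, so these coordinates use up at most half of the allowance in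
  -- `Near`; the mesh width `w` is chosen for the other half.
  obtain ⟨N, hN⟩ := exists_nat_gt (4 * P)
  -- The squared lengths in the large coordinates sum to at most `R n`, so at most `c n` points
  -- exceed this threshold.
  set B : ℝ := R / c with hB
  have hB0 : 0 < B := by positivity
  -- mesh width
  obtain ⟨w, hw0, hw⟩ : ∃ w : ℝ, 0 < w ∧ P * (R * w ^ 2) ≤ 1 / 2 := by
    refine ⟨√(1 / (2 * P * R)), Real.sqrt_pos.2 (by positivity), ?_⟩
    rw [Real.sq_sqrt (by positivity)]
    exact le_of_eq (by field_simp)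
  obtain ⟨m, hm⟩ := exists_nat_ge (√B / w + 1)
  -- There are at most `(2 * m + 1) ^ R` cells, and each holds at most `n / κ` points of `Z`, in
  -- total at most `c n`.
  obtain ⟨κ, hκ⟩ := exists_nat_gt (((2 * m + 1) ^ R : ℕ) / c : ℝ)
  have hκ0 : (0 : ℝ) < κ := lt_of_le_of_lt (by positivity) hκ
  refine ⟨N, κ, ?_, by exact_mod_cast hκ0, ?_⟩
  · have : (0 : ℝ) < N := lt_trans (by positivity) hN
    exact_mod_cast this
  intro V _ _ A O μ g h hA hμ hg hsmall Z hZ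
  rcases isEmpty_or_nonempty V with hV | hV
  · have : Z = ∅ := Subsingleton.elim _ _
    rw [this]; simp
  set n : ℝ := (Fintype.card V : ℝ) with hn'
  have hn : 0 < n := by simpa [hn'] using (Nat.cast_pos (α := ℝ)).2 Fintype.card_pos
  set J := Finset.univ.filter fun i => 2 * c < μ i ^ 2 with hJ
  have hJR : J.card ≤ R := by
    exact_mod_cast (h.card_large_le hc hc1 hA hμ).trans hR
  set e : V → V → ℝ := fun x i => √(n * g i) * O x i with he
  have he2 : ∀ x i, e x i ^ 2 = n * g i * O x i ^ 2 := fun x i => by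
    simp only [he]; rw [mul_pow, Real.sq_sqrt (mul_nonneg hn.le (hg i).1)]
  set G := Z.filter fun x => ∑ i ∈ J, e x i ^ 2 ≤ B with hG
  set D := Z.filter fun x => ¬ ∑ i ∈ J, e x i ^ 2 ≤ B with hD
  have hcard : G.card + D.card = Z.card := Finset.card_filter_add_card_filter_not _
  -- few points are long
  have hDc : (D.card : ℝ) ≤ c * n := by
    have h1 : (D.card : ℝ) * B ≤ ∑ x, ∑ i ∈ J, e x i ^ 2 := by
      rw [← nsmul_eq_mul, ← Finset.sum_const]
      refine (Finset.sum_le_sum fun x hx => ?_).trans (Finset.sum_le_univ_sum_of_nonneg fun x =>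
        Finset.sum_nonneg fun i _ => sq_nonneg _)
      exact (not_le.1 (Finset.mem_filter.1 hx).2).le
    have h2 : ∑ x, ∑ i ∈ J, e x i ^ 2 ≤ R * n := by
      rw [Finset.sum_comm]
      have : ∀ i ∈ J, ∑ x, e x i ^ 2 ≤ n := by
        intro i _
        simp only [he2, ← Finset.mul_sum, h.sum_sq_col, mul_one]
        nlinarith [(hg i).2]
      refine (Finset.sum_le_sum this).trans ?_
      rw [Finset.sum_const, nsmul_eq_mul]
      gcongr
    have h3 : (D.card : ℝ) * B ≤ c * n * B := by
      have : c * n * B = R * n := by rw [hB]; field_simp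
      linarith
    exact le_of_mul_le_mul_right h3 hB0
  -- the other points lie in few cells, and the points of a cell are near to each other
  have hGc : (G.card : ℝ) ≤ c * n := by
    set cell : V → (V → ℤ) := fun x i => if i ∈ J then ⌊e x i / w⌋ else 0 with hcell
    set T : Finset (V → ℤ) :=
      Fintype.piFinset fun i => if i ∈ J then Finset.Icc (-(m : ℤ)) m else {0} with hT
    have hTc : T.card ≤ (2 * m + 1) ^ R := by
      rw [hT, Fintype.card_piFinset]
      have : ∀ i : V, (if i ∈ J then Finset.Icc (-(m : ℤ)) m else {0}).card =
          if i ∈ J then 2 * m + 1 else 1 := by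
        intro i
        split_ifs
        · rw [Int.card_Icc]; omega
        · simp
      simp only [this]
      rw [Finset.prod_ite_mem, Finset.univ_inter, Finset.prod_const]
      exact Nat.pow_le_pow_right (by omega) hJR
    have hmaps : ∀ x ∈ G, cell x ∈ T := by
      intro x hx
      rw [hT, Fintype.mem_piFinset]
      intro i
      simp only [hcell]
      split_ifs with hi
      · have h1 : e x i ^ 2 ≤ B := le_trans
          (Finset.single_le_sum (f := fun i => e x i ^ 2) (fun i _ => sq_nonneg _) hi)
          (Finset.mem_filter.1 hx).2
        have h2 : |e x i / w| ≤ √B / w := by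
          rw [abs_div, abs_of_pos hw0]
          gcongr
          exact Real.abs_le_sqrt h1
        rw [abs_le] at h2
        rw [Finset.mem_Icc]
        constructor
        · rw [Int.le_floor]; push_cast; linarith
        · have : (⌊e x i / w⌋ : ℝ) ≤ m := (Int.floor_le _).trans (by linarith)
          exact_mod_cast this
      · simp
    have hfib : ∀ b ∈ T, κ * (G.filter fun x => cell x = b).card ≤ Fintype.card V := by
      intro b _
      rcases (G.filter fun x => cell x = b).eq_empty_or_nonempty with hemp | ⟨x, hx⟩
      · rw [hemp]; simp
      have hx' := Finset.mem_filter.1 hx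
      have hxZ : x ∈ Z := (Finset.mem_filter.1 hx'.1).1
      refine hZ x hxZ _ (fun y hy => (Finset.mem_filter.1 (Finset.mem_filter.1 hy).1).1) ?_
      intro y hy
      have hcy : cell x = cell y := hx'.2.trans (Finset.mem_filter.1 hy).2.symm
      rw [Near, specMatrix_dist]
      have hlarge : ∑ i ∈ J, n * (g i * (O x i - O y i) ^ 2) ≤ R * w ^ 2 := by
        have : ∀ i ∈ J, n * (g i * (O x i - O y i) ^ 2) ≤ w ^ 2 := by
          intro i hi
          have h1 : n * (g i * (O x i - O y i) ^ 2) = (e x i - e y i) ^ 2 := by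
            simp only [he]
            rw [← mul_sub, mul_pow, Real.sq_sqrt (mul_nonneg hn.le (hg i).1)]; ring
          have h2 : ⌊e x i / w⌋ = ⌊e y i / w⌋ := by
            have := congrFun hcy i
            simpa only [hcell, if_pos hi] using this
          have h3 := Int.abs_sub_lt_one_of_floor_eq_floor h2
          rw [← sub_div, abs_div, abs_of_pos hw0, div_lt_one hw0] at h3
          rw [h1, ← sq_abs]
          gcongr
        refine (Finset.sum_le_sum this).trans ?_
        rw [Finset.sum_const, nsmul_eq_mul]
        gcongr
      have hrest : ∑ i ∈ Finset.univ.filter (fun i => ¬ 2 * c < μ i ^ 2),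
          n * (P * (g i * (O x i - O y i) ^ 2)) ≤ 1 / 2 := by
        have : ∀ i ∈ Finset.univ.filter (fun i => ¬ 2 * c < μ i ^ 2),
            n * (P * (g i * (O x i - O y i) ^ 2)) ≤ 1 / 4 * (O x i - O y i) ^ 2 := by
          intro i hi
          have h1 := hsmall i (not_lt.1 (Finset.mem_filter.1 hi).2)
          have h2 : n * (4 * P) * g i ≤ n * N * g i := by
            have := (hg i).1
            gcongr
          have h3 : n * P * g i ≤ 1 / 4 := by linarith
          calc _ = n * P * g i * (O x i - O y i) ^ 2 := by ring
            _ ≤ _ := by gcongr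
        refine (Finset.sum_le_sum this).trans ?_
        refine (Finset.sum_le_univ_sum_of_nonneg fun i => by positivity).trans ?_
        have h4 : ∀ i, 1 / 4 * (O x i - O y i) ^ 2 ≤ 1 / 4 * (O x i ^ 2) + 1 / 4 * (O y i ^ 2) -
            1 / 2 * (O x i * O y i) := fun i => le_of_eq (by ring)
        refine (Finset.sum_le_sum fun i _ => h4 i).trans ?_
        rw [Finset.sum_sub_distrib, Finset.sum_add_distrib, ← Finset.mul_sum, ← Finset.mul_sum,
          ← Finset.mul_sum, h.sum_sq_row, h.sum_sq_row, h.sum_mul_self']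
        split_ifs <;> norm_num
      rw [Finset.mul_sum, ← Finset.sum_filter_add_sum_filter_not _ (fun i => 2 * c < μ i ^ 2)]
      have e1 : ∀ i, n * P * (g i * (O x i - O y i) ^ 2) =
          P * (n * (g i * (O x i - O y i) ^ 2)) := fun i => by ring
      have e2 : ∀ i, n * P * (g i * (O x i - O y i) ^ 2) =
          n * (P * (g i * (O x i - O y i) ^ 2)) := fun i => by ring
      have s1 : ∑ i ∈ J, n * P * (g i * (O x i - O y i) ^ 2) ≤ 1 / 2 := by
        rw [Finset.sum_congr rfl fun i _ => e1 i, ← Finset.mul_sum]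
        exact (mul_le_mul_of_nonneg_left hlarge hP.le).trans hw
      have s2 : ∑ i ∈ Finset.univ.filter (fun i => ¬ 2 * c < μ i ^ 2),
          n * P * (g i * (O x i - O y i) ^ 2) ≤ 1 / 2 := by
        simpa only [e2] using hrest
      linarith
    have h1 : κ * G.card ≤ (2 * m + 1) ^ R * Fintype.card V := by
      rw [Finset.card_eq_sum_card_fiberwise hmaps, Finset.mul_sum]
      refine (Finset.sum_le_sum hfib).trans ?_
      rw [Finset.sum_const, smul_eq_mul]
      exact Nat.mul_le_mul_right _ hTc
    have h2 : (κ : ℝ) * G.card ≤ ((2 * m + 1) ^ R : ℕ) * n := by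
      rw [hn']; exact_mod_cast h1
    have h3 : (((2 * m + 1) ^ R : ℕ) : ℝ) ≤ c * κ := by
      rw [div_lt_iff₀ hc] at hκ; linarith
    have h4 : (κ : ℝ) * G.card ≤ κ * (c * n) := by
      calc (κ : ℝ) * G.card ≤ ((2 * m + 1) ^ R : ℕ) * n := h2
        _ ≤ c * κ * n := by gcongr
        _ = _ := by ring
    exact le_of_mul_le_mul_left h4 hκ0
  have : (Z.card : ℝ) = G.card + D.card := by exact_mod_cast hcard.symm
  linarith

end Cluster

/-! ### Equitability of good partitions -/

section Partition

variable {V : Type*} [Fintype V] {A : Matrix V V ℝ} {c : ℝ} {k : ℕ}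

/-- The weight that `A` sends from `x` to the class `b`. -/
def classWeight (A : Matrix V V ℝ) (χ : V → Fin k) (b : Fin k) (x : V) : ℝ :=
  ∑ y, A x y * if χ y = b then 1 else 0

theorem IsExpanderMatrix.classWeight_mem (hA : IsExpanderMatrix A c) (χ : V → Fin k) (b : Fin k)
    (x : V) : classWeight A χ b x ∈ Set.Icc (0 : ℝ) 1 := by
  constructor
  · refine Finset.sum_nonneg fun y _ => mul_nonneg (hA.nonneg x y) ?_
    split_ifs <;> norm_num
  · rw [← hA.row_sum x]
    refine Finset.sum_le_sum fun y _ => ?_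
    split_ifs
    · rw [mul_one]
    · rw [mul_zero]; exact hA.nonneg x y

/-- Test the quadratic form on `(e - p) + s u`, where `e - p` is the centred indicator of class `b`
and `u` the deviation on class `a`. The cross term is `2 s ‖u‖²`, and neither square term is very
negative, so a large `‖u‖²` would contradict one-sided expansion. -/
theorem IsExpanderMatrix.sum_sq_classWeight_sub_le (hA : IsExpanderMatrix A c) (hc : 0 < c)
    {χ : V → Fin k} {U : Finset V} {δ : ℝ} (hU : (U.card : ℝ) ≤ δ * Fintype.card V)
    (hcover : ∀ x y, A x y ≠ 0 → χ x = χ y → x ∈ U ∨ y ∈ U) (a b : Fin k) {m : ℝ}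
    (hm : m ∈ Set.Icc (0 : ℝ) 1)
    (hmean : ∑ x, (if χ x = a then classWeight A χ b x - m else 0) = 0) :
    ∑ x, (if χ x = a then classWeight A χ b x - m else 0) ^ 2 ≤
      (2 * c + 4 * c ^ 2 + δ / c) * Fintype.card V := by
  classical
  rcases isEmpty_or_nonempty V with hV | hV
  · simp
  have hn : (0 : ℝ) < Fintype.card V := by exact_mod_cast Fintype.card_pos
  set n : ℝ := (Fintype.card V : ℝ) with hn'
  set f := classWeight A χ b with hf
  set u : V → ℝ := fun x => if χ x = a then f x - m else 0 with hu
  set e : V → ℝ := fun x => if χ x = b then 1 else 0 with he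
  set D := ∑ x, u x ^ 2 with hD
  have hconst : ∀ r : ℝ, ∑ _x : V, r = r * n := fun r => by
    rw [Finset.sum_const, Finset.card_univ, nsmul_eq_mul, mul_comm]
  have hu1 : ∀ x, |u x| ≤ 1 := by
    intro x
    simp only [hu]
    split_ifs
    · have := hA.classWeight_mem χ b x
      rw [abs_le]; exact ⟨by linarith [this.1, hm.2], by linarith [this.2, hm.1]⟩
    · simp
  -- `u` is supported on one class, all of whose inner edges meet `U`. The rows and columns of `U`
  -- have total weight at most `2 δ n`, and `|u| ≤ 1`.
  have huu : -(2 * δ * n) ≤ ∑ x, ∑ y, A x y * u x * u y := by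
    have hpt : ∀ x y, -(A x y * (if x ∈ U then 1 else 0) + A x y * (if y ∈ U then 1 else 0)) ≤
        A x y * u x * u y := by
      intro x y
      have h0 := hA.nonneg x y
      have h1 : |A x y * u x * u y| ≤ A x y := by
        rw [abs_mul, abs_mul, abs_of_nonneg h0]
        calc A x y * |u x| * |u y| ≤ A x y * 1 * 1 := by
              gcongr
              exacts [hu1 x, hu1 y]
          _ = A x y := by ring
      by_cases hxy : x ∈ U ∨ y ∈ U
      · have h2 := neg_le_of_abs_le h1
        rcases hxy with h | h <;> simp only [if_pos h] <;> split_ifs <;> linarith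
      · have h3 : A x y * u x * u y = 0 := by
          by_cases hz : A x y = 0
          · rw [hz]; ring
          have h4 : χ x ≠ χ y := fun h => hxy (hcover x y hz h)
          simp only [hu]
          by_cases hx : χ x = a
          · have hy : χ y ≠ a := fun h => h4 (hx.trans h.symm)
            rw [if_neg hy, mul_zero]
          · rw [if_neg hx, mul_zero, zero_mul]
        rw [h3]
        push Not at hxy
        simp [hxy.1, hxy.2]
    have hs := Finset.sum_le_sum fun x (_ : x ∈ Finset.univ) =>
      Finset.sum_le_sum fun y (_ : y ∈ Finset.univ) => hpt x y
    simp only [Finset.sum_neg_distrib, Finset.sum_add_distrib] at hs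
    rw [hA.sum_left, hA.sum_right] at hs
    simp only [Finset.sum_ite_mem, Finset.univ_inter, Finset.sum_const, nsmul_eq_mul,
      mul_one] at hs
    linarith
  set p := (∑ x, e x) / n with hp
  have hpn : ∑ x, e x = p * n := by rw [hp]; field_simp
  have he01 : ∀ x, 0 ≤ e x ∧ e x ≤ 1 := fun x => by
    simp only [he]; split_ifs <;> norm_num
  have hp0 : 0 ≤ p := div_nonneg (Finset.sum_nonneg fun x _ => (he01 x).1) hn.le
  have hp1 : p ≤ 1 := by
    rw [hp, div_le_one hn]
    refine (Finset.sum_le_sum fun x _ => (he01 x).2).trans ?_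
    rw [hconst, one_mul]
  have he0 : ∑ x, (e x - p) = 0 := by
    rw [Finset.sum_sub_distrib, hconst, hpn, sub_self]
  have hee : ∑ x, (e x - p) ^ 2 ≤ n := by
    calc ∑ x, (e x - p) ^ 2 ≤ ∑ _x : V, (1 : ℝ) := by
          refine Finset.sum_le_sum fun x _ => ?_
          have := he01 x
          nlinarith
      _ = n := by rw [hconst, one_mul]
  -- `A (e - p)` is `f - p`, which equals `u + (m - p)` on class `a`; the constant disappears
  -- because `u` has sum zero.
  have hcross : ∑ x, ∑ y, A x y * u x * (e y - p) = D := by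
    have e1 : ∀ x, ∑ y, A x y * u x * (e y - p) = u x * (f x - p) := by
      intro x
      have e2 : ∀ y, A x y * u x * (e y - p) = u x * (A x y * e y) - u x * p * A x y :=
        fun y => by ring
      simp only [e2, Finset.sum_sub_distrib, ← Finset.mul_sum, hA.row_sum]
      simp only [hf, classWeight, he]; ring
    have e3 : ∀ x, u x * (f x - p) = u x ^ 2 + (m - p) * u x := by
      intro x
      simp only [hu]
      split_ifs <;> ring
    simp only [e1, e3, Finset.sum_add_distrib, ← Finset.mul_sum]
    have : ∑ x, u x = 0 := hmean
    rw [this]; ring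
  -- With this choice the term `c * 2 * s ^ 2 * D` from the norm of the test vector equals `s * D`,
  -- half of the cross term `2 * s * D`.
  set s := 1 / (2 * c) with hs
  have hsc : 2 * c * s = 1 := by rw [hs]; field_simp
  have hmain := hA.quadratic_le (fun x => (e x - p) + s * u x) (by
    rw [Finset.sum_add_distrib, he0, ← Finset.mul_sum]
    have : ∑ x, u x = 0 := hmean
    rw [this]; ring)
  have hexp : ∑ x, ∑ y, A x y * ((e x - p) + s * u x) * ((e y - p) + s * u y) =
      ∑ x, ∑ y, A x y * (e x - p) * (e y - p) + 2 * s * D +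
        s ^ 2 * ∑ x, ∑ y, A x y * u x * u y := by
    have hcross' : ∑ x, ∑ y, A x y * (e x - p) * u y = D := by
      rw [← hcross, Finset.sum_comm]
      refine Finset.sum_congr rfl fun x _ => Finset.sum_congr rfl fun y _ => ?_
      rw [hA.symm y x]; ring
    have e1 : ∀ x y, A x y * ((e x - p) + s * u x) * ((e y - p) + s * u y) =
        A x y * (e x - p) * (e y - p) + s * (A x y * (e x - p) * u y) +
        s * (A x y * u x * (e y - p)) + s ^ 2 * (A x y * u x * u y) := fun x y => by ring
    simp only [e1, Finset.sum_add_distrib, ← Finset.mul_sum]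
    rw [hcross, hcross']; ring
  have hw2 : ∑ x, ((e x - p) + s * u x) ^ 2 ≤ 2 * n + 2 * s ^ 2 * D := by
    calc ∑ x, ((e x - p) + s * u x) ^ 2
        ≤ ∑ x, (2 * (e x - p) ^ 2 + 2 * s ^ 2 * u x ^ 2) :=
          Finset.sum_le_sum fun x _ => by nlinarith [sq_nonneg ((e x - p) - s * u x)]
      _ = 2 * ∑ x, (e x - p) ^ 2 + 2 * s ^ 2 * D := by
          rw [Finset.sum_add_distrib, ← Finset.mul_sum, ← Finset.mul_sum]
      _ ≤ _ := by linarith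
  rw [hexp] at hmain
  have h1 := (abs_le.1 (hA.abs_quadratic_le (fun x => e x - p))).1
  have h2 : s ^ 2 * -(2 * δ * n) ≤ s ^ 2 * ∑ x, ∑ y, A x y * u x * u y := by gcongr
  have h3 : c * ∑ x, ((e x - p) + s * u x) ^ 2 ≤ c * (2 * n + 2 * s ^ 2 * D) := by gcongr
  have h4 : c * (2 * s ^ 2 * D) = s * D := by linear_combination (s * D) * hsc
  have h5 : s * D ≤ n + 2 * c * n + s ^ 2 * (2 * δ * n) := by linarith
  have h6 : D ≤ 2 * c * (n + 2 * c * n + s ^ 2 * (2 * δ * n)) := by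
    have := mul_le_mul_of_nonneg_left h5 (by linarith : 0 ≤ 2 * c)
    rwa [← mul_assoc, hsc, one_mul] at this
  refine h6.trans (le_of_eq ?_)
  rw [hs]; field_simp; ring

end Partition

/-! ### The error of the filter on the image of `A` -/

section FilterError

variable {V : Type*} [Fintype V] [DecidableEq V] {A O : Matrix V V ℝ} {μ : V → ℝ}

/-- The filter hardly changes the vectors in the image of `A`. -/
theorem IsDiagonalization.sum_sq_sub_filter_le (h : IsDiagonalization A O μ) {g f : V → ℝ}
    {r : ℝ} (hg : ∀ i, ((1 - g i) * μ i) ^ 2 ≤ r) (hf : ∑ x, f x ^ 2 ≤ Fintype.card V)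
    (hr : 0 ≤ r) :
    ∑ x, (A.mulVec f x - (specMatrix O g).mulVec (A.mulVec f) x) ^ 2 ≤ r * Fintype.card V := by
  have h1 : ∀ x, A.mulVec f x - (specMatrix O g).mulVec (A.mulVec f) x =
      (specMatrix O fun i => (1 - g i) * μ i).mulVec f x := by
    intro x
    rw [Matrix.mulVec_mulVec]
    have hA : A = specMatrix O μ := h.eq
    conv_lhs => rw [hA, h.specMatrix_mul]
    rw [specMatrix_mulVec, specMatrix_mulVec, specMatrix_mulVec, ← Finset.sum_sub_distrib]
    exact Finset.sum_congr rfl fun i _ => by ring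
  simp only [h1]
  rw [h.sum_sq_specMatrix_mulVec]
  calc ∑ i, ((1 - g i) * μ i) ^ 2 * O.transpose.mulVec f i ^ 2
      ≤ ∑ i, r * O.transpose.mulVec f i ^ 2 :=
        Finset.sum_le_sum fun i _ => mul_le_mul_of_nonneg_right (hg i) (sq_nonneg _)
    _ = r * ∑ x, f x ^ 2 := by rw [← Finset.mul_sum, h.sum_sq_transpose_mulVec]
    _ ≤ _ := by gcongr

end FilterError

/-! ### Rounding -/

theorem sum_card_filter_eq_le {ι α V : Type*} [Fintype ι] [DecidableEq α] (T : Finset V)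
    (h : V → α) {r : ι → α} (hr : Function.Injective r) :
    ∑ i, (T.filter fun x => h x = r i).card ≤ T.card := by
  classical
  rw [← Finset.card_biUnion]
  · exact Finset.card_le_card (Finset.biUnion_subset.2 fun i _ => Finset.filter_subset _ _)
  · intro i _ j _ hij
    rw [Function.onFun, Finset.disjoint_left]
    intro x hx hx'
    exact hij (hr ((Finset.mem_filter.1 hx).2.symm.trans (Finset.mem_filter.1 hx').2))

section Rounding

variable {V : Type*} [Fintype V] [DecidableEq V]

/-- `L` is what is left over after the removal of the vertices of a maximal matching among the
monochromatic edges of `col`. -/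
structure IsRounding (G : SimpleGraph V) (col : V → ℕ) (L : Finset V) : Prop where
  indep : ∀ x ∈ L, ∀ y ∈ L, G.Adj x y → col x ≠ col y
  removed_le : ∀ W : Finset V, (∀ x y, G.Adj x y → col x = col y → x ∈ W ∨ y ∈ W) → ∀ i,
    (Finset.univ.filter fun x => x ∉ L ∧ col x = i).card ≤
      2 * (W.filter fun x => x ∉ L ∧ col x = i).card

/-- In one class of equal rows let the distinguished color have `m₁` vertices and the other colors
`m₂`. The latter, together with bad vertices, cover the monochromatic edges, so up to bad vertices
at least `(m₁ + m₂) - 2 m₂` vertices survive. A vertex of `B` is charged once in its true class and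
twice in the cover of its assigned class, a vertex of `U` only twice. -/
theorem IsRounding.le_card {G : SimpleGraph V} {k k' : ℕ} {χ : V → Fin k} {ρ : Fin k → ℕ}
    {col : V → ℕ} {B U L : Finset V} (hL : IsRounding G col L)
    (hB : ∀ x, x ∉ B → col x = ρ (χ x)) (hU : ∀ x y, G.Adj x y → χ x = χ y → x ∈ U ∨ y ∈ U)
    {S : Fin k' → Finset (Fin k)} {aStar : Fin k' → Fin k} (haS : ∀ i, aStar i ∈ S i)
    (hcover : ∀ a, ∃ i, a ∈ S i) (hρ : ∀ i j, ∀ a ∈ S i, ∀ b ∈ S j, ρ a = ρ b ↔ i = j) :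
    ∑ i, max 0 (((Finset.univ.filter fun x => χ x = aStar i).card : ℝ) -
      ∑ a ∈ (S i).erase (aStar i), ((Finset.univ.filter fun x => χ x = a).card : ℝ)) ≤
      L.card + 3 * B.card + 2 * U.card := by
  classical
  set r : Fin k' → ℕ := fun i => ρ (aStar i) with hr
  have hrinj : Function.Injective r := fun i j hij =>
    (hρ i j _ (haS i) _ (haS j)).1 hij
  have hmem : ∀ a i, ρ a = r i → a ∈ S i := by
    intro a i ha
    obtain ⟨j, hj⟩ := hcover a
    rwa [← (hρ j i a hj _ (haS i)).1 ha]
  -- An edge that avoids `B` and joins distinguished colors is monochromatic only if these colors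
  -- coincide, and then `U` covers it.
  set W : Finset V := (B ∪ U) ∪ Finset.univ.filter (fun x => χ x ∉ Set.range aStar) with hW
  have hWc : ∀ x y, G.Adj x y → col x = col y → x ∈ W ∨ y ∈ W := by
    intro x y hxy hc
    by_contra! hcon
    simp only [hW, Finset.mem_union, Finset.mem_filter, Finset.mem_univ, true_and, not_or,
      not_not] at hcon
    obtain ⟨⟨⟨hxB, hxU⟩, i, hi⟩, ⟨hyB, hyU⟩, j, hj⟩ := hcon
    rw [hB x hxB, hB y hyB, ← hi, ← hj, hρ i j _ (haS i) _ (haS j)] at hc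
    have : χ x = χ y := by rw [← hi, ← hj, hc]
    rcases hU x y hxy this with h | h
    exacts [hxU h, hyU h]
  have hclass : ∀ T : Finset (Fin k), ((Finset.univ.filter fun x => χ x ∈ T).card : ℝ) =
      ∑ a ∈ T, ((Finset.univ.filter fun x => χ x = a).card : ℝ) := by
    intro T
    have hmaps : Set.MapsTo χ (Finset.univ.filter fun x => χ x ∈ T : Finset V) T :=
      fun x hx => (Finset.mem_filter.1 (Finset.mem_coe.1 hx)).2
    rw [Finset.card_eq_sum_card_fiberwise hmaps]
    push_cast
    refine Finset.sum_congr rfl fun a ha => ?_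
    congr 2
    ext x
    simp only [Finset.mem_filter, Finset.mem_univ, true_and]
    exact ⟨fun h => h.2, fun h => ⟨h ▸ ha, h⟩⟩
  have hi : ∀ i, max 0 (((Finset.univ.filter fun x => χ x = aStar i).card : ℝ) -
      ∑ a ∈ (S i).erase (aStar i), ((Finset.univ.filter fun x => χ x = a).card : ℝ)) ≤
      ((L.filter fun x => col x = r i).card : ℝ) +
      2 * (((B ∪ U).filter fun x => col x = r i).card : ℝ) +
      ((B.filter fun x => ρ (χ x) = r i).card : ℝ) := by
    intro i
    refine max_le (by positivity) ?_
    rw [← hclass]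
    have h1 := hL.removed_le W hWc (r i)
    have h2 : (W.filter fun x => x ∉ L ∧ col x = r i).card ≤
        ((B ∪ U).filter fun x => col x = r i).card +
        (Finset.univ.filter fun x => χ x ∈ (S i).erase (aStar i)).card := by
      refine (Finset.card_le_card ?_).trans (Finset.card_union_le _ _)
      intro x hx
      simp only [hW, Finset.mem_filter, Finset.mem_union, Finset.mem_univ, true_and,
        Finset.mem_erase] at hx ⊢
      obtain ⟨h | h, _, hc⟩ := hx
      · exact Or.inl ⟨h, hc⟩
      · by_cases hxB : x ∈ B
        · exact Or.inl ⟨Or.inl hxB, hc⟩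
        · exact Or.inr ⟨fun h' => h ⟨i, h'.symm⟩, hmem _ _ ((hB x hxB).symm.trans hc)⟩
    have h3 : (Finset.univ.filter fun x => χ x ∈ S i).card ≤
        (L.filter fun x => col x = r i).card +
        (Finset.univ.filter fun x => x ∉ L ∧ col x = r i).card +
        (B.filter fun x => ρ (χ x) = r i).card := by
      refine (Finset.card_le_card ?_).trans ((Finset.card_union_le _ _).trans
        (Nat.add_le_add_right (Finset.card_union_le _ _) _))
      intro x hx
      simp only [Finset.mem_filter, Finset.mem_union, Finset.mem_univ, true_and] at hx ⊢
      have hρx : ρ (χ x) = r i := (hρ i i _ hx _ (haS i)).2 rfl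
      by_cases hxB : x ∈ B
      · exact Or.inr ⟨hxB, hρx⟩
      · have := (hB x hxB).trans hρx
        by_cases hxL : x ∈ L
        · exact Or.inl (Or.inl ⟨hxL, this⟩)
        · exact Or.inl (Or.inr ⟨hxL, this⟩)
    have h4 : (Finset.univ.filter fun x => χ x ∈ S i).card =
        (Finset.univ.filter fun x => χ x = aStar i).card +
        (Finset.univ.filter fun x => χ x ∈ (S i).erase (aStar i)).card := by
      rw [← Finset.card_union_of_disjoint]
      · congr 1
        ext x
        simp only [Finset.mem_filter, Finset.mem_union, Finset.mem_univ, true_and,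
          Finset.mem_erase]
        constructor
        · intro h
          by_cases h' : χ x = aStar i
          exacts [Or.inl h', Or.inr ⟨h', h⟩]
        · rintro (h | h)
          exacts [h ▸ haS i, h.2]
      · rw [Finset.disjoint_left]
        intro x hx hx'
        exact (Finset.mem_erase.1 (Finset.mem_filter.1 hx').2).1 (Finset.mem_filter.1 hx).2
    have h5 : (Finset.univ.filter fun x => χ x = aStar i).card ≤
        (Finset.univ.filter fun x => χ x ∈ (S i).erase (aStar i)).card +
        (L.filter fun x => col x = r i).card +
        2 * ((B ∪ U).filter fun x => col x = r i).card +
        (B.filter fun x => ρ (χ x) = r i).card := by omega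
    have h6 : ((Finset.univ.filter fun x => χ x = aStar i).card : ℝ) ≤
        ((Finset.univ.filter fun x => χ x ∈ (S i).erase (aStar i)).card : ℝ) +
        ((L.filter fun x => col x = r i).card : ℝ) +
        2 * (((B ∪ U).filter fun x => col x = r i).card : ℝ) +
        ((B.filter fun x => ρ (χ x) = r i).card : ℝ) := by exact_mod_cast h5
    linarith
  refine (Finset.sum_le_sum fun i _ => hi i).trans ?_
  rw [Finset.sum_add_distrib, Finset.sum_add_distrib, ← Finset.mul_sum]
  have s1 := sum_card_filter_eq_le L col hrinj
  have s2 := (sum_card_filter_eq_le (B ∪ U) col hrinj).trans (Finset.card_union_le _ _)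
  have s3 := sum_card_filter_eq_le B (fun x => ρ (χ x)) hrinj
  have s1' : ∑ i, ((L.filter fun x => col x = r i).card : ℝ) ≤ L.card := by exact_mod_cast s1
  have s2' : ∑ i, (((B ∪ U).filter fun x => col x = r i).card : ℝ) ≤ B.card + U.card := by
    exact_mod_cast s2
  have s3' : ∑ i, ((B.filter fun x => ρ (χ x) = r i).card : ℝ) ≤ B.card := by
    exact_mod_cast s3
  linarith

end Rounding

/-! ### Stationary distributions and classes of equal rows -/

section Model

variable {k : ℕ} {M : Matrix (Fin k) (Fin k) ℝ}

/-- The number of distinct rows. -/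
noncomputable def rowCount (M : Matrix (Fin k) (Fin k) ℝ) : ℕ := by
  classical exact (Finset.univ.image M.row).card

theorem exists_rowIndex (M : Matrix (Fin k) (Fin k) ℝ) :
    ∃ ρ : Fin k → ℕ, (∀ a, ρ a < rowCount M) ∧ ∀ a b, ρ a = ρ b ↔ M.row a = M.row b := by
  classical
  have hmem : ∀ a, M.row a ∈ Finset.univ.image M.row := fun a =>
    Finset.mem_image_of_mem _ (Finset.mem_univ a)
  refine ⟨fun a => ((Finset.univ.image M.row).equivFin ⟨M.row a, hmem a⟩).val,
    fun a => Fin.is_lt _, fun a b => ?_⟩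
  rw [← Fin.ext_iff, Equiv.apply_eq_iff_eq, Subtype.mk.injEq]

/-- The program is built from `M` alone; this makes its number of output sets correct for every row
partition. -/
theorem IsRowPartition.eq_rowCount {k' : ℕ} {S : Fin k' → Finset (Fin k)}
    (hS : IsRowPartition M S) : k' = rowCount M := by
  classical
  choose a ha using hS.nonempty
  have hinj : Function.Injective fun i => M.row (a i) := by
    intro i j hij
    by_contra hne
    exact hS.row_ne i j hne _ (ha i) _ (ha j) hij
  have : Finset.univ.image M.row = Finset.univ.image fun i => M.row (a i) := by
    ext r
    simp only [Finset.mem_image, Finset.mem_univ, true_and]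
    constructor
    · rintro ⟨b, rfl⟩
      obtain ⟨i, hi⟩ := hS.cover b
      exact ⟨i, hS.row_eq i _ (ha i) _ hi⟩
    · rintro ⟨i, rfl⟩
      exact ⟨_, rfl⟩
  rw [rowCount, this, Finset.card_image_of_injective _ hinj, Finset.card_univ, Fintype.card_fin]

/-- Only finitely many differences of entries occur, so any `γ` close enough to `0` lies below all
nonzero ones. -/
theorem exists_gap (M : Matrix (Fin k) (Fin k) ℝ) :
    ∃ γ : ℝ, 0 < γ ∧ ∀ a b, (∀ e, |M a e - M b e| < γ) → M.row a = M.row b := by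
  have h : ∀ᶠ γ : ℝ in nhdsWithin 0 (Set.Ioi 0),
      ∀ a b e, |M a e - M b e| < γ → M a e = M b e := by
    simp only [Filter.eventually_all]
    intro a b e
    by_cases hab : M a e = M b e
    · exact Filter.Eventually.of_forall fun _ _ => hab
    · have h0 : 0 < |M a e - M b e| := abs_pos.2 (sub_ne_zero.2 hab)
      filter_upwards [Ioo_mem_nhdsGT h0] with γ hγ h1
      exact absurd h1 (not_lt.2 hγ.2.le)
  obtain ⟨γ, h1, h2⟩ := (h.and self_mem_nhdsWithin).exists
  exact ⟨γ, h2, fun a b hab => funext fun e => h1 a b e (hab e)⟩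

/-- The eigenvalue `1` is simple, so `v ↦ (v M - v, ∑ v)` is injective. An injective linear map in
finite dimension is antilipschitz, and at `p - π` its value has norm at most `ε`. -/
theorem exists_stationary_stability (hM : IsReversibleRowStochastic M)
    (hsec : secondEigenvalue M ≤ 0) : ∃ C : ℝ, 0 ≤ C ∧ ∀ (π p : Fin k → ℝ) (ε : ℝ),
      IsStationaryDistribution M π → ∑ a, p a = 1 →
      (∀ b, |∑ a, p a * M a b - p b| ≤ ε) → ∀ a, |p a - π a| ≤ C * ε := by
  obtain ⟨π₀, hπ₀, hdb⟩ := hM.detailed_balance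
  have hst : Matrix.vecMul π₀ M = π₀ := by
    funext b
    simp only [Matrix.vecMul, dotProduct]
    rw [Finset.sum_congr rfl fun a _ => hdb a b, ← Finset.mul_sum, hM.row_sum, mul_one]
  have hπ0 : π₀ ≠ 0 := by
    rintro rfl
    have := hπ₀.sum_eq_one
    simp at this
  set Φ : (Fin k → ℝ) →ₗ[ℝ] (Fin k → ℝ) × ℝ :=
    LinearMap.prod (Matrix.vecMulLinear M - LinearMap.id)
      (∑ a, LinearMap.proj (R := ℝ) (φ := fun _ : Fin k => ℝ) a) with hΦ
  have hΦ1 : ∀ v, Φ v = (Matrix.vecMul v M - v, ∑ a, v a) := by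
    intro v
    simp [hΦ]
  have hker : LinearMap.ker Φ = ⊥ := by
    rw [LinearMap.ker_eq_bot']
    intro v hv
    rw [hΦ1, Prod.mk_eq_zero] at hv
    obtain ⟨c, rfl⟩ := eq_smul_of_secondEigenvalue_nonpos hsec hst (sub_eq_zero.1 hv.1) hπ0
    have h2 := hv.2
    simp only [Pi.smul_apply, smul_eq_mul, ← Finset.mul_sum, hπ₀.sum_eq_one, mul_one] at h2
    rw [h2, zero_smul]
  obtain ⟨K, hK0, hK⟩ := LinearMap.exists_antilipschitzWith Φ hker
  refine ⟨K, K.2, fun π p ε hπ hp hε a => ?_⟩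
  have hε0 : 0 ≤ ε := (abs_nonneg _).trans (hε a)
  have h1 := hK.le_mul_dist p π
  rw [dist_eq_norm, dist_eq_norm, ← map_sub, hΦ1] at h1
  have h2 : |p a - π a| ≤ ‖p - π‖ := norm_le_pi_norm (p - π) a
  have h3 : ‖(Matrix.vecMul (p - π) M - (p - π), ∑ a, (p - π) a)‖ ≤ ε := by
    rw [Prod.norm_def]
    refine max_le ?_ ?_
    · rw [pi_norm_le_iff_of_nonneg hε0]
      intro b
      rw [Matrix.sub_vecMul, hπ.stationary]
      have := hε b
      rw [Real.norm_eq_abs]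
      simp only [Pi.sub_apply]
      rw [sub_sub_sub_cancel_right]
      exact this
    · simp only [Pi.sub_apply, Finset.sum_sub_distrib, hp, hπ.sum_eq_one]
      simpa using hε0
  exact h2.trans (h1.trans (mul_le_mul_of_nonneg_left h3 K.2))

end Model

/-! ### Regular one-sided expanders as doubly stochastic matrices -/

section NormAdj

variable {n d : ℕ} {G : SimpleGraph (Fin n)} [DecidableRel G.Adj]

theorem SimpleGraph.IsRegularOfDegree.normAdj_apply (hG : G.IsRegularOfDegree d) (x y : Fin n) :
    normAdj G x y = G.adjMatrix ℝ x y / d := by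
  rw [normAdj, Matrix.mul_diagonal, Matrix.diagonal_mul, hG x, hG y, mul_right_comm,
    ← mul_inv, Real.mul_self_sqrt (Nat.cast_nonneg d), div_eq_mul_inv, mul_comm]

/-- Regularity makes the constants an eigenvector with eigenvalue `1`. As `c < 1`, it belongs to the
one exceptional eigenvalue, so the spectral bound becomes a bound on vectors of sum zero. -/
theorem SimpleGraph.IsRegularOfDegree.isExpanderMatrix (hG : G.IsRegularOfDegree d) (hd : 0 < d)
    {c : ℝ} (hc : c < 1) (hexp : IsOneSidedExpander G c) :
    IsExpanderMatrix (normAdj G) c ∧ ∃ O μ, IsDiagonalization (normAdj G) O μ ∧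
      ∀ i j, i ≠ j → μ i ≤ c ∨ μ j ≤ c := by
  have hd' : (d : ℝ) ≠ 0 := by exact_mod_cast hd.ne'
  have hsymm : ∀ x y, normAdj G x y = normAdj G y x := by
    intro x y
    simp only [hG.normAdj_apply, SimpleGraph.adjMatrix_apply, G.adj_comm x y]
  have hherm : (normAdj G).IsHermitian := by
    rw [Matrix.IsHermitian, Matrix.conjTranspose_eq_transpose_of_trivial]
    ext x y
    exact hsymm y x
  have hrow : ∀ x, ∑ y, normAdj G x y = 1 := by
    intro x
    simp only [hG.normAdj_apply, ← Finset.sum_div]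
    have : ∑ y, G.adjMatrix ℝ x y = d := by
      simp only [SimpleGraph.adjMatrix_apply, Finset.sum_boole]
      rw [← hG x, ← SimpleGraph.card_neighborFinset_eq_degree]
      congr 2
      ext y; simp
    rw [this, div_self hd']
  obtain ⟨O, hO⟩ := hherm.exists_isDiagonalization
  have hμ : ∀ i j, i ≠ j → hherm.eigenvalues i ≤ c ∨ hherm.eigenvalues j ≤ c :=
    fun i j hij => hherm.eigenvalues_le_or_le hexp hij
  refine ⟨⟨hsymm, fun x y => ?_, hrow, fun u hu => ?_⟩, O, _, hO, hμ⟩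
  · rw [hG.normAdj_apply, SimpleGraph.adjMatrix_apply]
    split_ifs <;> positivity
  · have h1 := hO.quadratic_le hc hμ (by
      funext x
      simp only [Matrix.mulVec, dotProduct, Pi.one_apply, mul_one]
      exact hrow x) hu
    have h2 : u ⬝ᵥ (normAdj G).mulVec u = ∑ x, ∑ y, normAdj G x y * u x * u y := by
      simp only [dotProduct, Matrix.mulVec, Finset.mul_sum]
      exact Finset.sum_congr rfl fun x _ => Finset.sum_congr rfl fun y _ => by ring
    rw [h2] at h1
    refine h1.trans (le_of_eq ?_)
    simp [dotProduct, sq]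

end NormAdj

/-! ### Correctness of the algorithm -/

/-- The integer version of `Near`. -/
def IntNear {n : ℕ} (p : Matrix (Fin n) (Fin n) ℤ × ℤ) (P : ℕ) (x y : Fin n) : Prop :=
  n * P * (p.1 x x + p.1 y y - 2 * p.1 x y) ≤ p.2

/-- Every cluster (label different from `0`) is near to a center, and no unlabelled vertex is
near to many unlabelled vertices. -/
structure IsClustering {n : ℕ} (p : Matrix (Fin n) (Fin n) ℤ × ℤ) (P κ : ℕ) (cl : Fin n → ℕ) :
    Prop where
  near_center : ∀ l, l ≠ 0 → ∃ z, ∀ x, cl x = l → IntNear p P z x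
  sparse : ∀ x, ∀ Y : Finset (Fin n), (∀ y ∈ Y, cl y = 0 ∧ IntNear p P x y) → κ * Y.card ≤ n

/-- Chebyshev's inequality, used to turn mean square errors into numbers of bad vertices. -/
theorem card_filter_mul_sq_le {V : Type*} [Fintype V] (h : V → ℝ) {r : ℝ} (hr : 0 ≤ r) :
    ((Finset.univ.filter fun x => ¬ |h x| < r).card : ℝ) * r ^ 2 ≤ ∑ x, h x ^ 2 := by
  rw [← nsmul_eq_mul, ← Finset.sum_const]
  refine (Finset.sum_le_sum fun x hx => ?_).trans
    (Finset.sum_le_univ_sum_of_nonneg fun x => sq_nonneg (h x))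
  rw [← sq_abs (h x)]
  have := not_lt.1 (Finset.mem_filter.1 hx).2
  gcongr

theorem sum_colorClass {n k : ℕ} (χ : Fin n → Fin k) (a : Fin k) (f : Fin n → ℝ) :
    ∑ x ∈ colorClass χ a, f x = ∑ x, if χ x = a then f x else 0 := by
  rw [colorClass, Finset.sum_filter]

theorem model_eq {n k : ℕ} (A : Matrix (Fin n) (Fin n) ℝ) (χ : Fin n → Fin k) (a b : Fin k) :
    model A χ a b = (∑ x ∈ colorClass χ a, classWeight A χ b x) / (colorClass χ a).card := by
  rw [model, Matrix.of_apply]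
  congr 1
  refine Finset.sum_congr rfl fun x _ => ?_
  rw [sum_colorClass, classWeight]
  exact Finset.sum_congr rfl fun y _ => by split_ifs <;> simp

theorem model_mul_card {n k : ℕ} (A : Matrix (Fin n) (Fin n) ℝ) (χ : Fin n → Fin k)
    (a b : Fin k) :
    (colorClass χ a).card * model A χ a b = ∑ x ∈ colorClass χ a, classWeight A χ b x := by
  rw [model_eq]
  rcases (colorClass χ a).eq_empty_or_nonempty with h | h
  · rw [h]; simp
  · have : ((colorClass χ a).card : ℝ) ≠ 0 := by exact_mod_cast h.card_pos.ne'
    field_simp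

theorem IsExpanderMatrix.model_mem {n k : ℕ} {A : Matrix (Fin n) (Fin n) ℝ} {c : ℝ}
    (hA : IsExpanderMatrix A c) (χ : Fin n → Fin k) (a b : Fin k) :
    model A χ a b ∈ Set.Icc (0 : ℝ) 1 := by
  rw [model_eq]
  constructor
  · exact div_nonneg (Finset.sum_nonneg fun x _ => (hA.classWeight_mem χ b x).1)
      (Nat.cast_nonneg _)
  · refine div_le_one_of_le₀ ?_ (Nat.cast_nonneg _)
    refine (Finset.sum_le_sum fun x _ => (hA.classWeight_mem χ b x).2).trans ?_
    simp

/-- `2 ^ i` is the largest power of two that is at most `1 / (8 * c)`. -/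
theorem exists_boost_count {c : ℝ} (hc : 0 < c) (hc1 : c ≤ 1 / 8) :
    ∃ i : ℕ, 8 * c * 2 ^ i ≤ 1 ∧ 1 ≤ 16 * c * 2 ^ i := by
  obtain ⟨i, h1, h2⟩ := exists_nat_pow_near (x := 1 / (8 * c)) (y := 2)
    (by rw [le_div_iff₀ (by positivity)]; linarith) one_lt_two
  refine ⟨i, ?_, ?_⟩
  · rw [le_div_iff₀ (by positivity)] at h1; linarith
  · rw [div_lt_iff₀ (by positivity), pow_succ] at h2; linarith

set_option maxHeartbeats 1000000 in
/-- All but few vertices get the class of their color from a suitable table of labels. -/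
theorem exists_table {n k i j N P κ : ℕ} {M : Matrix (Fin k) (Fin k) ℝ} {γ c δ : ℝ}
    {A O : Matrix (Fin n) (Fin n) ℝ} {μ : Fin n → ℝ} {p : Matrix (Fin n) (Fin n) ℤ × ℤ}
    {χ : Fin n → Fin k} {U : Finset (Fin n)} {cl : Fin n → ℕ}
    (hγ : 0 < γ) (hgap : ∀ a b, (∀ e, |M a e - M b e| < γ) → M.row a = M.row b)
    (hP : 64 ≤ P * γ ^ 2) (hc : 0 < c) (hc1 : c ≤ 1 / 8)
    (hsmall : ∀ g : Fin n → ℝ, (∀ i, g i ∈ Set.Icc (0 : ℝ) 1) →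
      (∀ i, μ i ^ 2 ≤ 2 * c → Fintype.card (Fin n) * N * g i ≤ 1) →
      ∀ Z : Finset (Fin n), (∀ x ∈ Z, ∀ Y ⊆ Z, (∀ y ∈ Y, Near (specMatrix O g) P x y) →
        κ * Y.card ≤ Fintype.card (Fin n)) → (Z.card : ℝ) ≤ 2 * c * Fintype.card (Fin n))
    (hi : 8 * c * 2 ^ i ≤ 1) (hi' : 1 ≤ 16 * c * 2 ^ i) (hj : n * N ≤ 2 ^ j)
    (hj' : 1 ≤ c * 2 ^ j) (hA : IsExpanderMatrix A c) (h : IsDiagonalization A O μ)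
    (hp : Represents O p μ) (hδ : 0 < δ) (hδγ : δ ≤ γ / 8)
    (hM : ∀ a b, |M a b - model A χ a b| ≤ δ) (hU : (U.card : ℝ) ≤ δ * n)
    (hcover : ∀ x y, A x y ≠ 0 → χ x = χ y → x ∈ U ∨ y ∈ U)
    (hcl : IsClustering (intFilter i j p) P κ cl) {ρ : Fin k → ℕ} {m : ℕ}
    (hρm : ∀ a, ρ a < m) (hm : 0 < m) (hρ : ∀ a b, ρ a = ρ b ↔ M.row a = M.row b) :
    ∃ (σ : ℕ → ℕ) (B : Finset (Fin n)), (∀ l, σ l < m) ∧ (∀ x, x ∉ B → σ (cl x) = ρ (χ x)) ∧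
      (B.card : ℝ) ≤ (2 + 64 / γ ^ 2 * (112 * k + 6 * k ^ 2)) * (c + δ / c) * n := by
  classical
  set g : Fin n → ℝ := fun a => filterFun i j (μ a) with hg
  have hμ1 : ∀ a, |μ a| ≤ 1 := fun a => h.abs_le_one hA a
  have hg01 : ∀ a, g a ∈ Set.Icc (0 : ℝ) 1 := fun a => filterFun_mem i j (hμ1 a)
  have h2j : (0 : ℝ) < 2 ^ j := by positivity
  set q := intFilter i j p with hq
  have hrep : Represents O q g := h.represents_intFilter hp i j
  set F := specMatrix O g with hF
  have hPos : (0 : ℝ) < P := by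
    by_contra hcon
    have : (P : ℝ) = 0 := le_antisymm (not_lt.1 hcon) (Nat.cast_nonneg P)
    rw [this] at hP; linarith
  have hnear : ∀ x y, IntNear q P x y → Near F P x y := by
    intro x y hxy
    rw [IntNear] at hxy
    have h1 : (n : ℝ) * P * (q.1 x x + q.1 y y - 2 * q.1 x y) ≤ q.2 := by exact_mod_cast hxy
    rw [hrep.2, hrep.2, hrep.2] at h1
    have hq0 : (0 : ℝ) < q.2 := by exact_mod_cast hrep.1
    rw [Near, Fintype.card_fin]
    have h2 : (n * P * (F x x + F y y - 2 * F x y)) * q.2 ≤ 1 * q.2 := by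
      rw [hF]; linarith
    exact le_of_mul_le_mul_right h2 hq0
  -- weights of classes
  set f : Fin k → Fin n → ℝ := fun b => classWeight A χ b with hf
  set e : Fin k → Fin n → ℝ := fun b y => if χ y = b then 1 else 0 with he
  have hfe : ∀ b, f b = A.mulVec (e b) := fun b => rfl
  have he2 : ∀ b, ∑ y, e b y ^ 2 ≤ Fintype.card (Fin n) := by
    intro b
    calc ∑ y, e b y ^ 2 ≤ ∑ _y : Fin n, (1 : ℝ) := Finset.sum_le_sum fun y _ => by
          simp only [he]; split_ifs <;> norm_num
      _ = _ := by simp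
  have hf2 : ∀ b, ∑ y, f b y ^ 2 ≤ Fintype.card (Fin n) := by
    intro b
    calc ∑ y, f b y ^ 2 ≤ ∑ _y : Fin n, (1 : ℝ) := Finset.sum_le_sum fun y _ => by
          have := hA.classWeight_mem χ b y
          exact pow_le_one₀ this.1 this.2
      _ = _ := by simp
  -- If `μ² < 112 c`, then `0 ≤ 1 - g ≤ 1` is enough; otherwise `g` is within `c` of `1` and `|μ| ≤
  -- 1`. The intermediate range of the filter needs no control.
  have herr1 : ∀ b, ∑ x, (f b x - F.mulVec (f b) x) ^ 2 ≤ 112 * c * n := by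
    intro b
    have hle : ∀ a, ((1 - g a) * μ a) ^ 2 ≤ 112 * c := by
      intro a
      rw [mul_pow]
      have h1 := hg01 a
      have h3 : (1 - g a) ^ 2 ≤ 1 := pow_le_one₀ (by linarith [h1.2]) (by linarith [h1.1])
      have h4 := (sq_mem_Icc (hμ1 a))
      rcases le_or_gt (112 * c) (μ a ^ 2) with hc2 | hc2
      · have h5 := le_filterFun hi' j (hμ1 a) hc2
        have h6 : (1 : ℝ) / 2 ^ j ≤ c := by rw [div_le_iff₀ h2j]; exact hj'
        have h7 : (1 - g a) ^ 2 ≤ 1 - g a := by nlinarith [h1.1, h1.2]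
        have h8 : (1 - g a) ^ 2 * μ a ^ 2 ≤ c * 1 := by
          apply mul_le_mul (h7.trans (h5.trans h6)) h4.2 h4.1 hc.le
        linarith
      · have h8 : (1 - g a) ^ 2 * μ a ^ 2 ≤ 1 * (112 * c) :=
          mul_le_mul h3 hc2.le h4.1 zero_le_one
        linarith
    have := h.sum_sq_sub_filter_le hle (he2 b) (by positivity)
    rw [Fintype.card_fin] at this
    rw [hfe]
    exact this
  have herr2 : ∀ b, ∑ x, (f b x - model A χ (χ x) b) ^ 2 ≤ k * (6 * c + δ / c) * n := by
    intro b
    have h1 : ∀ a, ∑ x, (if χ x = a then f b x - model A χ a b else 0) ^ 2 ≤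
        (6 * c + δ / c) * n := by
      intro a
      have hmean : ∑ x, (if χ x = a then f b x - model A χ a b else 0) = 0 := by
        rw [← sum_colorClass, Finset.sum_sub_distrib, Finset.sum_const, nsmul_eq_mul,
          model_mul_card]
        exact sub_self _
      have := hA.sum_sq_classWeight_sub_le hc (by rwa [Fintype.card_fin]) hcover a b
        (hA.model_mem χ a b) hmean
      rw [Fintype.card_fin] at this
      refine this.trans ?_
      gcongr
      nlinarith
    have h2 : ∀ x, (f b x - model A χ (χ x) b) ^ 2 =
        ∑ a, (if χ x = a then f b x - model A χ a b else 0) ^ 2 := by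
      intro x
      rw [Finset.sum_eq_single (χ x)]
      · rw [if_pos rfl]
      · intro a _ ha
        rw [if_neg ha.symm]; simp
      · simp
    simp only [h2]
    rw [Finset.sum_comm]
    refine (Finset.sum_le_sum fun a _ => h1 a).trans ?_
    rw [Finset.sum_const, Finset.card_univ, Fintype.card_fin, nsmul_eq_mul, mul_assoc]
  set Z := Finset.univ.filter fun x => cl x = 0 with hZ
  have hZc : (Z.card : ℝ) ≤ 2 * c * n := by
    have := hsmall g hg01 (fun a ha => ?_) Z (fun x hx Y hYZ hY => ?_)
    · rwa [Fintype.card_fin] at this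
    · have h1 := filterFun_le hi j (hμ1 a) ha
      have h2 : (n * N : ℝ) ≤ 2 ^ j := by exact_mod_cast hj
      rw [Fintype.card_fin]
      calc n * N * g a ≤ 2 ^ j * (1 / 2 ^ j) :=
            mul_le_mul h2 h1 (hg01 a).1 h2j.le
        _ = 1 := by field_simp
    · rw [Fintype.card_fin]
      have hsub : Y ⊆ Y.filter fun y => IntNear q P x y := by
        intro y hy
        refine Finset.mem_filter.2 ⟨hy, ?_⟩
        have h1 := hY y hy
        rw [Near, Fintype.card_fin] at h1
        have hq0 : (0 : ℝ) < q.2 := by exact_mod_cast hrep.1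
        have h2 : (n : ℝ) * P * (q.1 x x + q.1 y y - 2 * q.1 x y) ≤ q.2 := by
          rw [hrep.2, hrep.2, hrep.2]
          have h3 := mul_le_mul_of_nonneg_right h1 hq0.le
          linarith
        rw [IntNear]
        exact_mod_cast h2
      exact hcl.sparse x Y fun y hy =>
        ⟨(Finset.mem_filter.1 (hYZ hy)).2, (Finset.mem_filter.1 (hsub hy)).2⟩
  set B1 : Fin k → Finset (Fin n) := fun b =>
    Finset.univ.filter fun x => ¬ |f b x - F.mulVec (f b) x| < γ / 8 with hB1
  set B2 : Fin k → Finset (Fin n) := fun b =>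
    Finset.univ.filter fun x => ¬ |f b x - model A χ (χ x) b| < γ / 8 with hB2
  set B : Finset (Fin n) := Z ∪ Finset.univ.biUnion (fun b => B1 b ∪ B2 b) with hB
  have hgood : ∀ x, x ∉ B → cl x ≠ 0 ∧ ∀ b, |f b x - F.mulVec (f b) x| < γ / 8 ∧
      |f b x - model A χ (χ x) b| < γ / 8 := by
    intro x hx
    simp only [hB, hZ, hB1, hB2, Finset.mem_union, Finset.mem_biUnion, Finset.mem_filter,
      Finset.mem_univ, true_and, not_or, not_exists, not_not] at hx
    exact hx
  have hsame : ∀ x y, x ∉ B → y ∉ B → cl x = cl y → ρ (χ x) = ρ (χ y) := by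
    intro x y hx hy hxy
    rw [hρ]
    obtain ⟨hx0, hxg⟩ := hgood x hx
    obtain ⟨-, hyg⟩ := hgood y hy
    obtain ⟨z, hz⟩ := hcl.near_center (cl x) hx0
    refine hgap _ _ fun b => ?_
    -- Nearness bounds `P` times the squared difference by `1`, and `64 ≤ P * γ ^ 2` turns this into
    -- `γ / 8`.
    have hctr : ∀ w, cl w = cl x → |F.mulVec (f b) z - F.mulVec (f b) w| ≤ γ / 8 := by
      intro w hw
      have h1 := h.sq_sub_le_of_near hg01 hPos (hnear z w (hz w hw)) (hf2 b)
      apply abs_le_of_sq_le_sq _ (by positivity)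
      rw [← hF] at h1
      by_contra hcon
      have h2 := mul_lt_mul_of_pos_left (not_le.1 hcon) hPos
      have h3 : (P : ℝ) * (γ / 8) ^ 2 = P * γ ^ 2 / 64 := by ring
      linarith
    have a1 := abs_le.1 (hM (χ x) b)
    have a2 := abs_le.1 (hM (χ y) b)
    have a3 := abs_lt.1 (hxg b).1
    have a4 := abs_lt.1 (hxg b).2
    have a5 := abs_lt.1 (hyg b).1
    have a6 := abs_lt.1 (hyg b).2
    have a7 := abs_le.1 (hctr x rfl)
    have a8 := abs_le.1 (hctr y hxy.symm)
    -- The entries of `M` at `χ x` and `χ y` are linked through the model, the weight, the filtered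
    -- weight and the center `z`: eight errors of at most `γ / 8`, four of them strict.
    rw [abs_lt]
    constructor <;> linarith
  -- By `hsame` any good vertex of a cluster determines its class; clusters without good vertices
  -- get an arbitrary admissible value.
  refine ⟨fun l => if hl : ∃ x, x ∉ B ∧ cl x = l then ρ (χ hl.choose) else 0, B, ?_, ?_, ?_⟩
  · intro l
    dsimp only
    split_ifs
    exacts [hρm _, hm]
  · intro x hx
    have hl : ∃ y, y ∉ B ∧ cl y = cl x := ⟨x, hx, rfl⟩
    dsimp only
    rw [dif_pos hl]
    exact hsame _ _ hl.choose_spec.1 hx hl.choose_spec.2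
  · have hcast : (B.card : ℝ) ≤ Z.card + ∑ b, (((B1 b).card : ℝ) + (B2 b).card) := by
      have : B.card ≤ Z.card + ∑ b, ((B1 b).card + (B2 b).card) := by
        refine (Finset.card_union_le _ _).trans (Nat.add_le_add_left ?_ _)
        exact Finset.card_biUnion_le.trans (Finset.sum_le_sum fun b _ => Finset.card_union_le _ _)
      exact_mod_cast this
    have hγ8 : 0 ≤ γ / 8 := by positivity
    have hone : ∀ b, ((B1 b).card : ℝ) + (B2 b).card ≤
        64 / γ ^ 2 * (112 * c * n + k * (6 * c + δ / c) * n) := by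
      intro b
      have h1 := (card_filter_mul_sq_le (fun x => f b x - F.mulVec (f b) x) hγ8).trans (herr1 b)
      have h2 := (card_filter_mul_sq_le (fun x => f b x - model A χ (χ x) b) hγ8).trans
        (herr2 b)
      have h3 : (((B1 b).card : ℝ) + (B2 b).card) * (γ / 8) ^ 2 ≤
          112 * c * n + k * (6 * c + δ / c) * n := by
        rw [add_mul]; exact add_le_add h1 h2
      have h4 : ((B1 b).card : ℝ) + (B2 b).card =
          64 / γ ^ 2 * ((((B1 b).card : ℝ) + (B2 b).card) * (γ / 8) ^ 2) := by
        field_simp; ring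
      rw [h4]
      gcongr
    have hsum : ∑ b, (((B1 b).card : ℝ) + (B2 b).card) ≤
        k * (64 / γ ^ 2 * (112 * c * n + k * (6 * c + δ / c) * n)) := by
      refine (Finset.sum_le_sum fun b _ => hone b).trans ?_
      rw [Finset.sum_const, Finset.card_univ, Fintype.card_fin, nsmul_eq_mul]
    have hdc : 0 ≤ δ / c := by positivity
    have hn0 : (0 : ℝ) ≤ n := Nat.cast_nonneg n
    have e1 : k * (64 / γ ^ 2 * (112 * c * n + k * (6 * c + δ / c) * n)) =
        64 / γ ^ 2 * (112 * k) * c * n + 64 / γ ^ 2 * k ^ 2 * (6 * c + δ / c) * n := by ring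
    have e2 : 64 / γ ^ 2 * (112 * k) * c * n ≤ 64 / γ ^ 2 * (112 * k) * (c + δ / c) * n := by
      gcongr; linarith
    have e3 : 64 / γ ^ 2 * k ^ 2 * (6 * c + δ / c) * n ≤
        64 / γ ^ 2 * k ^ 2 * (6 * (c + δ / c)) * n := by
      gcongr; linarith
    have e4 : 2 * c * n ≤ 2 * (c + δ / c) * n := by gcongr; linarith
    calc (B.card : ℝ) ≤ _ := hcast
      _ ≤ 2 * (c + δ / c) * n + (64 / γ ^ 2 * (112 * k) * (c + δ / c) * n +
        64 / γ ^ 2 * k ^ 2 * (6 * (c + δ / c)) * n) := by linarith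
      _ = _ := by ring

/-- Parameters for which every clustering yields a good coloring. -/
theorem exists_parameters {k : ℕ} {M : Matrix (Fin k) (Fin k) ℝ}
    (hM : IsReversibleRowStochastic M) (hsec : secondEigenvalue M ≤ 0) :
    ∃ (C δ₀ lam₀ : ℝ) (P : ℕ), 0 < C ∧ 0 < δ₀ ∧ 0 < lam₀ ∧ 0 < P ∧ 0 < rowCount M ∧
      ∀ lam : ℝ, 0 < lam → lam ≤ lam₀ → ∃ i N κ : ℕ, 0 < N ∧ 0 < κ ∧
        ∀ δ : ℝ, 0 < δ → δ ≤ δ₀ → ∀ (n d : ℕ) (G : SimpleGraph (Fin n)) [DecidableRel G.Adj],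
          G.IsRegularOfDegree d → IsModelColorable G M δ → IsOneSidedExpander G lam →
          0 < n ∧ 0 < d ∧ ∀ (j : ℕ) (cl : Fin n → ℕ), n * N ≤ 2 ^ j →
          IsClustering (intFilter i j (G.adjMatrix ℤ, (d : ℤ))) P κ cl →
          ∃ σ : ℕ → ℕ, (∀ l, σ l < rowCount M) ∧
            ∀ L : Finset (Fin n), IsRounding G (fun x => σ (cl x)) L →
            ∀ (π : Fin k → ℝ) (k' : ℕ) (S : Fin k' → Finset (Fin k)) (aStar : Fin k' → Fin k),
              IsStationaryDistribution M π → IsRowPartition M S → (∀ i, aStar i ∈ S i) →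
              (∑ i, max 0 (π (aStar i) - ∑ a ∈ (S i).erase (aStar i), π a) -
                C * (√δ + lam + δ / lam)) * n ≤ L.card := by
  obtain ⟨π₀, hπ₀, -⟩ := hM.detailed_balance
  have hk : 0 < k := by
    rcases Nat.eq_zero_or_pos k with rfl | h
    · have := hπ₀.sum_eq_one
      simp at this
    · exact h
  have hkR : (0 : ℝ) < k := by exact_mod_cast hk
  obtain ⟨γ, hγ, hgap⟩ := exists_gap M
  obtain ⟨C₂, hC₂, hstab⟩ := exists_stationary_stability hM hsec
  obtain ⟨ρ, hρlt, hρ⟩ := exists_rowIndex M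
  have hm : 0 < rowCount M := (Nat.zero_le _).trans_lt (hρlt ⟨0, hk⟩)
  obtain ⟨P, hP⟩ := exists_nat_gt (64 / γ ^ 2)
  have hP0 : (0 : ℝ) < P := lt_of_le_of_lt (by positivity) hP
  rw [div_lt_iff₀ (by positivity)] at hP
  set C₁ : ℝ := 2 + 64 / γ ^ 2 * (112 * k + 6 * k ^ 2) with hC₁
  have hC₁0 : 0 < C₁ := by positivity
  -- `3 * C₁ + 2` comes from `IsRounding.le_card`, and `k * k * C₂` from replacing class frequencies
  -- by `π` in at most `k` maxima of at most `k` terms each. The bounds on `δ` serve for `δ ≤ √δ`,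
  -- for the gap, and for excluding a zero model, which gives `0 < n` and `0 < d`.
  refine ⟨3 * C₁ + 2 + k * k * C₂, min (min 1 (γ / 8)) (1 / (2 * k)), 1 / 8, P, by positivity,
    by positivity, by norm_num, by exact_mod_cast hP0, hm, fun lam hlam hlam1 => ?_⟩
  obtain ⟨i, hi, hi'⟩ := exists_boost_count hlam hlam1
  obtain ⟨N, κ, hN, hκ, hsmall⟩ := exists_card_le_of_near hlam (by linarith) hP0
  -- Enlarging `N` by the factor `l` makes the single condition on `2 ^ j` also imply `1 ≤ lam * 2 ^
  -- j`.
  obtain ⟨l, hl⟩ := exists_nat_ge (1 / lam)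
  have hl0 : (0 : ℝ) < l := lt_of_lt_of_le (by positivity) hl
  have hl1 : 0 < l := by exact_mod_cast hl0
  refine ⟨i, N * l, κ, Nat.mul_pos hN hl1, hκ, fun δ hδ hδ₀ n d G _ hreg hcol hexp => ?_⟩
  have hδ1 : δ ≤ 1 := hδ₀.trans ((min_le_left _ _).trans (min_le_left _ _))
  have hδγ : δ ≤ γ / 8 := hδ₀.trans ((min_le_left _ _).trans (min_le_right _ _))
  have hδk : δ ≤ 1 / (2 * k) := hδ₀.trans (min_le_right _ _)
  obtain ⟨χ, hχ, U, hUc, hU⟩ := hcol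
  -- the model is not identically zero
  have hmodel : ∃ a b, model (normAdj G) χ a b ≠ 0 := by
    by_contra! hcon
    have h1 : ∀ b, M ⟨0, hk⟩ b ≤ 1 / (2 * k) := fun b => by
      have := hχ ⟨0, hk⟩ b
      rw [hcon, sub_zero] at this
      exact (le_abs_self _).trans (this.trans hδk)
    have h2 := Finset.sum_le_sum fun b (_ : b ∈ Finset.univ) => h1 b
    rw [hM.row_sum, Finset.sum_const, Finset.card_univ, Fintype.card_fin, nsmul_eq_mul] at h2
    have h3 : (k : ℝ) * (1 / (2 * k)) = 1 / 2 := by field_simp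
    linarith
  have hnd : 0 < n ∧ 0 < d := by
    obtain ⟨a, b, hab⟩ := hmodel
    rw [model_eq] at hab
    have h1 := Finset.exists_ne_zero_of_sum_ne_zero (div_ne_zero_iff.1 hab).1
    obtain ⟨x, -, hx⟩ := h1
    obtain ⟨y, -, hy⟩ := Finset.exists_ne_zero_of_sum_ne_zero hx
    refine ⟨x.pos, Nat.pos_of_ne_zero ?_⟩
    rintro rfl
    rw [hreg.normAdj_apply] at hy
    simp at hy
  obtain ⟨hn, hd⟩ := hnd
  refine ⟨hn, hd, fun j cl hj hcl => ?_⟩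
  obtain ⟨hA, O, μ, hO, hμ⟩ := hreg.isExpanderMatrix hd (by linarith) hexp
  have hdR : (0 : ℝ) < d := by exact_mod_cast hd
  have hnR : (0 : ℝ) < n := by exact_mod_cast hn
  have hrep : Represents O (G.adjMatrix ℤ, (d : ℤ)) μ := by
    refine ⟨Int.natCast_pos.2 hd, fun x y => ?_⟩
    have h1 : specMatrix O μ = normAdj G := hO.eq.symm
    rw [h1, hreg.normAdj_apply]
    simp only [SimpleGraph.adjMatrix_apply]
    push_cast
    field_simp
  have hcover : ∀ x y, normAdj G x y ≠ 0 → χ x = χ y → x ∈ U ∨ y ∈ U := by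
    intro x y hxy
    refine hU x y ?_
    by_contra hcon
    rw [hreg.normAdj_apply, SimpleGraph.adjMatrix_apply, if_neg hcon] at hxy
    simp at hxy
  have hjN : n * N ≤ 2 ^ j := le_trans (by
    rw [← mul_assoc]; exact Nat.le_mul_of_pos_right _ hl1) hj
  have hjl : (1 : ℝ) ≤ lam * 2 ^ j := by
    have h1 : l ≤ 2 ^ j := le_trans (by
      rw [← mul_assoc]; exact Nat.le_mul_of_pos_left _ (Nat.mul_pos hn hN)) hj
    have h2 : (l : ℝ) ≤ 2 ^ j := by exact_mod_cast h1
    rw [div_le_iff₀ hlam] at hl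
    nlinarith
  obtain ⟨σ, B, hσ, hB, hBc⟩ := exists_table hγ hgap hP.le hlam hlam1
    (fun g hg hg' Z hZ => hsmall hO hA hμ hg hg' Z hZ) hi hi' hjN hjl hA hO hrep hδ hδγ hχ hUc
    hcover hcl hρlt hm hρ
  refine ⟨σ, hσ, fun L hL π k' S aStar hπ hS haS => ?_⟩
  have hSρ : ∀ i j, ∀ a ∈ S i, ∀ b ∈ S j, ρ a = ρ b ↔ i = j := by
    intro i j a ha b hb
    rw [hρ]
    constructor
    · intro h
      by_contra hne
      exact hS.row_ne i j hne a ha b hb h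
    · rintro rfl
      exact hS.row_eq i a ha b hb
  have hmain := hL.le_card hB hU haS hS.cover hSρ
  -- relative sizes of the classes
  set p : Fin k → ℝ := fun a => (colorClass χ a).card / n with hp
  have hp1 : ∑ a, p a = 1 := by
    simp only [hp, ← Finset.sum_div]
    rw [div_eq_one_iff_eq hnR.ne']
    have := Finset.card_eq_sum_card_fiberwise (f := χ) (s := Finset.univ) (t := Finset.univ)
      (fun x _ => Finset.mem_coe.2 (Finset.mem_univ _))
    rw [Finset.card_univ, Fintype.card_fin] at this
    exact_mod_cast this.symm
  have hp0 : ∀ a, 0 ≤ p a := fun a => by positivity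
  -- The frequencies are exactly stationary for the model, because the columns of the adjacency
  -- matrix sum to one; passing from the model to `M` costs at most `δ`.
  have hpst : ∀ b, |∑ a, p a * M a b - p b| ≤ δ := by
    intro b
    have h1 : ∑ a, p a * model (normAdj G) χ a b = p b := by
      have h2 : ∀ a, p a * model (normAdj G) χ a b =
          (∑ x ∈ colorClass χ a, classWeight (normAdj G) χ b x) / n := by
        intro a
        rw [← model_mul_card]; simp only [hp]; ring
      simp only [h2, ← Finset.sum_div]
      simp only [hp]
      congr 1
      simp only [sum_colorClass]
      rw [Finset.sum_comm]
      have h3 : ∀ x, (∑ a, if χ x = a then classWeight (normAdj G) χ b x else 0) =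
          classWeight (normAdj G) χ b x := fun x => by
        rw [Finset.sum_ite_eq]; simp
      rw [Finset.sum_congr rfl fun x _ => h3 x]
      refine (hA.sum_right fun y => if χ y = b then 1 else 0).trans ?_
      rw [Finset.sum_boole]
      rfl
    rw [← h1, ← Finset.sum_sub_distrib]
    calc |∑ a, (p a * M a b - p a * model (normAdj G) χ a b)|
        ≤ ∑ a, |p a * M a b - p a * model (normAdj G) χ a b| := Finset.abs_sum_le_sum_abs _ _
      _ ≤ ∑ a, p a * δ := by
          refine Finset.sum_le_sum fun a _ => ?_
          rw [← mul_sub, abs_mul, abs_of_nonneg (hp0 a)]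
          exact mul_le_mul_of_nonneg_left (hχ a b) (hp0 a)
      _ = δ := by rw [← Finset.sum_mul, hp1, one_mul]
  have hpπ := hstab π p δ hπ hp1 hpst
  have hk' : k' ≤ k := by
    have hinj : Function.Injective aStar := by
      intro i j hij
      by_contra hne
      exact hS.row_ne i j hne _ (haS i) _ (haS j) (by rw [hij])
    simpa using Fintype.card_le_of_injective _ hinj
  have hterm : ∀ i, max 0 (π (aStar i) - ∑ a ∈ (S i).erase (aStar i), π a) ≤
      max 0 (p (aStar i) - ∑ a ∈ (S i).erase (aStar i), p a) + k * (C₂ * δ) := by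
    intro i
    have h0 : 0 ≤ C₂ * δ := by positivity
    have h1 : ∑ a ∈ (S i).erase (aStar i), (p a - π a) ≤
        ∑ a ∈ (S i).erase (aStar i), C₂ * δ :=
      Finset.sum_le_sum fun a _ => (le_abs_self _).trans (hpπ a)
    rw [Finset.sum_sub_distrib, Finset.sum_const, nsmul_eq_mul] at h1
    have h2 := (abs_le.1 (hpπ (aStar i))).1
    have h3 : (((S i).erase (aStar i)).card : ℝ) + 1 ≤ k := by
      have := Finset.card_erase_add_one (haS i)
      have h4 := Finset.card_le_univ (S i)
      rw [Fintype.card_fin] at h4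
      exact_mod_cast this.trans_le h4
    have h5 : (((S i).erase (aStar i)).card : ℝ) * (C₂ * δ) + C₂ * δ ≤ k * (C₂ * δ) := by
      have := mul_le_mul_of_nonneg_right h3 h0
      linarith
    refine max_le ?_ ?_
    · have := le_max_left 0 (p (aStar i) - ∑ a ∈ (S i).erase (aStar i), p a)
      positivity
    · have := le_max_right 0 (p (aStar i) - ∑ a ∈ (S i).erase (aStar i), p a)
      linarith
  have hsum : ∑ i, max 0 (π (aStar i) - ∑ a ∈ (S i).erase (aStar i), π a) ≤
      ∑ i, max 0 (p (aStar i) - ∑ a ∈ (S i).erase (aStar i), p a) + k * k * C₂ * δ := by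
    refine (Finset.sum_le_sum fun i _ => hterm i).trans ?_
    rw [Finset.sum_add_distrib, Finset.sum_const, Finset.card_univ, Fintype.card_fin,
      nsmul_eq_mul]
    have : (k' : ℝ) * (k * (C₂ * δ)) ≤ k * (k * (C₂ * δ)) := by gcongr
    linarith
  have hpn : (∑ i, max 0 (p (aStar i) - ∑ a ∈ (S i).erase (aStar i), p a)) * n =
      ∑ i, max 0 (((Finset.univ.filter fun x => χ x = aStar i).card : ℝ) -
        ∑ a ∈ (S i).erase (aStar i), ((Finset.univ.filter fun x => χ x = a).card : ℝ)) := by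
    rw [Finset.sum_mul]
    refine Finset.sum_congr rfl fun i _ => ?_
    rw [max_mul_of_nonneg _ _ hnR.le, zero_mul, sub_mul, Finset.sum_mul]
    have h1 : ∀ a, p a * n = ((Finset.univ.filter fun x => χ x = a).card : ℝ) := fun a => by
      simp only [hp]; rw [div_mul_cancel₀ _ hnR.ne']; rfl
    simp only [h1]
  have hsq : δ ≤ √δ := by
    rw [Real.le_sqrt hδ.le hδ.le]; nlinarith
  have hdl : 0 ≤ δ / lam := by positivity
  set η := √δ + lam + δ / lam with hη
  have b1 : (B.card : ℝ) ≤ C₁ * η * n := hBc.trans (by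
    gcongr; rw [hη]; linarith [Real.sqrt_nonneg δ])
  have hδη : δ ≤ η := by rw [hη]; linarith
  have b2 : (U.card : ℝ) ≤ η * n := hUc.trans (by gcongr)
  have b3 : k * k * C₂ * δ ≤ k * k * C₂ * η := by gcongr
  have b4 := mul_le_mul_of_nonneg_right (hsum.trans (add_le_add_right b3 _)) hnR.le
  rw [add_mul, hpn] at b4
  have b5 : (3 * C₁ + 2 + k * k * C₂) * η * n =
      3 * (C₁ * η * n) + 2 * (η * n) + k * k * C₂ * η * n := by ring
  rw [sub_mul, b5]
  linarith

/-! ### Reasoning about programs -/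

/-- The arrays that are assigned to. -/
def Program.writes : Program → List ℕ
  | .nop => []
  | .assign a _ _ => [a]
  | .seq p q => p.writes ++ q.writes
  | .cond _ p q => p.writes ++ q.writes
  | .loop _ p => p.writes

theorem Memory.write_of_ne (s : Memory) {a b : ℕ} (i z : ℤ) (h : b ≠ a) :
    s.write a i z b = s b := by
  funext j
  simp [Memory.write, h]

theorem Memory.write_apply (s : Memory) (a : ℕ) (i z j : ℤ) :
    s.write a i z a j = if j = i then z else s a j := by
  simp [Memory.write]

@[simp]
theorem Memory.write_self (s : Memory) (a : ℕ) (i z : ℤ) : s.write a i z a i = z := by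
  simp [Memory.write]

theorem Exec.frame {p : Program} {s s' : Memory} {t : ℕ} (h : Exec p s t s') :
    ∀ a, a ∉ p.writes → s' a = s a := by
  induction h with
  | nop => intro a _; rfl
  | assign a i e s =>
    intro b hb
    exact Memory.write_of_ne _ _ _ (by simpa [Program.writes] using hb)
  | seq _ _ ih1 ih2 =>
    intro b hb
    simp only [Program.writes, List.mem_append, not_or] at hb
    rw [ih2 b hb.2, ih1 b hb.1]
  | cond_true _ _ ih =>
    intro b hb
    simp only [Program.writes, List.mem_append, not_or] at hb
    exact ih b hb.1
  | cond_false _ _ ih =>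
    intro b hb
    simp only [Program.writes, List.mem_append, not_or] at hb
    exact ih b hb.2
  | loop_true _ _ _ ih1 ih2 =>
    intro b hb
    rw [ih2 b hb, ih1 b hb]
  | loop_false => intro b _; rfl

/-- The program `p`, started with memory `s`, halts after at most `T` time units with a memory that
satisfies `Q`. -/
def Runs (p : Program) (s : Memory) (T : ℕ) (Q : Memory → Prop) : Prop :=
  ∃ t s', Exec p s t s' ∧ t ≤ T ∧ Q s'

namespace Runs

variable {p q body : Program} {s : Memory} {T T' B c c' d d' v a : ℕ} {Q R : Memory → Prop}
  {e i : Expr}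

theorem mono (h : Runs p s T Q) (hT : T ≤ T') (hQ : ∀ s', Q s' → R s') : Runs p s T' R := by
  obtain ⟨t, s', h1, h2, h3⟩ := h
  exact ⟨t, s', h1, h2.trans hT, hQ s' h3⟩

theorem imp (h : Runs p s T Q) (hQ : ∀ s', Q s' → R s') : Runs p s T R := h.mono le_rfl hQ

/-- Running times are kept in the form `c * B ^ d`, with one `B` that bounds loop lengths and bit
lengths; this aligns exponents for `Runs.seqB`. -/
theorem raise (h : Runs p s (c * B ^ d) Q) (hB : 1 ≤ B) (hc : c ≤ c') (hd : d ≤ d') :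
    Runs p s (c' * B ^ d') Q :=
  h.mono (Nat.mul_le_mul hc (Nat.pow_le_pow_right hB hd)) fun _ => id

theorem frame (h : Runs p s T Q) : Runs p s T fun s' => Q s' ∧ ∀ a, a ∉ p.writes → s' a = s a := by
  obtain ⟨t, s', h1, h2, h3⟩ := h
  exact ⟨t, s', h1, h2, h3, h1.frame⟩

theorem nop (hT : 1 ≤ T) (hQ : Q s) : Runs .nop s T Q := ⟨1, s, Exec.nop s, hT, hQ⟩

theorem assign (hT : i.time s + e.time s + 1 ≤ T) (hQ : Q (s.write a (i.eval s) (e.eval s))) :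
    Runs (.assign a i e) s T Q := ⟨_, _, Exec.assign a i e s, hT, hQ⟩

theorem seq (hp : Runs p s T Q) (hq : ∀ s', Q s' → Runs q s' T' R) :
    Runs (.seq p q) s (T + T') R := by
  obtain ⟨t, s', h1, h2, h3⟩ := hp
  obtain ⟨t', s'', h4, h5, h6⟩ := hq s' h3
  exact ⟨_, _, Exec.seq h1 h4, add_le_add h2 h5, h6⟩

theorem seqB (hp : Runs p s (c * B ^ d) Q) (hq : ∀ s', Q s' → Runs q s' (c' * B ^ d) R) :
    Runs (.seq p q) s ((c + c') * B ^ d) R := by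
  rw [add_mul]; exact hp.seq hq

theorem cond (hp : e.eval s ≠ 0 → Runs p s T Q) (hq : e.eval s = 0 → Runs q s T Q)
    (hT : e.time s + 1 + T ≤ T') : Runs (.cond e p q) s T' Q := by
  by_cases he : e.eval s = 0
  · obtain ⟨t, s', h1, h2, h3⟩ := hq he
    exact ⟨_, _, Exec.cond_false he h1, by omega, h3⟩
  · obtain ⟨t, s', h1, h2, h3⟩ := hp he
    exact ⟨_, _, Exec.cond_true he h1, by omega, h3⟩

theorem loop {I : ℕ → Memory → Prop} {te : ℕ} (n : ℕ) (h0 : I 0 s)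
    (hstep : ∀ m < n, ∀ s, I m s → e.eval s ≠ 0 ∧ e.time s ≤ te ∧ Runs p s T (I (m + 1)))
    (hend : ∀ s, I n s → e.eval s = 0 ∧ e.time s ≤ te) :
    Runs (.loop e p) s (n * (te + 1 + T) + (te + 1)) (I n) := by
  have key : ∀ r m, m + r = n → ∀ s, I m s →
      Runs (.loop e p) s (r * (te + 1 + T) + (te + 1)) (I n) := by
    intro r
    induction r with
    | zero =>
      intro m hm s hs
      obtain rfl : m = n := by omega
      obtain ⟨h1, h2⟩ := hend s hs
      exact ⟨_, _, Exec.loop_false h1, by omega, hs⟩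
    | succ r ih =>
      intro m hm s hs
      obtain ⟨h1, h2, t, s', h3, h4, h5⟩ := hstep m (by omega) s hs
      obtain ⟨t', s'', h6, h7, h8⟩ := ih (m + 1) (by omega) s' h5
      refine ⟨_, _, Exec.loop_true h1 h3 h6, ?_, h8⟩
      rw [add_mul, one_mul]
      omega
  exact key n 0 (by omega) s h0

end Runs

/-- The content of cell `0` of array `a`. -/
def Expr.var (a : ℕ) : Expr := .read a (.const 0)

instance : Add Expr := ⟨Expr.add⟩
instance : Sub Expr := ⟨Expr.sub⟩
instance : Mul Expr := ⟨Expr.mul⟩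
instance : Div Expr := ⟨Expr.div⟩

namespace Expr

variable (s : Memory) (e f : Expr)

theorem eval_const (z : ℤ) : (const z).eval s = z := rfl
theorem eval_read (a : ℕ) : (read a e).eval s = s a (e.eval s) := rfl
theorem eval_var (a : ℕ) : (var a).eval s = s a 0 := rfl
theorem eval_add : (e + f).eval s = e.eval s + f.eval s := rfl
theorem eval_sub : (e - f).eval s = e.eval s - f.eval s := rfl
theorem eval_mul : (e * f).eval s = e.eval s * f.eval s := rfl
theorem eval_div : (e / f).eval s = e.eval s / f.eval s := rfl
theorem eval_lt : (lt e f).eval s = if e.eval s < f.eval s then 1 else 0 := rfl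
theorem time_const (z : ℤ) : (const z).time s = 1 := rfl
theorem time_read (a : ℕ) : (read a e).time s = e.time s + 1 := rfl
theorem time_var (a : ℕ) : (var a).time s = 2 := rfl
theorem time_add : (e + f).time s = e.time s + f.time s + 1 := rfl
theorem time_sub : (e - f).time s = e.time s + f.time s + 1 := rfl
theorem time_mul : (e * f).time s =
    e.time s + f.time s + 1 + bitLength (e.eval s) + bitLength (f.eval s) := rfl
theorem time_div : (e / f).time s =
    e.time s + f.time s + 1 + bitLength (e.eval s) + bitLength (f.eval s) := rfl
theorem time_lt : (lt e f).time s = e.time s + f.time s + 1 := rfl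

end Expr

theorem bitLength_le_natAbs (z : ℤ) : bitLength z ≤ z.natAbs := by
  rw [bitLength, Nat.size_le]
  exact Nat.lt_two_pow_self

theorem bitLength_natCast_le {m B : ℕ} (h : m ≤ B) : bitLength (m : ℤ) ≤ B :=
  (bitLength_le_natAbs _).trans (by simpa using h)

theorem bitLength_le_size {z : ℤ} {H : ℕ} (h : |z| ≤ H) : bitLength z ≤ H.size := by
  apply Nat.size_le_size
  have : (z.natAbs : ℤ) ≤ H := by rwa [Int.natCast_natAbs]
  exact_mod_cast this

open Expr in
/-- `for v = 0, …, N - 1 do body`, where `N` is the content of cell `0` of array `a`. -/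
def forLoop (v a : ℕ) (body : Program) : Program :=
  .seq (.assign v (const 0) (const 0))
    (.loop (lt (var v) (var a)) (.seq body (.assign v (const 0) (var v + const 1))))

theorem forLoop_writes (v a : ℕ) (body : Program) :
    (forLoop v a body).writes = v :: (body.writes ++ [v]) := rfl

namespace Runs

variable {body : Program} {s : Memory} {B c d v a : ℕ}

/-- The body must leave the counter and the bound alone, and `I` must not depend on the counter's
cell. A loop raises the exponent of `B` by one; the `30` absorbs the tests and increments. -/
theorem forLoop {I : ℕ → Memory → Prop} {n : ℕ} (hB : 1 ≤ B) (hn : n ≤ B)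
    (hv : v ∉ body.writes) (ha : a ∉ v :: body.writes) (hsa : s a 0 = n)
    (hIv : ∀ m s z, I m s → I m (s.write v 0 z)) (h0 : I 0 s)
    (hstep : ∀ m < n, ∀ s', I m s' → s' v 0 = m → (∀ b, b ∉ v :: body.writes → s' b = s b) →
      Runs body s' (c * B ^ d) (I (m + 1))) :
    Runs (forLoop v a body) s ((c + 30) * B ^ (d + 1))
      (fun s' => I n s' ∧ ∀ b, b ∉ v :: body.writes → s' b = s b) := by
  have hframe : ∀ {s' : Memory}, (∀ b, b ∉ v :: body.writes → s' b = s b) → s' a 0 = n := by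
    intro s' h
    rw [h a ha, hsa]
  have hinit : Runs (.assign v (.const 0) (.const 0)) s 3 (fun s' => I 0 s' ∧ s' v 0 = (0 : ℕ) ∧
      ∀ b, b ∉ v :: body.writes → s' b = s b) := by
    refine Runs.assign (by simp [Expr.time]) ⟨hIv _ _ _ h0, by simp [Expr.eval], ?_⟩
    intro b hb
    exact Memory.write_of_ne _ _ _ fun h => hb (by simp [h])
  have hBd : 1 ≤ B ^ d := Nat.one_le_pow _ _ hB
  have hmain := hinit.seq (T' := n * (5 + 1 + (c * B ^ d + 6)) + (5 + 1)) fun s₁ hs₁ =>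
    (Runs.loop (e := .lt (.var v) (.var a))
      (p := .seq body (.assign v (.const 0) (.var v + .const 1))) 
      (I := fun m s' => I m s' ∧ s' v 0 = m ∧ ∀ b, b ∉ v :: body.writes → s' b = s b) n hs₁
      (fun m hm s' hs' => by
        refine ⟨?_, by simp [Expr.time_lt, Expr.time_var], ?_⟩
        · rw [Expr.eval_lt, Expr.eval_var, Expr.eval_var, hs'.2.1, hframe hs'.2.2,
            if_pos (by exact_mod_cast hm)]
          exact one_ne_zero
        · refine (hstep m hm s' hs'.1 hs'.2.1 hs'.2.2).frame.seq fun s'' hs'' => ?_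
          refine Runs.assign (by simp [Expr.time_add, Expr.time_var, Expr.time_const]) ?_
          rw [Expr.eval_const, Expr.eval_add, Expr.eval_var, Expr.eval_const]
          have hvs : s'' v 0 = m := by rw [hs''.2 v hv, hs'.2.1]
          refine ⟨hIv _ _ _ hs''.1, by rw [Memory.write_self, hvs]; push_cast; rfl, ?_⟩
          intro b hb
          rw [Memory.write_of_ne _ _ _ fun h => hb (by simp [h]),
            hs''.2 b fun h => hb (List.mem_cons_of_mem _ h), hs'.2.2 b hb])
      (fun s' hs' => by
        refine ⟨?_, by simp [Expr.time_lt, Expr.time_var]⟩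
        rw [Expr.eval_lt, Expr.eval_var, Expr.eval_var, hs'.2.1, hframe hs'.2.2,
          if_neg (lt_irrefl _)]))
  refine hmain.mono ?_ fun s' h => ⟨h.1, h.2.2⟩
  · rw [pow_succ]
    have h1 : n * (5 + 1 + (c * B ^ d + 6)) ≤ B * (c * B ^ d + 12 * B ^ d) :=
      Nat.mul_le_mul hn (by omega)
    have h2 : 1 ≤ B ^ d * B := Nat.mul_pos hBd hB
    have h3 : B * (c * B ^ d + 12 * B ^ d) = (c + 12) * (B ^ d * B) := by ring
    have h4 : (c + 30) * (B ^ d * B) = (c + 12) * (B ^ d * B) + 18 * (B ^ d * B) := by ring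
    omega

/-- A loop that fills an array. -/
theorem fill {arr n : ℕ} {e : Expr} {val : ℕ → ℤ} (hB : 1 ≤ B) (hn : n ≤ B) (hv : v ≠ arr)
    (hav : a ≠ v) (haa : a ≠ arr) (hsa : s a 0 = n)
    (he : ∀ m < n, ∀ s' : Memory, s' v 0 = m → (∀ b, b ≠ v → b ≠ arr → s' b = s b) →
      s' arr m = s arr m → e.eval s' = val m ∧ e.time s' ≤ c * B) :
    Runs (_root_.forLoop v a (.assign arr (.var v) e)) s ((c + 33) * B ^ 2)
      (fun s' => (∀ m < n, s' arr m = val m) ∧ ∀ b, b ≠ v → b ≠ arr → s' b = s b) := by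
  have h := Runs.forLoop (body := .assign arr (.var v) e) (s := s) (v := v) (a := a) (B := B)
    (c := c + 3) (d := 1) (I := fun m s' => (∀ l < m, s' arr l = val l) ∧
      ∀ l : ℕ, m ≤ l → s' arr l = s arr l) hB hn
    (by simpa [Program.writes] using hv) (by simp [Program.writes, hav, haa]) hsa
    (fun m s' z h => by rw [Memory.write_of_ne _ _ _ hv.symm]; exact h)
    ⟨by simp, fun _ _ => rfl⟩
    (fun m hm s' hI hsv hfr => by
      obtain ⟨h1, h2⟩ := he m hm s' hsv (fun b h1 h2 => hfr b (by simp [Program.writes, h1, h2]))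
        (hI.2 m le_rfl)
      refine Runs.assign ?_ ?_
      · rw [Expr.time_var, pow_one, add_mul]; omega
      · rw [Expr.eval_var, hsv, h1]
        refine ⟨fun l hl => ?_, fun l hl => ?_⟩
        · rw [Memory.write_apply]
          rcases Nat.lt_succ_iff_lt_or_eq.1 hl with h | rfl
          · rw [if_neg (by exact_mod_cast h.ne), hI.1 l h]
          · rw [if_pos rfl]
        · rw [Memory.write_apply, if_neg (by exact_mod_cast (by omega : l ≠ m)),
            hI.2 l (by omega)])
  refine h.imp fun s' hs' => ⟨hs'.1.1, fun b h1 h2 => hs'.2 b ?_⟩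
  simp [Program.writes, h1, h2]

end Runs

/-! ### The filter as a program

The arrays are used as follows (a number is cell `0` of an array): `0` the number `n` of vertices,
`1` the adjacency matrix, `2` the output, `3` the numerators and `5` the common denominator of the
filter matrix, `4` an auxiliary matrix, `6` the number `n²`, `7`-`13` counters and auxiliary
numbers, `14` the labels of the vertices, `15` the number of labels, `16` the table that assigns
classes to labels, `17` the indicator of the vertices that are not removed, `18` a counter, `19` the
number of vertices that the best coloring covers, `20` the length of the output. -/

/-- The array `f` holds the matrix `X` row by row. -/
def HoldsMatrix {n : ℕ} (f : ℤ → ℤ) (X : Matrix (Fin n) (Fin n) ℤ) : Prop :=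
  ∀ x y : Fin n, f ((x : ℤ) * n + y) = X x y

theorem index_lt {n x y : ℕ} (hx : x < n) (hy : y < n) : x * n + y < n * n := by
  calc x * n + y < x * n + n := by omega
    _ = (x + 1) * n := by ring
    _ ≤ n * n := Nat.mul_le_mul_right _ hx

theorem index_div {n x y : ℕ} (hy : y < n) : (x * n + y) / n = x := by
  rw [mul_comm, Nat.mul_add_div (by omega), Nat.div_eq_of_lt hy, add_zero]

theorem index_mod {n x y : ℕ} (hy : y < n) : (x * n + y) % n = y := by
  rw [mul_comm, Nat.mul_add_mod, Nat.mod_eq_of_lt hy]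

theorem HoldsMatrix.sum_eq {n : ℕ} {f : ℤ → ℤ} {X : Matrix (Fin n) (Fin n) ℤ}
    (h : HoldsMatrix f X) (x y : Fin n) :
    ∑ w ∈ Finset.range n, f (((x : ℕ) : ℤ) * n + w) * f ((w : ℤ) * n + ((y : ℕ) : ℤ)) =
      (X * X) x y := by
  rw [Matrix.mul_apply, Finset.sum_range]
  exact Finset.sum_congr rfl fun w _ => by rw [h x w, h w y]

section SquareProgram

open Expr

/-- Array `4` becomes the square of array `3`. -/
def squareProg : Program :=
  forLoop 10 6 (
    .seq (.assign 7 (const 0) (var 10 / var 0)) (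
    .seq (.assign 8 (const 0) (var 10 - var 7 * var 0)) (
    .seq (.assign 11 (const 0) (const 0)) (
    .seq (forLoop 9 0 (.assign 11 (const 0)
      (var 11 + read 3 (var 7 * var 0 + var 9) * read 3 (var 9 * var 0 + var 8))))
    (.assign 4 (var 10) (var 11))))))

/-- Cell `m` has row `m / n` and column `m % n`. A product of entries costs `O(B)`, an entry of the
square consists of `n ≤ B` products, and there are `n * n ≤ B` entries. -/
theorem squareProg_runs {n B : ℕ} {s : Memory} {X : Matrix (Fin n) (Fin n) ℤ} (hn : 0 < n)
    (hB : n * n ≤ B) (h0 : s 0 0 = n) (h6 : s 6 0 = ((n * n : ℕ) : ℤ))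
    (h3 : HoldsMatrix (s 3) X) (hX : ∀ x y, bitLength (X x y) ≤ B) :
    Runs squareProg s (140 * B ^ 3) (fun s' => HoldsMatrix (s' 4) (X * X) ∧
      ∀ b, b ∉ [4, 7, 8, 9, 10, 11] → s' b = s b) := by
  have hnB : n ≤ B := le_trans (Nat.le_mul_of_pos_left _ hn) hB
  have hB1 : 1 ≤ B := le_trans hn hnB
  set val : ℕ → ℤ := fun m => ∑ w ∈ Finset.range n,
    s 3 (((m / n : ℕ) : ℤ) * n + w) * s 3 ((w : ℤ) * n + ((m % n : ℕ) : ℤ)) with hval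
  have key := Runs.forLoop (s := s) (v := 10) (a := 6) (c := 110) (d := 2)
    (body := .seq (.assign 7 (const 0) (var 10 / var 0)) (
      .seq (.assign 8 (const 0) (var 10 - var 7 * var 0)) (
      .seq (.assign 11 (const 0) (const 0)) (
      .seq (forLoop 9 0 (.assign 11 (const 0)
        (var 11 + read 3 (var 7 * var 0 + var 9) * read 3 (var 9 * var 0 + var 8))))
      (.assign 4 (var 10) (var 11))))))
    (I := fun m s' => ∀ l < m, s' 4 (l : ℤ) = val l) hB1 hB
    (by simp [Program.writes, forLoop_writes]) (by simp [Program.writes, forLoop_writes]) h6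
    (fun m s' z h => by simpa [Memory.write_of_ne] using h) (by simp) ?_
  · refine key.imp fun s' hs' => ⟨fun x y => ?_, fun b hb => hs'.2 b ?_⟩
    · have h1 := hs'.1 _ (index_lt x.2 y.2)
      rw [hval] at h1
      simp only [index_div y.2, index_mod y.2] at h1
      rw [h3.sum_eq] at h1
      exact_mod_cast h1
    · simp [Program.writes, forLoop_writes] at hb ⊢
      tauto
  · intro m hm s₁ hI h10 hfr
    have f0 : s₁ 0 0 = n := by rw [hfr 0 (by simp [Program.writes, forLoop_writes]), h0]
    have f3 : s₁ 3 = s 3 := hfr 3 (by simp [Program.writes, forLoop_writes])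
    have hbn : bitLength (n : ℤ) ≤ B := bitLength_natCast_le hnB
    have hbm : bitLength (m : ℤ) ≤ B := bitLength_natCast_le (hm.le.trans hB)
    have hdn : m / n < n := Nat.div_lt_of_lt_mul hm
    have hmn : m % n < n := Nat.mod_lt _ hn
    have hbd : bitLength ((m / n : ℕ) : ℤ) ≤ B := bitLength_natCast_le (hdn.le.trans hnB)
    have hdiv : (m : ℤ) / (n : ℤ) = ((m / n : ℕ) : ℤ) := by push_cast; rfl
    have hmod : (m : ℤ) - ((m / n : ℕ) : ℤ) * n = ((m % n : ℕ) : ℤ) := by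
      have := Nat.div_add_mod m n
      have h' : (n : ℤ) * ((m / n : ℕ) : ℤ) + ((m % n : ℕ) : ℤ) = m := by exact_mod_cast this
      linear_combination -h'
    have hBB : 2 * B ≤ 2 * B ^ 2 := Nat.mul_le_mul_left _ (Nat.le_self_pow two_ne_zero B)
    have hB2 : 1 ≤ B ^ 2 := Nat.one_le_pow _ _ hB1
    have hB11 : B ^ (1 + 1) = B ^ 2 := rfl
    refine ((Runs.assign (T := 9 * B ^ 2)
      (Q := fun s₂ => s₂ = s₁.write 7 0 ((m / n : ℕ) : ℤ)) ?_ ?_).seq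
      (T' := 95 * B ^ 2) fun s₂ hs₂ => ?_).mono (by omega) fun _ => id
    · simp only [time_const, time_div, time_var, eval_var, h10, f0]; omega
    · simp only [eval_const, eval_div, eval_var, h10, f0, hdiv]
    subst hs₂
    refine ((Runs.assign (T := 12 * B ^ 2) (Q := fun s₃ => s₃ =
      (s₁.write 7 0 ((m / n : ℕ) : ℤ)).write 8 0 ((m % n : ℕ) : ℤ)) ?_ ?_).seq
      (T' := 80 * B ^ 2) fun s₃ hs₃ => ?_).mono (by omega) fun _ => id
    · simp only [time_const, time_sub, time_mul, time_var, eval_var, Memory.write_self,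
        Memory.write_of_ne, ne_eq, OfNat.zero_ne_ofNat,
        not_false_eq_true, f0]
      omega
    · simp only [eval_const, eval_sub, eval_mul, eval_var, Memory.write_self,
        Memory.write_of_ne, ne_eq, OfNat.zero_ne_ofNat, Nat.reduceEqDiff, not_false_eq_true, f0,
        h10, hmod]
    subst hs₃
    refine ((Runs.assign (T := 3 * B ^ 2) (Q := fun s₄ => s₄ =
      ((s₁.write 7 0 ((m / n : ℕ) : ℤ)).write 8 0 ((m % n : ℕ) : ℤ)).write 11 0 0) ?_ ?_).seq
      (T' := 77 * B ^ 2) fun s₄ hs₄ => ?_).mono (by omega) fun _ => id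
    · simp only [time_const]; omega
    · simp only [eval_const]
    have g7 : s₄ 7 0 = ((m / n : ℕ) : ℤ) := by
      rw [hs₄, Memory.write_of_ne _ _ _ (by decide), Memory.write_of_ne _ _ _ (by decide),
        Memory.write_self]
    have g8 : s₄ 8 0 = ((m % n : ℕ) : ℤ) := by
      rw [hs₄, Memory.write_of_ne _ _ _ (by decide), Memory.write_self]
    have g11 : s₄ 11 0 = 0 := by rw [hs₄, Memory.write_self]
    have gof : ∀ b, b ≠ 7 → b ≠ 8 → b ≠ 11 → s₄ b = s₁ b := fun b h7 h8 h11 => by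
      rw [hs₄, Memory.write_of_ne _ _ _ h11, Memory.write_of_ne _ _ _ h8,
        Memory.write_of_ne _ _ _ h7]
    have g0 : s₄ 0 0 = n := by rw [gof 0 (by decide) (by decide) (by decide), f0]
    have g3 : s₄ 3 = s 3 := by rw [gof 3 (by decide) (by decide) (by decide), f3]
    have g4 : s₄ 4 = s₁ 4 := gof 4 (by decide) (by decide) (by decide)
    have g10 : s₄ 10 0 = m := by rw [gof 10 (by decide) (by decide) (by decide), h10]
    refine ((Runs.forLoop (s := s₄) (v := 9) (a := 0) (B := B) (c := 40) (d := 1)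
      (body := .assign 11 (const 0)
        (var 11 + read 3 (var 7 * var 0 + var 9) * read 3 (var 9 * var 0 + var 8)))
      (I := fun j s' => s' 11 0 = ∑ w ∈ Finset.range j,
        s 3 (((m / n : ℕ) : ℤ) * n + w) * s 3 ((w : ℤ) * n + ((m % n : ℕ) : ℤ))) hB1 hnB
      (by simp [Program.writes]) (by simp [Program.writes]) g0
      (fun m s' z h => by simpa [Memory.write_of_ne] using h) (by simpa using g11) ?_).seq
      (T' := 5 * B ^ 2) fun s₅ hs₅ => ?_).mono (by omega) fun _ => id
    · intro j hj s₅ hI5 h9 hfr5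
      have k0 : s₅ 0 0 = n := by rw [hfr5 0 (by simp [Program.writes]), g0]
      have k3 : s₅ 3 = s 3 := by rw [hfr5 3 (by simp [Program.writes]), g3]
      have k7 : s₅ 7 0 = ((m / n : ℕ) : ℤ) := by rw [hfr5 7 (by simp [Program.writes]), g7]
      have k8 : s₅ 8 0 = ((m % n : ℕ) : ℤ) := by rw [hfr5 8 (by simp [Program.writes]), g8]
      have hbj : bitLength (j : ℤ) ≤ B := bitLength_natCast_le (hj.le.trans hnB)
      have b1 : bitLength (s 3 (((m / n : ℕ) : ℤ) * n + j)) ≤ B := by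
        rw [h3 ⟨m / n, hdn⟩ ⟨j, hj⟩]; exact hX _ _
      have b2 : bitLength (s 3 ((j : ℤ) * n + ((m % n : ℕ) : ℤ))) ≤ B := by
        rw [h3 ⟨j, hj⟩ ⟨m % n, hmn⟩]; exact hX _ _
      refine Runs.assign ?_ ?_
      · simp only [time_const, time_add, time_mul, time_read, time_var, eval_var, eval_read,
          eval_add, eval_mul, k0, k3, k7, k8, h9, pow_one]
        omega
      · simp only [eval_const, eval_var, eval_read, eval_add, eval_mul, k0, k3, k7, k8, h9, hI5,
          Memory.write_self]
        rw [Finset.sum_range_succ]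
    · refine Runs.assign ?_ ?_
      · simp only [time_var]; omega
      · have k10 : s₅ 10 0 = m := by rw [hs₅.2 10 (by simp [Program.writes]), g10]
        have k4 : s₅ 4 = s₁ 4 := by rw [hs₅.2 4 (by simp [Program.writes]), g4]
        intro l hl
        rw [eval_var, eval_var, k10, hs₅.1, Memory.write_apply, k4]
        rcases Nat.lt_succ_iff_lt_or_eq.1 hl with h | rfl
        · rw [if_neg (by exact_mod_cast h.ne), hI l h]
        · rw [if_pos rfl]

end SquareProgram

/-! ### Digit bounds for the filter and the program that computes it -/

section FilterProgram

open Expr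

/-- A bound for the numerators and the denominator that is squared by the steps of the filter. -/
def IsBounded {n : ℕ} (p : Matrix (Fin n) (Fin n) ℤ × ℤ) (E : ℕ) : Prop :=
  (∀ x y, 3 * n * |p.1 x y| ≤ E) ∧ 3 * n * |p.2| ≤ E

namespace IsBounded

variable {n E : ℕ} {p : Matrix (Fin n) (Fin n) ℤ × ℤ}

theorem mul_le {a b : ℤ} (ha : 3 * n * |a| ≤ E) (hb : 3 * n * |b| ≤ E) :
    (3 * n) * (3 * n) * |a * b| ≤ ((E ^ 2 : ℕ) : ℤ) := by
  have h1 : 3 * n * |a| * (3 * n * |b|) ≤ E * E :=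
    mul_le_mul ha hb (by positivity) (by positivity)
  rw [abs_mul]; push_cast
  linarith

/-- Of the two factors `3 * n` one `n` pays for the `n` summands. The remaining `9 * n` is three
times what `IsBounded` asks for, which leaves room for the three products in `intBoost`. -/
theorem abs_mul_self_le (h : IsBounded p E) (x y : Fin n) :
    9 * n * |(p.1 * p.1) x y| ≤ ((E ^ 2 : ℕ) : ℤ) := by
  have hn : (0 : ℤ) < n := by exact_mod_cast x.pos
  have h1 : n * (9 * n * |(p.1 * p.1) x y|) ≤ n * ((E ^ 2 : ℕ) : ℤ) := by
    rw [Matrix.mul_apply]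
    calc n * (9 * n * |∑ z, p.1 x z * p.1 z y|) ≤ n * (9 * n * ∑ z, |p.1 x z * p.1 z y|) := by
          gcongr; exact Finset.abs_sum_le_sum_abs _ _
      _ = ∑ z, (3 * n) * (3 * n) * |p.1 x z * p.1 z y| := by
          rw [← Finset.mul_sum]; ring
      _ ≤ ∑ _z : Fin n, ((E ^ 2 : ℕ) : ℤ) :=
          Finset.sum_le_sum fun z _ => mul_le (h.1 x z) (h.1 z y)
      _ = n * ((E ^ 2 : ℕ) : ℤ) := by simp
  exact le_of_mul_le_mul_left h1 hn

theorem mul_self_le (h : IsBounded p E) (hn : 0 < n) :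
    3 * n * |p.2 * p.2| ≤ ((E ^ 2 : ℕ) : ℤ) := by
  have h1 := mul_le h.2 h.2
  have hn' : (1 : ℤ) ≤ n := by exact_mod_cast hn
  have h2 : 0 ≤ 3 * n * |p.2 * p.2| := by positivity
  nlinarith

theorem intSq (h : IsBounded p E) (hn : 0 < n) : IsBounded (intSq p) (E ^ 2) := by
  refine ⟨fun x y => ?_, h.mul_self_le hn⟩
  have h1 := h.abs_mul_self_le x y
  have h2 : 0 ≤ n * |(p.1 * p.1) x y| := by positivity
  change 3 * n * |(p.1 * p.1) x y| ≤ _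
  linarith

theorem intBoost (h : IsBounded p E) (hn : 0 < n) : IsBounded (intBoost p) (E ^ 2) := by
  refine ⟨fun x y => ?_, h.mul_self_le hn⟩
  have h1 := h.abs_mul_self_le x y
  have h2 := mul_le h.2 (h.1 x y)
  have hn' : (1 : ℤ) ≤ n := by exact_mod_cast hn
  have h3 : |2 * p.2 * p.1 x y - (p.1 * p.1) x y| ≤ 2 * |p.2 * p.1 x y| + |(p.1 * p.1) x y| := by
    refine (abs_sub _ _).trans ?_
    rw [mul_assoc, abs_mul, abs_two]
  have h4 : n * |p.2 * p.1 x y| ≤ n * n * |p.2 * p.1 x y| := by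
    have : 0 ≤ n * |p.2 * p.1 x y| := by positivity
    nlinarith
  change 3 * n * |2 * p.2 * p.1 x y - (p.1 * p.1) x y| ≤ _
  have h5 : 3 * n * |2 * p.2 * p.1 x y - (p.1 * p.1) x y| ≤
      3 * n * (2 * |p.2 * p.1 x y| + |(p.1 * p.1) x y|) := by gcongr
  linarith

theorem bitLength_le (h : IsBounded p E) (hn : 0 < n) {B : ℕ} (hE : E.size ≤ B) :
    (∀ x y, bitLength (p.1 x y) ≤ B) ∧ bitLength p.2 ≤ B ∧ bitLength (2 * p.2) ≤ B := by
  have hn' : (1 : ℤ) ≤ n := by exact_mod_cast hn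
  have key : ∀ z : ℤ, 3 * n * |z| ≤ E → 3 * |z| ≤ E := fun z hz => by
    have := abs_nonneg z
    nlinarith
  refine ⟨fun x y => ?_, ?_, ?_⟩ <;> refine (bitLength_le_size ?_).trans hE
  · have := key _ (h.1 x y); have := abs_nonneg (p.1 x y); linarith
  · have := key _ h.2; have := abs_nonneg p.2; linarith
  · rw [abs_mul, abs_two]; have := key _ h.2; have := abs_nonneg p.2; linarith

/-- Every squaring and every boost squares the bound: one initial squaring, `i` boosts, and two
operations in each of `j` rounds. -/
theorem intFilter (h : IsBounded p E) (hn : 0 < n) (i j : ℕ) :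
    IsBounded (intFilter i j p) (E ^ 2 ^ (1 + i + 2 * j)) := by
  have h1 : ∀ i, IsBounded (_root_.intBoost^[i] (_root_.intSq p)) (E ^ 2 ^ (1 + i)) := by
    intro i
    induction i with
    | zero => exact h.intSq hn
    | succ i ih =>
      rw [Function.iterate_succ_apply', ← add_assoc, pow_succ 2, pow_mul]
      exact ih.intBoost hn
  rw [_root_.intFilter]
  induction j with
  | zero => exact h1 i
  | succ j ih =>
    rw [Function.iterate_succ_apply', mul_add, mul_one, ← add_assoc, pow_add 2, pow_mul,
      show E ^ 2 ^ (1 + i + 2 * j) = E ^ 2 ^ (1 + i + 2 * j) from rfl, pow_two 2, pow_mul _ 2 2]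
    exact (ih.intSq hn).intBoost hn

end IsBounded

/-- The memory holds the integer matrix `p.1` and the denominator `p.2`. -/
structure HoldsFilter {n : ℕ} (p : Matrix (Fin n) (Fin n) ℤ × ℤ) (s : Memory) : Prop where
  size : s 0 0 = n
  sq : s 6 0 = ((n * n : ℕ) : ℤ)
  matrix : HoldsMatrix (s 3) p.1
  denom : s 5 0 = p.2

/-- Squares the matrix, replaces its entries by the values of `e`, and squares the denominator. -/
def stepProg (e : Expr) : Program :=
  .seq squareProg (.seq (forLoop 10 6 (.assign 3 (var 10) e))
    (.assign 5 (const 0) (var 5 * var 5)))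

/-- Array `3` is overwritten in place, so the value of `e` may rely only on the old entry at the
current position, the same entry of the square, and the denominator; none of these has changed yet
when it is read. -/
theorem stepProg_runs {n B E : ℕ} {s : Memory} {p : Matrix (Fin n) (Fin n) ℤ × ℤ} {e : Expr}
    {X : Matrix (Fin n) (Fin n) ℤ} (hn : 0 < n) (hB : n * n ≤ B) (hE : E.size ≤ B)
    (hs : HoldsFilter p s) (hp : IsBounded p E)
    (he : ∀ (s' : Memory) (x y : Fin n), s' 10 0 = (x : ℤ) * n + y →
      s' 3 ((x : ℤ) * n + y) = p.1 x y → s' 4 ((x : ℤ) * n + y) = (p.1 * p.1) x y →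
      s' 5 0 = p.2 → e.eval s' = X x y ∧ e.time s' ≤ 20 * B) :
    Runs (stepProg e) s (300 * B ^ 3) (fun s' => HoldsFilter (X, p.2 * p.2) s' ∧
      ∀ b, b ∉ [3, 4, 5, 7, 8, 9, 10, 11] → s' b = s b) := by
  have hnB : n ≤ B := le_trans (Nat.le_mul_of_pos_left _ hn) hB
  have hB1 : 1 ≤ B := le_trans hn hnB
  obtain ⟨hX, hS, -⟩ := hp.bitLength_le hn hE
  have h1 := squareProg_runs hn hB hs.size hs.sq hs.matrix hX
  refine ((h1.raise hB1 le_rfl le_rfl).seqB (c' := 100) fun s₁ hs₁ => ?_).raise hB1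
    (by norm_num) le_rfl
  have f0 : s₁ 0 0 = n := by rw [hs₁.2 0 (by simp), hs.size]
  have f6 : s₁ 6 0 = ((n * n : ℕ) : ℤ) := by rw [hs₁.2 6 (by simp), hs.sq]
  have f3 : s₁ 3 = s 3 := hs₁.2 3 (by simp)
  have f5 : s₁ 5 0 = p.2 := by rw [hs₁.2 5 (by simp), hs.denom]
  set val : ℕ → ℤ := fun m => if h : m < n * n then
    X ⟨m / n, Nat.div_lt_of_lt_mul h⟩ ⟨m % n, Nat.mod_lt _ hn⟩ else 0 with hval
  have h2 := Runs.fill (B := B) (v := 10) (a := 6) (arr := 3) (e := e) (s := s₁) (c := 20)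
    (val := val) hB1 hB (by decide) (by decide) (by decide) f6 (fun m hm s' hv hfr harr => by
      have hdm : (m : ℤ) = (((⟨m / n, Nat.div_lt_of_lt_mul hm⟩ : Fin n) : ℕ) : ℤ) * n +
          (((⟨m % n, Nat.mod_lt _ hn⟩ : Fin n) : ℕ) : ℤ) := by
        have := Nat.div_add_mod m n
        rw [mul_comm] at this
        exact_mod_cast this.symm
      have h3 := he s' ⟨m / n, Nat.div_lt_of_lt_mul hm⟩ ⟨m % n, Nat.mod_lt _ hn⟩
        (by rw [hv, hdm]) (by rw [← hdm, harr, f3, hdm, hs.matrix])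
        (by rw [hfr 4 (by decide) (by decide), hs₁.1])
        (by rw [hfr 5 (by decide) (by decide), f5])
      refine ⟨?_, h3.2⟩
      rw [h3.1, hval]
      simp only [hm, dif_pos])
  refine ((h2.raise hB1 le_rfl (by norm_num : 2 ≤ 3)).seqB (c' := 10) fun s₂ hs₂ => ?_).raise hB1
    (by norm_num) le_rfl
  have g5 : s₂ 5 0 = p.2 := by rw [hs₂.2 5 (by decide) (by decide), f5]
  have hB3 : B ≤ B ^ 3 := Nat.le_self_pow (by norm_num) B
  refine Runs.assign ?_ ⟨⟨?_, ?_, ?_, ?_⟩, ?_⟩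
  · simp only [time_const, time_mul, time_var, eval_var, g5]; omega
  · rw [Memory.write_of_ne _ _ _ (by decide), hs₂.2 0 (by decide) (by decide), f0]
  · rw [Memory.write_of_ne _ _ _ (by decide), hs₂.2 6 (by decide) (by decide), f6]
  · rw [Memory.write_of_ne _ _ _ (by decide)]
    intro x y
    have h4 := hs₂.1 _ (index_lt x.2 y.2)
    rw [hval] at h4
    simp only [index_lt x.2 y.2, dif_pos, index_div y.2, index_mod y.2] at h4
    exact_mod_cast h4
  · rw [eval_const, Memory.write_self, eval_mul, eval_var, g5]
  · intro b hb
    simp only [List.mem_cons, List.not_mem_nil, or_false, not_or] at hb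
    rw [Memory.write_of_ne _ _ _ (by tauto), hs₂.2 b (by tauto) (by tauto), hs₁.2 b (by
      simp only [List.mem_cons, List.not_mem_nil, or_false, not_or]; tauto)]

def intSqProg : Program := stepProg (read 4 (var 10))

def intBoostProg : Program :=
  stepProg (const 2 * var 5 * read 3 (var 10) - read 4 (var 10))

section Steps

variable {n B E : ℕ} {s : Memory} {p : Matrix (Fin n) (Fin n) ℤ × ℤ}

theorem intSqProg_runs (hn : 0 < n) (hB : n * n ≤ B) (hE : E.size ≤ B) (hs : HoldsFilter p s)
    (hp : IsBounded p E) : Runs intSqProg s (300 * B ^ 3) (fun s' => HoldsFilter (intSq p) s' ∧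
      ∀ b, b ∉ [3, 4, 5, 7, 8, 9, 10, 11] → s' b = s b) := by
  have hB1 : 1 ≤ B := le_trans (Nat.mul_pos hn hn) hB
  refine stepProg_runs hn hB hE hs hp fun s' x y h10 h3 h4 h5 => ⟨?_, ?_⟩
  · rw [eval_read, eval_var, h10, h4]
  · rw [time_read, time_var]; omega

theorem intBoostProg_runs (hn : 0 < n) (hB : n * n ≤ B) (hE : E.size ≤ B)
    (hs : HoldsFilter p s) (hp : IsBounded p E) :
    Runs intBoostProg s (300 * B ^ 3) (fun s' => HoldsFilter (intBoost p) s' ∧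
      ∀ b, b ∉ [3, 4, 5, 7, 8, 9, 10, 11] → s' b = s b) := by
  have hB1 : 1 ≤ B := le_trans (Nat.mul_pos hn hn) hB
  obtain ⟨hX, hS, h2S⟩ := hp.bitLength_le hn hE
  refine stepProg_runs hn hB hE hs hp fun s' x y h10 h3 h4 h5 => ⟨?_, ?_⟩
  · simp only [eval_sub, eval_mul, eval_read, eval_var, eval_const, h10, h3, h4, h5]
    rfl
  · have hb2 : bitLength 2 = 2 := by decide
    have := hX x y
    simp only [time_sub, time_mul, time_read, time_var, time_const, eval_mul, eval_read, eval_var,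
      eval_const, h10, h3, h5, hb2]
    omega

end Steps

/-- Computes the filter matrix of the input graph. -/
def filterProg (i N : ℕ) : Program :=
  .seq (.assign 6 (const 0) (var 0 * var 0)) (
  .seq (forLoop 10 6 (.assign 3 (var 10) (read 1 (var 10)))) (
  .seq (.assign 5 (const 0) (const 0)) (
  .seq (forLoop 8 0 (.assign 5 (const 0) (var 5 + read 1 (var 8)))) (
  .seq intSqProg (
  .seq (.assign 13 (const 0) (const i)) (
  .seq (forLoop 12 13 intBoostProg) (
  .seq (.assign 13 (const 0) (var 0 * const N)) (
  .seq (.assign 12 (const 0) (const 1)) (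
  .loop (lt (var 12) (var 13)) (.seq intSqProg (.seq intBoostProg
    (.assign 12 (const 0) (var 12 + var 12)))))))))))))

/-- The bit bound at the last stage covers all earlier stages by monotonicity. The last loop doubles
a number until it reaches `n * N`, so the number of rounds is the upper logarithm of `n * N`. -/
theorem filterProg_runs {n d i N B : ℕ} {s : Memory} {A : Matrix (Fin n) (Fin n) ℤ} (hn : 0 < n)
    (hB : n * n ≤ B) (hiB : i ≤ B) (hNB : n * N ≤ B)
    (hBE : ((3 * n * n) ^ 2 ^ (1 + i + 2 * Nat.clog 2 (n * N))).size ≤ B) (hs0 : s 0 0 = n)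
    (hs1 : HoldsMatrix (s 1) A) (hA : ∀ x y, |A x y| ≤ 1) (hd : ∀ x, ∑ y, A x y = d)
    (hdn : d ≤ n) :
    Runs (filterProg i N) s (3000 * B ^ 4) (fun s' =>
      (∃ j, n * N ≤ 2 ^ j ∧ IsBounded (intFilter i j (A, (d : ℤ)))
        ((3 * n * n) ^ 2 ^ (1 + i + 2 * Nat.clog 2 (n * N))) ∧
        HoldsFilter (intFilter i j (A, (d : ℤ))) s') ∧
      ∀ b, b ∉ [3, 4, 5, 6, 7, 8, 9, 10, 11, 12, 13] → s' b = s b) := by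
  have hnB : n ≤ B := le_trans (Nat.le_mul_of_pos_left _ hn) hB
  have hB1 : 1 ≤ B := le_trans hn hnB
  have hB4 : B ≤ B ^ 4 := Nat.le_self_pow (by norm_num) B
  have hbn : bitLength (n : ℤ) ≤ B := bitLength_natCast_le hnB
  have hE0 : 1 ≤ 3 * n * n := Nat.mul_pos (Nat.mul_pos (by norm_num) hn) hn
  set J := Nat.clog 2 (n * N) with hJ
  have hpow : ∀ i' j, i' ≤ i → j ≤ J → (3 * n * n) ^ 2 ^ (1 + i' + 2 * j) ≤
      (3 * n * n) ^ 2 ^ (1 + i + 2 * J) := fun i' j hi' hj =>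
    Nat.pow_le_pow_right hE0 (Nat.pow_le_pow_right two_pos (by omega))
  have hsize : ∀ i' j, i' ≤ i → j ≤ J → ((3 * n * n) ^ 2 ^ (1 + i' + 2 * j)).size ≤ B :=
    fun i' j hi' hj => (Nat.size_le_size (hpow i' j hi' hj)).trans hBE
  have hA0 : IsBounded (A, (d : ℤ)) (3 * n * n) := by
    have hn' : (1 : ℤ) ≤ n := by exact_mod_cast hn
    refine ⟨fun x y => ?_, ?_⟩
    · have := hA x y
      push_cast
      change 3 * (n : ℤ) * |A x y| ≤ _
      nlinarith
    · change 3 * (n : ℤ) * |(d : ℤ)| ≤ _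
      rw [Nat.abs_cast]
      exact_mod_cast Nat.mul_le_mul_left _ hdn
  refine ((Runs.assign (T := 10 * B ^ 4) (Q := fun s₁ => s₁ 6 0 = ((n * n : ℕ) : ℤ) ∧
    ∀ b, b ≠ 6 → s₁ b = s b) ?_ ⟨?_, fun b hb => ?_⟩).seqB (c' := 2900) fun s₁ hs₁ => ?_).raise
    hB1 (by norm_num) le_rfl
  · simp only [time_const, time_mul, time_var, eval_var, hs0]; omega
  · rw [eval_const, Memory.write_self, eval_mul, eval_var, hs0]; push_cast; rfl
  · exact Memory.write_of_ne _ _ _ hb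
  have f0 : s₁ 0 0 = n := by rw [hs₁.2 0 (by decide), hs0]
  have h2 := Runs.fill (B := B) (v := 10) (a := 6) (arr := 3) (e := read 1 (var 10)) (s := s₁)
    (c := 5) (val := fun m => s 1 m) hB1 hB (by decide) (by decide) (by decide) hs₁.1
    (fun m hm s' hv hfr _ => by
      refine ⟨?_, by rw [time_read, time_var]; omega⟩
      rw [eval_read, eval_var, hv, hfr 1 (by decide) (by decide), hs₁.2 1 (by decide)])
  refine ((h2.raise hB1 le_rfl (by norm_num : 2 ≤ 4)).seqB (c' := 2850) fun s₂ hs₂ => ?_).raise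
    hB1 (by norm_num) le_rfl
  have hs₂3 : HoldsMatrix (s₂ 3) A := fun x y => by
    have := hs₂.1 _ (index_lt x.2 y.2)
    have h' := hs1 x y
    push_cast at this
    rw [this, h']
  have hof₂ : ∀ b, b ∉ [3, 6, 10] → s₂ b = s b := fun b hb => by
    simp only [List.mem_cons, List.not_mem_nil, or_false, not_or] at hb
    rw [hs₂.2 b (by tauto) (by tauto), hs₁.2 b (by tauto)]
  refine ((Runs.assign (T := 3 * B ^ 4) (Q := fun s₃ => s₃ 5 0 = 0 ∧
    ∀ b, b ≠ 5 → s₃ b = s₂ b) ?_ ⟨?_, fun b hb => ?_⟩).seqB (c' := 2840) fun s₃ hs₃ => ?_).raise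
    hB1 (by norm_num) le_rfl
  · simp only [time_const]; omega
  · rw [eval_const, Memory.write_self]
  · exact Memory.write_of_ne _ _ _ hb
  have g0 : s₃ 0 0 = n := by rw [hs₃.2 0 (by decide), hof₂ 0 (by decide), hs0]
  have h4 := Runs.forLoop (s := s₃) (v := 8) (a := 0) (B := B) (c := 10) (d := 1)
    (body := .assign 5 (const 0) (var 5 + read 1 (var 8)))
    (I := fun m s' => s' 5 0 = ∑ w ∈ Finset.range m, s 1 (w : ℤ)) hB1 hnB
    (by simp [Program.writes]) (by simp [Program.writes]) g0
    (fun m s' z h => by simpa [Memory.write_of_ne] using h) (by simpa using hs₃.1)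
    (fun m hm s' hI hv hfr => by
      have k1 : s' 1 = s 1 := by
        rw [hfr 1 (by simp [Program.writes]), hs₃.2 1 (by decide), hof₂ 1 (by decide)]
      refine Runs.assign ?_ ?_
      · simp only [time_const, time_add, time_read, time_var, pow_one]; omega
      · rw [eval_const, Memory.write_self, eval_add, eval_read, eval_var, eval_var, hv, hI, k1,
          Finset.sum_range_succ])
  refine ((h4.raise hB1 le_rfl (by norm_num : 1 + 1 ≤ 4)).seqB (c' := 2790)
    fun s₄ hs₄ => ?_).raise hB1 (by norm_num) le_rfl
  have hof₄ : ∀ b, b ∉ [3, 5, 6, 8, 10] → s₄ b = s b := fun b hb => by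
    simp only [List.mem_cons, List.not_mem_nil, or_false, not_or] at hb
    rw [hs₄.2 b (by simp [Program.writes]; tauto), hs₃.2 b (by tauto),
      hof₂ b (by simp; tauto)]
  have hs₄F : HoldsFilter (A, (d : ℤ)) s₄ := by
    refine ⟨?_, ?_, ?_, ?_⟩
    · rw [hof₄ 0 (by decide), hs0]
    · rw [hs₄.2 6 (by simp [Program.writes]), hs₃.2 6 (by decide),
        hs₂.2 6 (by decide) (by decide), hs₁.1]
    · rw [hs₄.2 3 (by simp [Program.writes]), hs₃.2 3 (by decide)]
      exact hs₂3
    -- By regularity the degree, which is the initial denominator, is the sum of the row of vertex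
    -- `0`.
    · rw [hs₄.1, ← hd ⟨0, hn⟩, Finset.sum_range]
      refine Finset.sum_congr rfl fun y _ => ?_
      have := hs1 ⟨0, hn⟩ y
      rw [← this]; simp
  have h5 := intSqProg_runs hn hB (E := 3 * n * n) ((Nat.size_le_size
    (Nat.le_self_pow (by positivity) _)).trans hBE) hs₄F hA0
  refine ((h5.raise hB1 le_rfl (by norm_num : 3 ≤ 4)).seqB (c' := 2400)
    fun s₅ hs₅ => ?_).raise hB1 (by norm_num) le_rfl
  refine ((Runs.assign (T := 3 * B ^ 4) (Q := fun s₆ => s₆ 13 0 = i ∧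
    ∀ b, b ≠ 13 → s₆ b = s₅ b) ?_ ⟨?_, fun b hb => ?_⟩).seqB (c' := 2390) fun s₆ hs₆ => ?_).raise
    hB1 (by norm_num) le_rfl
  · simp only [time_const]; omega
  · rw [eval_const, Memory.write_self, eval_const]
  · exact Memory.write_of_ne _ _ _ hb
  have hof₆ : ∀ b, b ∉ [3, 4, 5, 6, 7, 8, 9, 10, 11, 13] → s₆ b = s b := fun b hb => by
    simp only [List.mem_cons, List.not_mem_nil, or_false, not_or] at hb
    rw [hs₆.2 b (by tauto), hs₅.2 b (by simp; tauto), hof₄ b (by simp; tauto)]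
  have hF₆ : HoldsFilter (intSq (A, (d : ℤ))) s₆ := by
    obtain ⟨e1, e2, e3, e4⟩ := hs₅.1
    exact ⟨by rw [hs₆.2 0 (by decide), e1], by rw [hs₆.2 6 (by decide), e2],
      by rw [hs₆.2 3 (by decide)]; exact e3, by rw [hs₆.2 5 (by decide), e4]⟩
  have h7 := Runs.forLoop (s := s₆) (v := 12) (a := 13) (B := B) (c := 300) (d := 3) (n := i)
    (body := intBoostProg)
    (I := fun m s' => HoldsFilter (intBoost^[m] (intSq (A, (d : ℤ)))) s') hB1 hiB
    (by simp [Program.writes, forLoop_writes, intBoostProg, stepProg, squareProg])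
    (by simp [Program.writes, forLoop_writes, intBoostProg, stepProg, squareProg]) hs₆.1
    (fun m s' z h => by
      obtain ⟨e1, e2, e3, e4⟩ := h
      exact ⟨by rwa [Memory.write_of_ne _ _ _ (by decide)],
        by rwa [Memory.write_of_ne _ _ _ (by decide)],
        by rwa [Memory.write_of_ne _ _ _ (by decide)],
        by rwa [Memory.write_of_ne _ _ _ (by decide)]⟩) hF₆
    (fun m hm s' hI hv hfr => by
      rw [Function.iterate_succ_apply']
      exact (intBoostProg_runs hn hB (hsize m 0 hm.le (Nat.zero_le _)) hI
        (hA0.intFilter hn m 0)).imp fun s'' h => h.1)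
  refine ((h7.raise hB1 le_rfl le_rfl).seqB (c' := 2050) fun s₇ hs₇ => ?_).raise hB1
    (by norm_num) le_rfl
  have hof₇ : ∀ b, b ∉ [3, 4, 5, 6, 7, 8, 9, 10, 11, 12, 13] → s₇ b = s b := fun b hb => by
    simp only [List.mem_cons, List.not_mem_nil, or_false, not_or] at hb
    rw [hs₇.2 b (by
      simp [Program.writes, forLoop_writes, intBoostProg, stepProg, squareProg]; tauto),
      hof₆ b (by simp; tauto)]
  have hbN : bitLength (N : ℤ) ≤ B :=
    bitLength_natCast_le ((Nat.le_mul_of_pos_left _ hn).trans hNB)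
  refine ((Runs.assign (T := 10 * B ^ 4) (Q := fun s₈ => s₈ 13 0 = ((n * N : ℕ) : ℤ) ∧
    ∀ b, b ≠ 13 → s₈ b = s₇ b) ?_ ⟨?_, fun b hb => ?_⟩).seqB (c' := 2000) fun s₈ hs₈ => ?_).raise
    hB1 (by norm_num) le_rfl
  · simp only [time_const, time_mul, time_var, eval_var, eval_const, hs₇.1.size]; omega
  · rw [eval_const, Memory.write_self, eval_mul, eval_var, eval_const, hs₇.1.size]; push_cast; rfl
  · exact Memory.write_of_ne _ _ _ hb
  refine ((Runs.assign (T := 3 * B ^ 4) (Q := fun s₉ => s₉ 12 0 = 1 ∧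
    ∀ b, b ≠ 12 → s₉ b = s₈ b) ?_ ⟨?_, fun b hb => ?_⟩).seqB (c' := 1900) fun s₉ hs₉ => ?_).raise
    hB1 (by norm_num) le_rfl
  · simp only [time_const]; omega
  · rw [eval_const, Memory.write_self, eval_const]
  · exact Memory.write_of_ne _ _ _ hb
  have h10 := Runs.loop (s := s₉) (e := lt (var 12) (var 13)) (te := 5) (T := 608 * B ^ 3)
    (p := .seq intSqProg (.seq intBoostProg (.assign 12 (const 0) (var 12 + var 12))))
    (I := fun j s' => s' 12 0 = ((2 ^ j : ℕ) : ℤ) ∧ s' 13 0 = ((n * N : ℕ) : ℤ) ∧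
      HoldsFilter (intFilter i j (A, (d : ℤ))) s' ∧
      ∀ b, b ∉ [3, 4, 5, 6, 7, 8, 9, 10, 11, 12, 13] → s' b = s b) J
    ⟨by rw [hs₉.1]; simp, by rw [hs₉.2 13 (by decide), hs₈.1],
      by
        obtain ⟨e1, e2, e3, e4⟩ := hs₇.1
        exact ⟨by rw [hs₉.2 0 (by decide), hs₈.2 0 (by decide), e1],
          by rw [hs₉.2 6 (by decide), hs₈.2 6 (by decide), e2],
          by rw [hs₉.2 3 (by decide), hs₈.2 3 (by decide)]; exact e3,
          by rw [hs₉.2 5 (by decide), hs₈.2 5 (by decide), e4]; rfl⟩,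
      fun b hb => by
        have hb' := hb
        simp only [List.mem_cons, List.not_mem_nil, or_false, not_or] at hb
        rw [hs₉.2 b (by tauto), hs₈.2 b (by tauto), hof₇ b hb']⟩
    (fun j hj s' hI => by
      obtain ⟨i12, i13, iF, iof⟩ := hI
      refine ⟨?_, by simp [time_lt, time_var], ?_⟩
      · rw [eval_lt, eval_var, eval_var, i12, i13, if_pos]
        · exact one_ne_zero
        · exact_mod_cast (Nat.lt_clog_iff_pow_lt one_lt_two).1 hj
      · have hB3 : 1 ≤ B ^ 3 := Nat.one_le_pow _ _ hB1
        refine ((intSqProg_runs hn hB (hsize i j le_rfl hj.le) iF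
          (hA0.intFilter hn i j)).seqB (c' := 308) fun s'' hs'' => ?_).raise hB1
          (by norm_num) le_rfl
        have hb1 := (hA0.intFilter hn i j).intSq hn
        have hb2 : (((3 * n * n) ^ 2 ^ (1 + i + 2 * j)) ^ 2).size ≤ B := by
          refine le_trans (Nat.size_le_size ?_) hBE
          rw [← pow_mul, ← pow_succ]
          exact Nat.pow_le_pow_right hE0 (Nat.pow_le_pow_right two_pos (by omega))
        refine ((intBoostProg_runs hn hB hb2 hs''.1 hb1).seqB (c' := 8)
          fun s₃ hs₃ => ?_).raise hB1 (by norm_num) le_rfl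
        have k12 : s₃ 12 0 = ((2 ^ j : ℕ) : ℤ) := by
          rw [hs₃.2 12 (by decide), hs''.2 12 (by decide), i12]
        refine Runs.assign ?_ ⟨?_, ?_, ?_, fun b hb => ?_⟩
        · simp only [time_const, time_add, time_var]; omega
        · rw [eval_const, Memory.write_self, eval_add, eval_var, k12]; push_cast; ring
        · rw [Memory.write_of_ne _ _ _ (by decide), hs₃.2 13 (by decide), hs''.2 13 (by decide),
            i13]
        · obtain ⟨e1, e2, e3, e4⟩ := hs₃.1
          rw [intFilter, Function.iterate_succ_apply']
          exact ⟨by rwa [Memory.write_of_ne _ _ _ (by decide)],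
            by rwa [Memory.write_of_ne _ _ _ (by decide)],
            by rwa [Memory.write_of_ne _ _ _ (by decide)],
            by rwa [Memory.write_of_ne _ _ _ (by decide)]⟩
        · have hb' := hb
          simp only [List.mem_cons, List.not_mem_nil, or_false, not_or] at hb
          rw [Memory.write_of_ne _ _ _ (by tauto), hs₃.2 b (by simp; tauto),
            hs''.2 b (by simp; tauto), iof b hb'])
    (fun s' hI => by
      refine ⟨?_, by simp [time_lt, time_var]⟩
      rw [eval_lt, eval_var, eval_var, hI.1, hI.2.1, if_neg]
      rw [not_lt]
      exact_mod_cast Nat.le_pow_clog one_lt_two _)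
  refine h10.mono ?_ fun s' hI => ⟨⟨J, Nat.le_pow_clog one_lt_two _,
    hA0.intFilter hn i J, hI.2.2.1⟩, hI.2.2.2⟩
  have hJB : J ≤ B := le_trans (Nat.clog_le_of_le_pow Nat.lt_two_pow_self.le) hNB
  have hB3 : 1 ≤ B ^ 3 := Nat.one_le_pow _ _ hB1
  calc J * (5 + 1 + 608 * B ^ 3) + (5 + 1) ≤ B * (614 * B ^ 3) + 6 * B ^ 4 := by
        refine add_le_add (Nat.mul_le_mul hJB (by omega)) (by omega)
    _ = 620 * B ^ 4 := by ring
    _ ≤ 1900 * B ^ 4 := Nat.mul_le_mul_right _ (by norm_num)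

end FilterProgram

/-! ### Clustering -/

section ClusterProgram

open Expr

section ClusterInvariant

variable {n : ℕ} {p : Matrix (Fin n) (Fin n) ℤ × ℤ} {P κ : ℕ}

/-- The labels `cl`, of which there are `m`, after the treatment of the vertices less than `i`. -/
structure IsPartialClustering (p : Matrix (Fin n) (Fin n) ℤ × ℤ) (P κ i m : ℕ)
    (cl : Fin n → ℕ) : Prop where
  le : ∀ y, cl y ≤ m
  near_center : ∀ l, l ≠ 0 → l ≤ m → ∃ z, ∀ x, cl x = l → IntNear p P z x
  sparse : ∀ x : Fin n, (x : ℕ) < i → ∀ Y : Finset (Fin n),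
    (∀ y ∈ Y, cl y = 0 ∧ IntNear p P x y) → κ * Y.card ≤ n
  count : m * n ≤ κ * (Finset.univ.filter fun y => cl y ≠ 0).card

open Classical in
/-- The unlabelled vertices near to `x`. -/
noncomputable def freeBall (p : Matrix (Fin n) (Fin n) ℤ × ℤ) (P : ℕ) (cl : Fin n → ℕ)
    (x : Fin n) : Finset (Fin n) :=
  Finset.univ.filter fun y => cl y = 0 ∧ IntNear p P x y

theorem mem_freeBall {cl : Fin n → ℕ} {x y : Fin n} :
    y ∈ freeBall p P cl x ↔ cl y = 0 ∧ IntNear p P x y := by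
  simp [freeBall]

theorem IsPartialClustering.skip {i m : ℕ} {cl : Fin n → ℕ}
    (h : IsPartialClustering p P κ i m cl) (hi : i < n)
    (hc : κ * (freeBall p P cl ⟨i, hi⟩).card ≤ n) : IsPartialClustering p P κ (i + 1) m cl := by
  refine ⟨h.le, h.near_center, fun x hx Y hY => ?_, h.count⟩
  rcases Nat.lt_succ_iff_lt_or_eq.1 hx with hx | hx
  · exact h.sparse x hx Y hY
  · obtain rfl : x = ⟨i, hi⟩ := Fin.ext hx
    exact (Nat.mul_le_mul_left _ (Finset.card_le_card fun y hy => mem_freeBall.2 (hY y hy))).trans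
      hc

/-- The whole free ball becomes a cluster with center `i`. Unlabelled sets only shrink, so
sparseness persists at earlier vertices, and no unlabelled vertex near `i` is left. The ball is
disjoint from the labelled vertices, which raises the count. -/
theorem IsPartialClustering.insert {i m : ℕ} {cl : Fin n → ℕ}
    (h : IsPartialClustering p P κ i m cl) (hi : i < n)
    (hc : n ≤ κ * (freeBall p P cl ⟨i, hi⟩).card) {cl' : Fin n → ℕ}
    (hcl : ∀ y, cl' y = if y ∈ freeBall p P cl ⟨i, hi⟩ then m + 1 else cl y) :
    IsPartialClustering p P κ (i + 1) (m + 1) cl' := by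
  have h0 : ∀ y, cl' y = 0 → cl y = 0 ∧ y ∉ freeBall p P cl ⟨i, hi⟩ := by
    intro y hy
    rw [hcl] at hy
    split_ifs at hy with hm
    exact ⟨hy, hm⟩
  refine ⟨fun y => ?_, fun l hl hlm => ?_, fun x hx Y hY => ?_, ?_⟩
  · rw [hcl]
    split_ifs
    · exact le_rfl
    · exact (h.le y).trans (Nat.le_succ m)
  · rcases Nat.lt_succ_iff_lt_or_eq.1 (Nat.lt_succ_of_le hlm) with hlt | rfl
    · obtain ⟨z, hz⟩ := h.near_center l hl (Nat.le_of_lt_succ hlt)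
      refine ⟨z, fun x hx => hz x ?_⟩
      rw [hcl] at hx
      split_ifs at hx
      · omega
      · exact hx
    · refine ⟨⟨i, hi⟩, fun x hx => ?_⟩
      rw [hcl] at hx
      split_ifs at hx with hm
      · exact (mem_freeBall.1 hm).2
      · have := h.le x; omega
  · rcases Nat.lt_succ_iff_lt_or_eq.1 hx with hx | hx
    · exact h.sparse x hx Y fun y hy => ⟨(h0 y (hY y hy).1).1, (hY y hy).2⟩
    · obtain rfl : x = ⟨i, hi⟩ := Fin.ext hx
      have : Y = ∅ := Finset.eq_empty_of_forall_notMem fun y hy =>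
        (h0 y (hY y hy).1).2 (mem_freeBall.2 ⟨(h0 y (hY y hy).1).1, (hY y hy).2⟩)
      rw [this]; simp
  · have hsub : (freeBall p P cl ⟨i, hi⟩) ∪ (Finset.univ.filter fun y => cl y ≠ 0) ⊆
        Finset.univ.filter fun y => cl' y ≠ 0 := by
      intro y hy
      refine Finset.mem_filter.2 ⟨Finset.mem_univ _, fun hy0 => ?_⟩
      rcases Finset.mem_union.1 hy with hy | hy
      exacts [(h0 y hy0).2 hy, (Finset.mem_filter.1 hy).2 (h0 y hy0).1]
    have hdis : Disjoint (freeBall p P cl ⟨i, hi⟩) (Finset.univ.filter fun y => cl y ≠ 0) :=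
      Finset.disjoint_left.2 fun y hy hy' =>
        (Finset.mem_filter.1 hy').2 (mem_freeBall.1 hy).1
    have h1 := Finset.card_le_card hsub
    rw [Finset.card_union_of_disjoint hdis] at h1
    calc (m + 1) * n = m * n + n := by ring
      _ ≤ κ * (Finset.univ.filter fun y => cl y ≠ 0).card +
          κ * (freeBall p P cl ⟨i, hi⟩).card := add_le_add h.count hc
      _ = κ * ((freeBall p P cl ⟨i, hi⟩).card + (Finset.univ.filter fun y => cl y ≠ 0).card) := by
          ring
      _ ≤ _ := Nat.mul_le_mul_left _ h1

/-- Each cluster takes at least `n / κ` new vertices. This makes the number of tables independent of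
`n`. -/
theorem IsPartialClustering.le_of_pos {i m : ℕ} {cl : Fin n → ℕ}
    (h : IsPartialClustering p P κ i m cl) (hn : 0 < n) : m ≤ κ := by
  have h1 : (Finset.univ.filter fun y => cl y ≠ 0).card ≤ n := by
    simpa using Finset.card_le_univ (Finset.univ.filter fun y => cl y ≠ 0)
  exact Nat.le_of_mul_le_mul_right (h.count.trans (Nat.mul_le_mul_left _ h1)) hn

theorem IsPartialClustering.isClustering {m : ℕ} {cl : Fin n → ℕ} (hn : 0 < n)
    (h : IsPartialClustering p P κ n m cl) : IsClustering p P κ cl := by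
  refine ⟨fun l hl => ?_, fun x => h.sparse x x.2⟩
  by_cases hlm : l ≤ m
  · exact h.near_center l hl hlm
  -- Labels above `m` do not occur, so any vertex serves as their center.
  · exact ⟨⟨0, hn⟩, fun x hx => absurd (h.le x) (by omega)⟩

end ClusterInvariant

/-- The value is `1` if vertex `y` (array `8`) is unlabelled and near to vertex `x` (array `10`),
and `0` otherwise. -/
def nearTest (P : ℕ) : Expr :=
  lt (read 14 (var 8) + lt (var 5) (var 0 * const P *
    (read 3 (var 10 * var 0 + var 10) + read 3 (var 8 * var 0 + var 8) -
      const 2 * read 3 (var 10 * var 0 + var 8)))) (const 1)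

theorem nearTest_spec {n P B E : ℕ} {p : Matrix (Fin n) (Fin n) ℤ × ℤ} {s : Memory}
    {cl : Fin n → ℕ} {x y : Fin n} (hnB : n ≤ B) (hPB : n * P ≤ B)
    (hE : (2 * E).size ≤ B) (hp : IsBounded p E) (hs : HoldsFilter p s)
    (h10 : s 10 0 = x) (h8 : s 8 0 = y) (hcl : s 14 (y : ℤ) = cl y) :
    (nearTest P).eval s = (if y ∈ freeBall p P cl x then 1 else 0) ∧
      (nearTest P).time s ≤ 60 * B := by
  have hn : 0 < n := x.pos
  have hB1 : 1 ≤ B := le_trans hn hnB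
  have hbn : bitLength (n : ℤ) ≤ B := bitLength_natCast_le hnB
  have hbx : bitLength (x : ℤ) ≤ B := bitLength_natCast_le (x.2.le.trans hnB)
  have hby : bitLength (y : ℤ) ≤ B := bitLength_natCast_le (y.2.le.trans hnB)
  have hbP : bitLength (P : ℤ) ≤ B :=
    bitLength_natCast_le ((Nat.le_mul_of_pos_left _ hn).trans hPB)
  have hbnP : bitLength ((n : ℤ) * P) ≤ B := by
    have := bitLength_natCast_le hPB
    rwa [Nat.cast_mul] at this
  have hb2 : bitLength 2 = 2 := by decide
  have hn' : (1 : ℤ) ≤ n := by exact_mod_cast hn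
  have hentry : ∀ x y, 3 * |p.1 x y| ≤ E := fun x y => by
    have := hp.1 x y
    have := abs_nonneg (p.1 x y)
    nlinarith
  have hbX : bitLength (p.1 x y) ≤ B := by
    refine (bitLength_le_size (H := 2 * E) ?_).trans hE
    have := hentry x y
    have := abs_nonneg (p.1 x y)
    push_cast; linarith
  -- Entries are at most `E / 3` in absolute value, so the combination is at most `4 * E / 3`; this
  -- is why the hypothesis concerns `2 * E`.
  have hbW : bitLength (p.1 x x + p.1 y y - 2 * p.1 x y) ≤ B := by
    refine (bitLength_le_size (H := 2 * E) ?_).trans hE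
    have h1 := abs_le.1 (show |p.1 x x| ≤ |p.1 x x| from le_rfl)
    have h2 := abs_le.1 (show |p.1 y y| ≤ |p.1 y y| from le_rfl)
    have h3 := abs_le.1 (show |p.1 x y| ≤ |p.1 x y| from le_rfl)
    have := hentry x x
    have := hentry y y
    have := hentry x y
    push_cast
    rw [abs_le]
    constructor <;> linarith
  have e1 := hs.matrix x x
  have e2 := hs.matrix y y
  have e3 := hs.matrix x y
  constructor
  · simp only [nearTest, eval_lt, eval_add, eval_sub, eval_mul, eval_read, eval_var, eval_const,
      hs.size, hs.denom, h10, h8, hcl, e1, e2, e3, mem_freeBall, IntNear]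
    by_cases hc : cl y = 0
    · by_cases hfar : p.2 < n * P * (p.1 x x + p.1 y y - 2 * p.1 x y)
      · rw [if_pos hfar, hc, if_neg (by simp), if_neg (by simpa using hfar)]
      · rw [if_neg hfar, hc, if_pos (by simp), if_pos (by simpa using hfar)]
    · have h1 : (1 : ℤ) ≤ cl y := by exact_mod_cast Nat.one_le_iff_ne_zero.2 hc
      rw [if_neg (by split_ifs <;> omega), if_neg (by tauto)]
  · simp only [nearTest, time_lt, time_add, time_sub, time_mul, time_read, time_var, time_const,
      eval_add, eval_sub, eval_mul, eval_read, eval_var, eval_const, hs.size, h10, h8, e1,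
      e2, e3, hb2]
    omega

/-- Greedy clustering with respect to the filter matrix. -/
def clusterProg (P κ : ℕ) : Program :=
  forLoop 10 0 (
    .seq (.assign 18 (const 0) (const 0)) (
    .seq (forLoop 8 0 (.assign 18 (const 0) (var 18 + nearTest P))) (
    .cond (lt (var 0) (const κ * var 18))
      (.seq (.assign 15 (const 0) (var 15 + const 1))
        (forLoop 8 0 (.assign 14 (var 8) (read 14 (var 8) + nearTest P * var 15))))
      .nop)))

theorem HoldsFilter.congr {n : ℕ} {p : Matrix (Fin n) (Fin n) ℤ × ℤ} {s s' : Memory}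
    (h : HoldsFilter p s) (h0 : s' 0 = s 0) (h3 : s' 3 = s 3) (h5 : s' 5 = s 5)
    (h6 : s' 6 = s 6) : HoldsFilter p s' :=
  ⟨by rw [h0, h.size], by rw [h6, h.sq], by rw [h3]; exact h.matrix, by rw [h5, h.denom]⟩

theorem clusterProg_runs {n P κ B E : ℕ} {p : Matrix (Fin n) (Fin n) ℤ × ℤ} {s : Memory}
    (hn : 0 < n) (hnB : n ≤ B) (hPB : n * P ≤ B) (hκB : κ ≤ B)
    (hE : (2 * E).size ≤ B) (hp : IsBounded p E) (hs : HoldsFilter p s)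
    (h14 : ∀ y : Fin n, s 14 (y : ℤ) = 0) (h15 : s 15 0 = 0) :
    Runs (clusterProg P κ) s (400 * B ^ 3) (fun s' =>
      (∃ cl : Fin n → ℕ, IsClustering p P κ cl ∧ (∀ y, cl y ≤ κ) ∧
        ∀ y : Fin n, s' 14 (y : ℤ) = cl y) ∧
      ∀ b, b ∉ [8, 10, 14, 15, 18] → s' b = s b) := by
  have hB1 : 1 ≤ B := le_trans hn hnB
  have hB2 : B ≤ B ^ 2 := Nat.le_self_pow two_ne_zero B
  have hB11 : B ^ (1 + 1) = B ^ 2 := rfl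
  have key := Runs.forLoop (s := s) (v := 10) (a := 0) (n := n) (c := 350) (d := 2)
    (body := .seq (.assign 18 (const 0) (const 0)) (
      .seq (forLoop 8 0 (.assign 18 (const 0) (var 18 + nearTest P))) (
      .cond (lt (var 0) (const κ * var 18))
        (.seq (.assign 15 (const 0) (var 15 + const 1))
          (forLoop 8 0 (.assign 14 (var 8) (read 14 (var 8) + nearTest P * var 15))))
        .nop)))
    (I := fun i s' => ∃ (m : ℕ) (cl : Fin n → ℕ), IsPartialClustering p P κ i m cl ∧
      (∀ y : Fin n, s' 14 (y : ℤ) = cl y) ∧ s' 15 0 = m) hB1 hnB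
    (by simp [Program.writes, forLoop_writes]) (by simp [Program.writes, forLoop_writes]) hs.size
    (fun m s' z h => by simpa [Memory.write_of_ne] using h)
    ⟨0, fun _ => 0, ⟨fun _ => le_rfl, fun l h1 h2 => by omega, fun x hx => by omega, by simp⟩,
      fun y => by rw [h14]; rfl, by rw [h15]; rfl⟩ ?_
  · refine (key.imp fun s' hs' => ⟨?_, fun b hb => hs'.2 b ?_⟩).raise hB1 (by norm_num) le_rfl
    · obtain ⟨m, cl, h1, h2, -⟩ := hs'.1
      exact ⟨cl, h1.isClustering hn, fun y => (h1.le y).trans (h1.le_of_pos hn), h2⟩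
    · simp [Program.writes, forLoop_writes] at hb ⊢
      tauto
  · intro i hi s₁ hI h10 hfr
    obtain ⟨m, cl, hcl, h14, h15⟩ := hI
    have hmκ : m ≤ κ := hcl.le_of_pos hn
    have hF₁ : HoldsFilter p s₁ := by
      refine hs.congr ?_ ?_ ?_ ?_ <;>
      exact hfr _ (by simp [Program.writes, forLoop_writes])
    set x : Fin n := ⟨i, hi⟩ with hx
    refine ((Runs.assign (T := 3 * B ^ 2) (Q := fun s₂ => s₂ 18 0 = 0 ∧
      ∀ b, b ≠ 18 → s₂ b = s₁ b) ?_ ⟨?_, fun b hb => ?_⟩).seqB (c' := 340)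
      fun s₂ hs₂ => ?_).raise hB1 (by norm_num) le_rfl
    · simp only [time_const]; omega
    · rw [eval_const, Memory.write_self]
    · exact Memory.write_of_ne _ _ _ hb
    have hF₂ : HoldsFilter p s₂ := by
      refine hF₁.congr ?_ ?_ ?_ ?_ <;> exact hs₂.2 _ (by decide)
    have h3 := Runs.forLoop (s := s₂) (v := 8) (a := 0) (n := n) (B := B) (c := 70) (d := 1)
      (body := .assign 18 (const 0) (var 18 + nearTest P))
      (I := fun j s' => s' 18 0 = ∑ w ∈ Finset.range j,
        if h : w < n then (if (⟨w, h⟩ : Fin n) ∈ freeBall p P cl x then 1 else 0) else 0) hB1 hnB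
      (by simp [Program.writes]) (by simp [Program.writes]) hF₂.size
      (fun m s' z h => by simpa [Memory.write_of_ne] using h) (by simpa using hs₂.1)
      (fun j hj s' hI hv hfr' => by
        have hof : ∀ b, b ≠ 8 → b ≠ 18 → s' b = s₂ b := fun b h1 h2 =>
          hfr' b (by simp [Program.writes, h1, h2])
        have hF' : HoldsFilter p s' := by
          refine hF₂.congr ?_ ?_ ?_ ?_ <;> exact hof _ (by decide) (by decide)
        have ht := nearTest_spec (y := ⟨j, hj⟩) (x := x) (cl := cl) hnB hPB hE hp hF'
          (by rw [hof 10 (by decide) (by decide), hs₂.2 10 (by decide), h10]) hv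
          (by rw [hof 14 (by decide) (by decide), hs₂.2 14 (by decide), h14])
        refine Runs.assign ?_ ?_
        · simp only [time_const, time_add, time_var, pow_one]; omega
        · rw [eval_const, Memory.write_self, eval_add, eval_var, hI, ht.1,
            Finset.sum_range_succ, dif_pos hj])
    refine ((h3.raise hB1 le_rfl le_rfl).seqB (c' := 240) fun s₃ hs₃ => ?_).raise hB1
      (by norm_num) le_rfl
    set r := (freeBall p P cl x).card with hr
    have h18 : s₃ 18 0 = r := by
      rw [hs₃.1, Finset.sum_range, hr]
      simp only [Fin.is_lt, dif_pos, Fin.eta]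
      rw [Finset.sum_boole, Finset.filter_univ_mem]
    have hof₃ : ∀ b, b ≠ 8 → b ≠ 18 → s₃ b = s₁ b := fun b h1 h2 => by
      rw [hs₃.2 b (by simp [Program.writes, h1, h2]), hs₂.2 b h2]
    have hF₃ : HoldsFilter p s₃ := by
      refine hF₁.congr ?_ ?_ ?_ ?_ <;> exact hof₃ _ (by decide) (by decide)
    have k15 : s₃ 15 0 = m := by rw [hof₃ 15 (by decide) (by decide), h15]
    have k14 : ∀ y : Fin n, s₃ 14 (y : ℤ) = cl y := fun y => by
      rw [hof₃ 14 (by decide) (by decide), h14]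
    have hrn : r ≤ n := by simpa using Finset.card_le_univ (freeBall p P cl x)
    have hbr : bitLength (r : ℤ) ≤ B := bitLength_natCast_le (hrn.trans hnB)
    have hbκ : bitLength (κ : ℤ) ≤ B := bitLength_natCast_le hκB
    have hcond : (lt (var 0) (const (κ : ℤ) * var 18)).eval s₃ =
        if n < κ * r then 1 else 0 := by
      rw [eval_lt, eval_var, eval_mul, eval_const, eval_var, hF₃.size, h18]
      have : ((n : ℤ) < κ * r) ↔ n < κ * r := by exact_mod_cast Iff.rfl
      simp only [this]
    refine Runs.cond (T := 200 * B ^ 2) (fun hne => ?_) (fun heq => ?_) ?_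
    · have hlt : n < κ * r := by
        by_contra hcon
        rw [hcond, if_neg hcon] at hne
        exact hne rfl
      refine ((Runs.assign (T := 6 * B ^ 2) (Q := fun s₄ => s₄ 15 0 = ((m + 1 : ℕ) : ℤ) ∧
        ∀ b, b ≠ 15 → s₄ b = s₃ b) ?_ ⟨?_, fun b hb => ?_⟩).seqB (c' := 190)
        fun s₄ hs₄ => ?_).raise hB1 (by norm_num) le_rfl
      · simp only [time_const, time_add, time_var]; omega
      · rw [eval_const, Memory.write_self, eval_add, eval_var, eval_const, k15]; push_cast; rfl
      · exact Memory.write_of_ne _ _ _ hb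
      have hF₄ : HoldsFilter p s₄ := by
        refine hF₃.congr ?_ ?_ ?_ ?_ <;> exact hs₄.2 _ (by decide)
      set cl' : Fin n → ℕ := fun y => if y ∈ freeBall p P cl x then m + 1 else cl y with hcl'
      have hcl1 : IsPartialClustering p P κ (i + 1) (m + 1) cl' :=
        hcl.insert hi hlt.le fun y => rfl
      have hm1 : m + 1 ≤ κ := hcl1.le_of_pos hn
      have hbm : bitLength ((m + 1 : ℕ) : ℤ) ≤ B := bitLength_natCast_le (hm1.trans hκB)
      -- The new label times the test is added to the old label. The test is `1` only where the old
      -- label is `0`, and cell `j` still holds its old label when it is read.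
      have h5 := Runs.fill (B := B) (v := 8) (a := 0) (arr := 14) (n := n) (s := s₄) (c := 80)
        (e := read 14 (var 8) + nearTest P * var 15)
        (val := fun w => if h : w < n then (cl' ⟨w, h⟩ : ℤ) else 0) hB1 hnB (by decide)
        (by decide) (by decide) hF₄.size (fun j hj s' hv hfr' harr => by
          have hF' : HoldsFilter p s' := by
            refine hF₄.congr ?_ ?_ ?_ ?_ <;> exact hfr' _ (by decide) (by decide)
          have e14 : s' 14 (j : ℤ) = cl ⟨j, hj⟩ := by
            rw [harr, hs₄.2 14 (by decide)]; exact k14 ⟨j, hj⟩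
          have ht := nearTest_spec (y := ⟨j, hj⟩) (x := x) (cl := cl) hnB hPB hE hp hF'
            (by rw [hfr' 10 (by decide) (by decide), hs₄.2 10 (by decide),
              hof₃ 10 (by decide) (by decide), h10]) hv e14
          have e15 : s' 15 0 = ((m + 1 : ℕ) : ℤ) := by
            rw [hfr' 15 (by decide) (by decide), hs₄.1]
          constructor
          · rw [eval_add, eval_read, eval_mul, eval_var, eval_var, hv, e14, e15, ht.1, dif_pos hj]
            simp only [hcl']
            split_ifs with hmem
            · rw [(mem_freeBall.1 hmem).1]; push_cast; ring
            · ring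
          · have hbt : bitLength ((nearTest P).eval s') ≤ 1 := by
              rw [ht.1]; split_ifs <;> decide
            have hb15 : bitLength (s' 15 0) ≤ B := by rw [e15]; exact hbm
            simp only [time_add, time_read, time_var, time_mul, eval_var]
            omega)
      refine (h5.imp fun s₅ hs₅ => ?_).raise hB1 (by norm_num) le_rfl
      refine ⟨m + 1, cl', hcl1, fun y => ?_, ?_⟩
      · rw [hs₅.1 y y.2, dif_pos y.2]
      · rw [hs₅.2 15 (by decide) (by decide), hs₄.1]
    · have hle : κ * r ≤ n := by
        by_contra hcon
        rw [hcond, if_pos (not_le.1 hcon)] at heq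
        exact one_ne_zero heq
      exact Runs.nop (by omega) ⟨m, cl, hcl.skip hi hle, k14, k15⟩
    · simp only [time_lt, time_var, time_mul, time_const, eval_var, eval_const, h18]
      omega

end ClusterProgram

/-! ### Roundings as a program -/

section PartialRounding

variable {n : ℕ} {G : SimpleGraph (Fin n)} {col : Fin n → ℕ} {L : Finset (Fin n)}

/-- The state of the greedy removal of monochromatic edges after the first `m` pairs of vertices
have been processed. -/
structure IsPartialRounding (G : SimpleGraph (Fin n)) (col : Fin n → ℕ) (m : ℕ)
    (L : Finset (Fin n)) : Prop where
  indep : ∀ x y : Fin n, (x : ℕ) * n + y < m → x ∈ L → y ∈ L → G.Adj x y → col x ≠ col y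
  removed_le : ∀ W : Finset (Fin n), (∀ x y, G.Adj x y → col x = col y → x ∈ W ∨ y ∈ W) → ∀ i,
    (Finset.univ.filter fun x => x ∉ L ∧ col x = i).card ≤
      2 * (W.filter fun x => x ∉ L ∧ col x = i).card

theorem isPartialRounding_univ : IsPartialRounding G col 0 Finset.univ :=
  ⟨fun _ _ h => absurd h (Nat.not_lt_zero _), by simp⟩

theorem IsPartialRounding.isRounding (h : IsPartialRounding G col (n * n) L) :
    IsRounding G col L :=
  ⟨fun x hx y hy => h.indep x y (index_lt x.2 y.2) hx hy, h.removed_le⟩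

theorem index_injective {n m : ℕ} {x y : Fin n} (h : (x : ℕ) * n + y = m) :
    (x : ℕ) = m / n ∧ (y : ℕ) = m % n := by
  subst h
  exact ⟨(index_div y.2).symm, (index_mod y.2).symm⟩

theorem IsPartialRounding.skip {m : ℕ} (h : IsPartialRounding G col m L) {x y : Fin n}
    (hxy : (x : ℕ) * n + y = m) (hno : ¬ (G.Adj x y ∧ x ∈ L ∧ y ∈ L ∧ col x = col y)) :
    IsPartialRounding G col (m + 1) L := by
  refine ⟨fun u v huv hu hv hadj hcol => ?_, h.removed_le⟩
  rcases Nat.lt_succ_iff_lt_or_eq.1 huv with hlt | heq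
  · exact h.indep u v hlt hu hv hadj hcol
  · obtain ⟨h1, h2⟩ := index_injective heq
    obtain ⟨h3, h4⟩ := index_injective hxy
    obtain rfl : u = x := Fin.ext (h1.trans h3.symm)
    obtain rfl : v = y := Fin.ext (h2.trans h4.symm)
    exact hno ⟨hadj, hu, hv, hcol⟩

/-- Removing an edge costs two vertices of one color, and any cover contains one of its ends. That
end was still in `L`, so it is counted for the first time on the right. -/
theorem IsPartialRounding.erase {m : ℕ} (h : IsPartialRounding G col m L) {x y : Fin n}
    (hxy : (x : ℕ) * n + y = m) (hadj : G.Adj x y) (hx : x ∈ L) (hy : y ∈ L)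
    (hcol : col x = col y) : IsPartialRounding G col (m + 1) ((L.erase x).erase y) := by
  refine ⟨fun u v huv hu hv hadj' hcol' => ?_, fun W hW i => ?_⟩
  · rw [Finset.mem_erase, Finset.mem_erase] at hu hv
    rcases Nat.lt_succ_iff_lt_or_eq.1 huv with hlt | heq
    · exact h.indep u v hlt hu.2.2 hv.2.2 hadj' hcol'
    · exact hu.2.1 (Fin.ext ((index_injective heq).1.trans (index_injective hxy).1.symm))
  · have hold := h.removed_le W hW i
    have hiff : ∀ z, z ∉ (L.erase x).erase y ↔ z = x ∨ z = y ∨ z ∉ L := by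
      intro z; simp only [Finset.mem_erase]; tauto
    by_cases hi : col x = i
    · have h1 : (Finset.univ.filter fun z => z ∉ (L.erase x).erase y ∧ col z = i) ⊆
          insert x (insert y (Finset.univ.filter fun z => z ∉ L ∧ col z = i)) := by
        intro z hz
        simp only [Finset.mem_filter, Finset.mem_univ, true_and, hiff, Finset.mem_insert] at hz ⊢
        tauto
      have h1' := (Finset.card_le_card h1).trans ((Finset.card_insert_le _ _).trans
        (Nat.succ_le_succ (Finset.card_insert_le _ _)))
      obtain ⟨w, hw, hwW⟩ : ∃ w, (w = x ∨ w = y) ∧ w ∈ W := by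
        rcases hW x y hadj hcol with hw | hw
        exacts [⟨x, Or.inl rfl, hw⟩, ⟨y, Or.inr rfl, hw⟩]
      have hwL : w ∈ L := by rcases hw with rfl | rfl <;> assumption
      have hwc : col w = i := by rcases hw with rfl | rfl; exacts [hi, hcol ▸ hi]
      have h2 : insert w (W.filter fun z => z ∉ L ∧ col z = i) ⊆
          W.filter fun z => z ∉ (L.erase x).erase y ∧ col z = i := by
        intro z hz
        simp only [Finset.mem_filter, hiff, Finset.mem_insert] at hz ⊢
        rcases hz with rfl | hz
        · exact ⟨hwW, by tauto, hwc⟩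
        · tauto
      have h2' := Finset.card_le_card h2
      rw [Finset.card_insert_of_notMem (by simp [hwL])] at h2'
      omega
    · have hsame : ∀ z, (z ∉ (L.erase x).erase y ∧ col z = i) ↔ (z ∉ L ∧ col z = i) := by
        intro z
        rw [hiff]
        constructor
        · rintro ⟨rfl | rfl | hz, hzi⟩
          exacts [absurd hzi hi, absurd (hcol.trans hzi) hi, ⟨hz, hzi⟩]
        · tauto
      simp only [hsame]
      exact hold

end PartialRounding

/-- The memory holds the graph `G` and the labels `cl` of its vertices. -/
structure HoldsGraph {n : ℕ} (G : SimpleGraph (Fin n)) [DecidableRel G.Adj] (cl : Fin n → ℕ)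
    (s : Memory) : Prop where
  size : s 0 0 = n
  sq : s 6 0 = ((n * n : ℕ) : ℤ)
  matrix : HoldsMatrix (s 1) (G.adjMatrix ℤ)
  label : ∀ y : Fin n, s 14 (y : ℤ) = cl y

/-- The content of array `17` is the indicator of `L`. -/
def HoldsSet {n : ℕ} (L : Finset (Fin n)) (s : Memory) : Prop :=
  ∀ y : Fin n, s 17 (y : ℤ) = if y ∈ L then 1 else 0

/-! ### Programs for tables, matchings, output and enumeration -/

section Programs

open Expr

variable {n : ℕ} {G : SimpleGraph (Fin n)} [DecidableRel G.Adj] {cl : Fin n → ℕ} {σ : ℕ → ℕ}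
  {s s' : Memory} {B : ℕ}

theorem HoldsGraph.congr (h : HoldsGraph G cl s)
    (hs : ∀ b, b = 0 ∨ b = 6 ∨ b = 1 ∨ b = 14 → s' b = s b) : HoldsGraph G cl s' := by
  refine ⟨?_, ?_, ?_, fun y => ?_⟩
  · rw [hs 0 (by tauto), h.size]
  · rw [hs 6 (by tauto), h.sq]
  · rw [hs 1 (by tauto)]; exact h.matrix
  · rw [hs 14 (by tauto), h.label]

/-- The first `m` entries of array `16` become the first `m` values of `σ`. -/
def tableProg (σ : ℕ → ℕ) : ℕ → Program
  | 0 => .nop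
  | m + 1 => .seq (tableProg σ m) (.assign 16 (const m) (const (σ m)))

theorem tableProg_runs (σ : ℕ → ℕ) (s : Memory) (m : ℕ) :
    Runs (tableProg σ m) s (3 * m + 1) (fun s' => (∀ l < m, s' 16 (l : ℤ) = σ l) ∧
      ∀ b, b ≠ 16 → s' b = s b) := by
  induction m with
  | zero => exact Runs.nop le_rfl ⟨by simp, fun _ _ => rfl⟩
  | succ m ih =>
    refine (ih.seq (T' := 3) (R := fun s' => (∀ l < m + 1, s' 16 (l : ℤ) = σ l) ∧
      ∀ b, b ≠ 16 → s' b = s b) fun s₁ hs₁ => Runs.assign ?_ ⟨fun l hl => ?_, fun b hb => ?_⟩).mono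
      (by omega) fun _ => id
    · simp only [time_const]; omega
    · rw [Memory.write_apply, eval_const, eval_const]
      rcases Nat.lt_succ_iff_lt_or_eq.1 hl with h | rfl
      · rw [if_neg (by exact_mod_cast h.ne), hs₁.1 l h]
      · rw [if_pos rfl]
    · rw [Memory.write_of_ne _ _ _ hb, hs₁.2 b hb]

/-- The class of the vertex that `e` denotes. -/
def classOf (e : Expr) : Expr := read 16 (read 14 e)

/-- The value is `0` if `e` and `f` have the same value, and `1` otherwise. -/
def neTest (e f : Expr) : Expr := lt e f + lt f e

theorem neTest_eval (e f : Expr) (s : Memory) :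
    (neTest e f).eval s = if e.eval s = f.eval s then 0 else 1 := by
  rw [neTest, eval_add, eval_lt, eval_lt]
  split_ifs <;> omega

/-- Whether the vertices `7` and `8` are joined by a monochromatic edge of the current set. -/
def conflictTest : Expr :=
  lt (const 2) (read 1 (var 10) + read 17 (var 7) + read 17 (var 8) -
    neTest (classOf (var 7)) (classOf (var 8)))

/-- Greedy removal of monochromatic edges. -/
def matchProg : Program :=
  forLoop 10 6 (
    .seq (.assign 7 (const 0) (var 10 / var 0)) (
    .seq (.assign 8 (const 0) (var 10 - var 7 * var 0)) (
    .cond conflictTest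
      (.seq (.assign 17 (var 7) (const 0)) (.assign 17 (var 8) (const 0)))
      .nop)))

theorem matchProg_runs (hn : 0 < n) (hB : n * n ≤ B) (hs : HoldsGraph G cl s)
    (htb : ∀ y : Fin n, s 16 (cl y : ℤ) = σ (cl y)) (hlive : HoldsSet (Finset.univ : Finset (Fin n)) s) :
    Runs matchProg s (130 * B ^ 2) (fun s' =>
      (∃ L, IsRounding G (fun x => σ (cl x)) L ∧ HoldsSet L s') ∧
      ∀ b, b ∉ [7, 8, 10, 17] → s' b = s b) := by
  have hnB : n ≤ B := le_trans (Nat.le_mul_of_pos_left _ hn) hB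
  have hB1 : 1 ≤ B := le_trans hn hnB
  have key := Runs.forLoop (s := s) (v := 10) (a := 6) (c := 100) (d := 1) (n := n * n) (B := B)
    (body := .seq (.assign 7 (const 0) (var 10 / var 0)) (
      .seq (.assign 8 (const 0) (var 10 - var 7 * var 0)) (
      .cond conflictTest
        (.seq (.assign 17 (var 7) (const 0)) (.assign 17 (var 8) (const 0)))
        .nop)))
    (I := fun m s' => ∃ L, IsPartialRounding G (fun x => σ (cl x)) m L ∧ HoldsSet L s') hB1 hB
    (by simp [Program.writes]) (by simp [Program.writes]) hs.sq
    (fun m s' z h => by simpa [HoldsSet, Memory.write_of_ne] using h)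
    ⟨Finset.univ, isPartialRounding_univ, hlive⟩ ?_
  · refine (key.imp fun s' hs' => ⟨?_, fun b hb => hs'.2 b ?_⟩).raise hB1 (by norm_num) le_rfl
    · obtain ⟨L, h1, h2⟩ := hs'.1
      exact ⟨L, h1.isRounding, h2⟩
    · simp [Program.writes] at hb ⊢
      tauto
  · rintro m hm s₁ ⟨L, hL, hset⟩ h10 hfr
    rw [pow_one]
    have hG₁ : HoldsGraph G cl s₁ := hs.congr fun b hb => hfr b (by
      rcases hb with rfl | rfl | rfl | rfl <;> simp [Program.writes])
    have hbn : bitLength (n : ℤ) ≤ B := bitLength_natCast_le hnB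
    have hbm : bitLength (m : ℤ) ≤ B := bitLength_natCast_le (hm.le.trans hB)
    have hdn : m / n < n := Nat.div_lt_of_lt_mul hm
    have hmn : m % n < n := Nat.mod_lt _ hn
    have hbd : bitLength ((m / n : ℕ) : ℤ) ≤ B := bitLength_natCast_le (hdn.le.trans hnB)
    have hdm : m / n * n + m % n = m := by rw [mul_comm]; exact Nat.div_add_mod m n
    have hdiv : (m : ℤ) / (n : ℤ) = ((m / n : ℕ) : ℤ) := by push_cast; rfl
    have hmod : (m : ℤ) - ((m / n : ℕ) : ℤ) * n = ((m % n : ℕ) : ℤ) := by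
      have h' : ((m / n : ℕ) : ℤ) * (n : ℤ) + ((m % n : ℕ) : ℤ) = m := by exact_mod_cast hdm
      linear_combination -h'
    set x : Fin n := ⟨m / n, hdn⟩ with hx
    set y : Fin n := ⟨m % n, hmn⟩ with hy
    have hxy : (x : ℕ) * n + y = m := hdm
    refine ((Runs.assign (T := 9 * B)
      (Q := fun s₂ => s₂ 7 0 = ((x : ℕ) : ℤ) ∧ ∀ b, b ≠ 7 → s₂ b = s₁ b) ?_
        ⟨?_, fun b hb => Memory.write_of_ne _ _ _ hb⟩).seq
      (T' := 80 * B) fun s₂ hs₂ => ?_).mono (by omega) fun _ => id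
    · simp only [time_const, time_div, time_var, eval_var, h10, hG₁.size]; omega
    · rw [eval_const, Memory.write_self, eval_div, eval_var, eval_var, h10, hG₁.size, hdiv]
    have hG₂ : HoldsGraph G cl s₂ := hG₁.congr fun b hb => hs₂.2 b (by omega)
    refine ((Runs.assign (T := 12 * B)
      (Q := fun s₃ => s₃ 8 0 = ((y : ℕ) : ℤ) ∧ ∀ b, b ≠ 8 → s₃ b = s₂ b) ?_
        ⟨?_, fun b hb => Memory.write_of_ne _ _ _ hb⟩).seq
      (T' := 60 * B) fun s₃ hs₃ => ?_).mono (by omega) fun _ => id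
    · have : bitLength (s₂ 7 0) ≤ B := by rw [hs₂.1]; exact hbd
      simp only [time_const, time_sub, time_mul, time_var, eval_var, hG₂.size]; omega
    · rw [eval_const, Memory.write_self, eval_sub, eval_mul, eval_var, eval_var, eval_var,
        hs₂.2 10 (by decide), h10, hs₂.1, hG₂.size, hmod]
    have hG₃ : HoldsGraph G cl s₃ := hG₂.congr fun b hb => hs₃.2 b (by omega)
    have hof : ∀ b, b ≠ 7 → b ≠ 8 → s₃ b = s₁ b := fun b h1 h2 => by rw [hs₃.2 b h2, hs₂.2 b h1]
    have e7 : s₃ 7 0 = ((x : ℕ) : ℤ) := by rw [hs₃.2 7 (by decide), hs₂.1]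
    have e8 : s₃ 8 0 = ((y : ℕ) : ℤ) := hs₃.1
    have e10 : s₃ 10 0 = ((x : ℕ) : ℤ) * n + ((y : ℕ) : ℤ) := by
      rw [hof 10 (by decide) (by decide), h10, ← hxy]; push_cast; rfl
    have e17 : HoldsSet L s₃ := fun z => by rw [hof 17 (by decide) (by decide), hset z]
    have etb : ∀ z : Fin n, s₃ 16 (cl z : ℤ) = σ (cl z) := fun z => by
      rw [hof 16 (by decide) (by decide), hfr 16 (by simp [Program.writes]), htb]
    -- The three indicators add up to more than `2` only if all are `1`, and subtracting the
    -- indicator of distinct colors leaves `3` exactly for a monochromatic edge inside `L`.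
    have htest : conflictTest.eval s₃ =
        if G.Adj x y ∧ x ∈ L ∧ y ∈ L ∧ σ (cl x) = σ (cl y) then 1 else 0 := by
      have hiff : ((σ (cl x) : ℕ) : ℤ) = σ (cl y) ↔ σ (cl x) = σ (cl y) := Nat.cast_inj
      simp only [conflictTest, classOf, eval_lt, eval_sub, eval_add, eval_read, eval_var,
        eval_const, neTest_eval, e7, e8, e10, e17 x, e17 y, hG₃.matrix x y, hG₃.label, etb,
        SimpleGraph.adjMatrix_apply, hiff]
      by_cases h1 : G.Adj x y <;> by_cases h2 : x ∈ L <;> by_cases h3 : y ∈ L <;>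
        by_cases h4 : σ (cl x) = σ (cl y) <;> simp [h1, h2, h3, h4]
    refine Runs.cond (T := 6 * B + 2) (fun hne => ?_) (fun heq => ?_) ?_
    · have hc : G.Adj x y ∧ x ∈ L ∧ y ∈ L ∧ σ (cl x) = σ (cl y) := by
        by_contra hcon
        rw [htest, if_neg hcon] at hne
        exact hne rfl
      refine ((Runs.assign (T := 4) (Q := fun s₄ => HoldsSet (L.erase x) s₄ ∧
        ∀ b, b ≠ 17 → s₄ b = s₃ b) ?_ ⟨fun z => ?_, fun b hb => Memory.write_of_ne _ _ _ hb⟩).seq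
        (T' := 4) fun s₄ hs₄ => ?_).mono (by omega) fun _ => id
      · simp only [time_const, time_var]; omega
      · rw [Memory.write_apply, eval_var, e7, eval_const, e17 z]
        by_cases hz : z = x
        · simp [hz]
        · have : ((z : ℕ) : ℤ) ≠ ((x : ℕ) : ℤ) := fun h => hz (Fin.ext (by exact_mod_cast h))
          simp [hz, this]
      · refine Runs.assign ?_ ⟨_, hL.erase hxy hc.1 hc.2.1 hc.2.2.1 hc.2.2.2, fun z => ?_⟩
        · simp only [time_const, time_var]; omega
        · rw [Memory.write_apply, eval_var, hs₄.2 8 (by decide), e8, eval_const, hs₄.1 z]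
          by_cases hz : z = y
          · simp [hz]
          · have : ((z : ℕ) : ℤ) ≠ ((y : ℕ) : ℤ) := fun h => hz (Fin.ext (by exact_mod_cast h))
            simp [hz, this]
    · refine Runs.nop (by omega) ⟨L, hL.skip hxy fun hcon => ?_, e17⟩
      rw [htest, if_pos hcon] at heq
      exact one_ne_zero heq
    · simp only [conflictTest, neTest, classOf, time_lt, time_sub, time_add, time_read, time_var,
        time_const]
      omega

/-- Number `18` becomes the size of the set that array `17` holds. -/
def countProg : Program :=
  .seq (.assign 18 (const 0) (const 0))
    (forLoop 8 0 (.assign 18 (const 0) (var 18 + read 17 (var 8))))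

theorem countProg_runs {L : Finset (Fin n)} (hB1 : 1 ≤ B) (hnB : n ≤ B) (hs : s 0 0 = n)
    (hL : HoldsSet L s) : Runs countProg s (50 * B ^ 2) (fun s' => s' 18 0 = L.card ∧
      ∀ b, b ∉ [8, 18] → s' b = s b) := by
  have hB2 : 1 ≤ B ^ 2 := Nat.one_le_pow _ _ hB1
  refine ((Runs.assign (T := 3 * B ^ 2) (Q := fun s₁ => s₁ 18 0 = 0 ∧ ∀ b, b ≠ 18 → s₁ b = s b)
    ?_ ⟨?_, fun b hb => Memory.write_of_ne _ _ _ hb⟩).seqB (c' := 47)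
    fun s₁ hs₁ => ?_).raise hB1 (by norm_num) le_rfl
  · simp only [time_const]; omega
  · rw [eval_const, Memory.write_self]
  have h := Runs.forLoop (s := s₁) (v := 8) (a := 0) (n := n) (B := B) (c := 10) (d := 1)
    (body := .assign 18 (const 0) (var 18 + read 17 (var 8)))
    (I := fun j s' => s' 18 0 = ∑ w ∈ Finset.range j, s 17 (w : ℤ)) hB1 hnB
    (by simp [Program.writes]) (by simp [Program.writes]) (by rw [hs₁.2 0 (by decide), hs])
    (fun m s' z h => by simpa [Memory.write_of_ne] using h) (by simpa using hs₁.1)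
    (fun j hj s' hI hv hfr => by
      refine Runs.assign ?_ ?_
      · simp only [time_const, time_add, time_var, time_read, pow_one]; omega
      · rw [eval_const, Memory.write_self, eval_add, eval_var, eval_read, eval_var, hI, hv,
          hfr 17 (by simp [Program.writes]), hs₁.2 17 (by decide), Finset.sum_range_succ])
  refine (h.imp fun s' hs' => ⟨?_, fun b hb => ?_⟩).raise hB1 (by norm_num) le_rfl
  · rw [hs'.1, Finset.sum_range]
    rw [Finset.sum_congr rfl fun y _ => hL y, Finset.sum_boole, Finset.filter_univ_mem]
  · simp at hb
    rw [hs'.2 b (by simp [Program.writes]; tauto), hs₁.2 b hb.2]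

/-- Array `2` becomes the list of the indicators of the color classes. -/
def outputProg : Program :=
  forLoop 10 20 (.assign 2 (var 10) (lt (const 0) (read 17 (var 10 - var 10 / var 0 * var 0) -
    neTest (classOf (var 10 - var 10 / var 0 * var 0)) (var 10 / var 0))))

theorem outputProg_runs {k : ℕ} {L : Finset (Fin n)} (hn : 0 < n) (hnB : n ≤ B)
    (hkB : k * n ≤ B) (hs : HoldsGraph G cl s)
    (htb : ∀ y : Fin n, s 16 (cl y : ℤ) = σ (cl y)) (hL : HoldsSet L s)
    (h20 : s 20 0 = ((k * n : ℕ) : ℤ)) :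
    Runs outputProg s (200 * B ^ 2) (fun s' => (∀ i < k, ∀ x : Fin n,
      s' 2 ((i : ℤ) * n + (x : ℤ)) = 1 ↔ x ∈ L ∧ σ (cl x) = i) ∧
      ∀ b, b ∉ [2, 10] → s' b = s b) := by
  have hB1 : 1 ≤ B := le_trans hn hnB
  have h := Runs.fill (B := B) (v := 10) (a := 20) (arr := 2) (n := k * n) (s := s) (c := 100)
    (e := lt (const 0) (read 17 (var 10 - var 10 / var 0 * var 0) -
      neTest (classOf (var 10 - var 10 / var 0 * var 0)) (var 10 / var 0)))
    (val := fun m => if h : m % n < n then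
      (if (⟨m % n, h⟩ : Fin n) ∈ L ∧ σ (cl ⟨m % n, h⟩) = m / n then 1 else 0) else 0) hB1 hkB
    (by decide) (by decide) (by decide) h20 (fun m hm s' hv hfr _ => by
      have hG' : HoldsGraph G cl s' := hs.congr fun b hb => hfr b (by omega) (by omega)
      have hmn : m % n < n := Nat.mod_lt _ hn
      have hbn : bitLength (n : ℤ) ≤ B := bitLength_natCast_le hnB
      have hbm : bitLength (m : ℤ) ≤ B := bitLength_natCast_le (hm.le.trans hkB)
      have hbd : bitLength ((m / n : ℕ) : ℤ) ≤ B :=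
        bitLength_natCast_le ((Nat.div_le_self _ _).trans (hm.le.trans hkB))
      have hdm : m / n * n + m % n = m := by rw [mul_comm]; exact Nat.div_add_mod m n
      have hdiv : (m : ℤ) / (n : ℤ) = ((m / n : ℕ) : ℤ) := by push_cast; rfl
      have hmod : (m : ℤ) - ((m / n : ℕ) : ℤ) * n = ((m % n : ℕ) : ℤ) := by
        have h' : ((m / n : ℕ) : ℤ) * (n : ℤ) + ((m % n : ℕ) : ℤ) = m := by exact_mod_cast hdm
        linear_combination -h'
      have e17 : s' 17 ((m % n : ℕ) : ℤ) = if (⟨m % n, hmn⟩ : Fin n) ∈ L then 1 else 0 := by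
        rw [hfr 17 (by decide) (by decide)]; exact hL ⟨m % n, hmn⟩
      have e14 : s' 14 ((m % n : ℕ) : ℤ) = cl ⟨m % n, hmn⟩ := hG'.label ⟨m % n, hmn⟩
      have e16 : s' 16 (cl ⟨m % n, hmn⟩ : ℤ) = σ (cl ⟨m % n, hmn⟩) := by
        rw [hfr 16 (by decide) (by decide), htb]
      constructor
      · have hiff : ((σ (cl ⟨m % n, hmn⟩) : ℕ) : ℤ) = ((m / n : ℕ) : ℤ) ↔
            σ (cl ⟨m % n, hmn⟩) = m / n := Nat.cast_inj
        rw [dif_pos hmn]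
        simp only [classOf, eval_lt, eval_sub, eval_read, eval_mul, eval_div, eval_var,
          eval_const, neTest_eval, hv, hG'.size, hdiv, hmod, e17, e14, e16, hiff]
        by_cases h1 : (⟨m % n, hmn⟩ : Fin n) ∈ L <;>
          by_cases h2 : σ (cl ⟨m % n, hmn⟩) = m / n <;> simp [h1, h2]
      · simp only [neTest, classOf, time_lt, time_sub, time_add, time_read, time_mul, time_div,
          time_var, time_const, eval_div, eval_var, hv, hG'.size, hdiv]
        omega)
  refine (h.imp fun s' hs' => ⟨fun i hi x => ?_, fun b hb => ?_⟩).raise hB1 (by norm_num) le_rfl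
  · have hlt : i * n + x < k * n := by
      calc i * n + x < i * n + n := by have := x.2; omega
        _ = (i + 1) * n := by ring
        _ ≤ k * n := Nat.mul_le_mul_right _ hi
    have h1 := hs'.1 (i * n + x) hlt
    simp only [index_div x.2, index_mod x.2, x.2, dif_pos, Fin.eta] at h1
    push_cast at h1
    rw [h1]
    simp
  · simp at hb
    exact hs'.2 b hb.2 hb.1

/-- Array `2` holds a best coloring among those that belong to the tables of `T`, and number `19`
is the number of vertices that it covers (`-1` if there is no coloring yet). -/
structure HoldsBest {n : ℕ} (G : SimpleGraph (Fin n)) (cl : Fin n → ℕ) (k : ℕ)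
    (T : Set (ℕ → ℕ)) (s : Memory) : Prop where
  best : ∀ σ ∈ T, ∃ L, IsRounding G (fun x => σ (cl x)) L ∧ (L.card : ℤ) ≤ s 19 0
  attained : s 19 0 = -1 ∨ ∃ (σ : ℕ → ℕ) (L : Finset (Fin n)), (∀ l, σ l < k) ∧ IsRounding G (fun x => σ (cl x)) L ∧
    (∀ i < k, ∀ x : Fin n, s 2 ((i : ℤ) * n + (x : ℤ)) = 1 ↔ x ∈ L ∧ σ (cl x) = i) ∧
    s 19 0 = L.card

/-- The coloring that belongs to the table `σ` replaces the current one if it is better. -/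
def colorProg (κ : ℕ) (σ : ℕ → ℕ) : Program :=
  .seq (tableProg σ (κ + 1)) (
  .seq (forLoop 8 0 (.assign 17 (var 8) (const 1))) (
  .seq matchProg (
  .seq countProg (
  .cond (lt (var 19) (var 18)) (.seq (.assign 19 (const 0) (var 18)) outputProg) .nop))))

/-- Arrays `16` and `17` are refilled first, so nothing about them is assumed. The output and number
`19` change together, and only on strict improvement. -/
theorem colorProg_runs {k κ : ℕ} {T : Set (ℕ → ℕ)} (hn : 0 < n) (hB : n * n ≤ B)
    (hkB : k * n ≤ B) (hκB : κ ≤ B) (hσ : ∀ l, σ l < k) (hcl : ∀ y, cl y ≤ κ)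
    (hs : HoldsGraph G cl s) (h20 : s 20 0 = ((k * n : ℕ) : ℤ)) (hT : HoldsBest G cl k T s) :
    Runs (colorProg κ σ) s (450 * B ^ 2) (fun s' => HoldsGraph G cl s' ∧
      s' 20 0 = ((k * n : ℕ) : ℤ) ∧ HoldsBest G cl k (insert σ T) s') := by
  have hnB : n ≤ B := le_trans (Nat.le_mul_of_pos_left _ hn) hB
  have hB1 : 1 ≤ B := le_trans hn hnB
  have hB2 : B ≤ B ^ 2 := Nat.le_self_pow two_ne_zero B
  refine (((tableProg_runs σ s (κ + 1)).mono (T' := 7 * B ^ 2) (by omega) fun _ => id).seqB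
    (c' := 440) fun s₁ hs₁ => ?_).raise hB1 (by norm_num) le_rfl
  have hG₁ : HoldsGraph G cl s₁ := hs.congr fun b hb => hs₁.2 b (by omega)
  refine ((Runs.fill (B := B) (v := 8) (a := 0) (arr := 17) (n := n) (s := s₁) (c := 1)
    (e := const 1) (val := fun _ => 1) hB1 hnB (by decide) (by decide) (by decide) hG₁.size
    (fun m hm s' _ _ _ => ⟨rfl, by rw [time_const]; omega⟩)).seqB (c' := 400)
    fun s₂ hs₂ => ?_).raise hB1 (by norm_num) le_rfl
  have hG₂ : HoldsGraph G cl s₂ := hG₁.congr fun b hb => hs₂.2 b (by omega) (by omega)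
  have htb₂ : ∀ y : Fin n, s₂ 16 (cl y : ℤ) = σ (cl y) := fun y => by
    rw [hs₂.2 16 (by decide) (by decide), hs₁.1 _ (Nat.lt_succ_of_le (hcl y))]
  refine ((matchProg_runs hn hB hG₂ htb₂ fun y => by
    rw [hs₂.1 y y.2, if_pos (Finset.mem_univ y)]).seqB (c' := 270)
    fun s₃ hs₃ => ?_).raise hB1 (by norm_num) le_rfl
  obtain ⟨⟨L, hL, hset⟩, hfr₃⟩ := hs₃
  have hG₃ : HoldsGraph G cl s₃ := hG₂.congr fun b hb => hfr₃ b (by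
    rcases hb with rfl | rfl | rfl | rfl <;> decide)
  refine ((countProg_runs hB1 hnB hG₃.size hset).seqB (c' := 220)
    fun s₄ hs₄ => ?_).raise hB1 (by norm_num) le_rfl
  have hG₄ : HoldsGraph G cl s₄ := hG₃.congr fun b hb => hs₄.2 b (by
    rcases hb with rfl | rfl | rfl | rfl <;> decide)
  have hof : ∀ b, b ∉ [7, 8, 10, 16, 17, 18] → s₄ b = s b := fun b hb => by
    simp at hb
    rw [hs₄.2 b (by simp; tauto), hfr₃ b (by simp; tauto), hs₂.2 b (by tauto) (by tauto),
      hs₁.2 b (by tauto)]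
  have e19 : s₄ 19 = s 19 := hof 19 (by decide)
  have e2 : s₄ 2 = s 2 := hof 2 (by decide)
  have e20 : s₄ 20 0 = ((k * n : ℕ) : ℤ) := by rw [hof 20 (by decide), h20]
  have hset₄ : HoldsSet L s₄ := fun y => by rw [hs₄.2 17 (by decide), hset y]
  have htb₄ : ∀ y : Fin n, s₄ 16 (cl y : ℤ) = σ (cl y) := fun y => by
    rw [hs₄.2 16 (by decide), hfr₃ 16 (by decide), htb₂]
  refine Runs.cond (T := 210 * B ^ 2) (fun hne => ?_) (fun heq => ?_) ?_
  · have hlt : s 19 0 < L.card := by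
      by_contra hcon
      rw [eval_lt, eval_var, eval_var, e19, hs₄.1, if_neg hcon] at hne
      exact hne rfl
    refine ((Runs.assign (T := 5 * B ^ 2) (Q := fun s₅ => s₅ 19 0 = L.card ∧
      ∀ b, b ≠ 19 → s₅ b = s₄ b) ?_ ⟨?_, fun b hb => Memory.write_of_ne _ _ _ hb⟩).seqB
      (c' := 205) fun s₅ hs₅ => ?_).raise hB1 (by norm_num) le_rfl
    · simp only [time_const, time_var]; omega
    · rw [eval_const, Memory.write_self, eval_var, hs₄.1]
    have hG₅ : HoldsGraph G cl s₅ := hG₄.congr fun b hb => hs₅.2 b (by omega)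
    refine ((outputProg_runs hn hnB hkB hG₅ (fun y => by rw [hs₅.2 16 (by decide), htb₄])
      (fun y => by rw [hs₅.2 17 (by decide), hset₄ y])
      (by rw [hs₅.2 20 (by decide), e20])).imp fun s₆ hs₆ => ?_).raise hB1 (by norm_num) le_rfl
    have h19 : s₆ 19 0 = L.card := by rw [hs₆.2 19 (by decide), hs₅.1]
    refine ⟨hG₅.congr fun b hb => hs₆.2 b (by rcases hb with rfl | rfl | rfl | rfl <;> decide), ?_,
      ⟨?_, Or.inr ⟨σ, L, hσ, hL, hs₆.1, h19⟩⟩⟩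
    · rw [hs₆.2 20 (by decide), hs₅.2 20 (by decide), e20]
    · rintro τ (rfl | hτ)
      · exact ⟨L, hL, h19.ge⟩
      · obtain ⟨L', h1, h2⟩ := hT.best τ hτ
        exact ⟨L', h1, by rw [h19]; exact h2.trans hlt.le⟩
  · have hle : (L.card : ℤ) ≤ s 19 0 := by
      by_contra hcon
      rw [eval_lt, eval_var, eval_var, e19, hs₄.1, if_pos (not_le.1 hcon)] at heq
      exact one_ne_zero heq
    refine Runs.nop (by omega) ⟨hG₄, e20, ⟨?_, ?_⟩⟩
    · rw [e19]
      rintro τ (rfl | hτ)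
      · exact ⟨L, hL, hle⟩
      · exact hT.best τ hτ
    · rw [e19, e2]; exact hT.attained
  · simp only [time_lt, time_var]; omega

/-- A best coloring over a list of tables. -/
def bestProg (κ : ℕ) : List (ℕ → ℕ) → Program
  | [] => .nop
  | σ :: T => .seq (colorProg κ σ) (bestProg κ T)

theorem bestProg_runs {k κ : ℕ} (hn : 0 < n) (hB : n * n ≤ B) (hkB : k * n ≤ B) (hκB : κ ≤ B)
    (hcl : ∀ y, cl y ≤ κ) (T : List (ℕ → ℕ)) :
    ∀ (T₀ : Set (ℕ → ℕ)) (s : Memory), (∀ σ ∈ T, ∀ l, σ l < k) → HoldsGraph G cl s →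
      s 20 0 = ((k * n : ℕ) : ℤ) → HoldsBest G cl k T₀ s →
      Runs (bestProg κ T) s ((450 * T.length + 1) * B ^ 2)
        (fun s' => HoldsBest G cl k ({σ | σ ∈ T} ∪ T₀) s') := by
  have hB1 : 1 ≤ B := le_trans (Nat.mul_pos hn hn) hB
  induction T with
  | nil =>
    intro T₀ s _ _ _ h
    refine Runs.nop ?_ (by simpa using h)
    exact Nat.mul_pos (Nat.succ_pos _) (Nat.one_le_pow _ _ hB1)
  | cons σ T ih =>
    intro T₀ s hT hs h20 h
    refine (((colorProg_runs hn hB hkB hκB (hT σ List.mem_cons_self) hcl hs h20 h).seqB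
      fun s₁ hs₁ => ih (insert σ T₀) s₁ (fun τ hτ => hT τ (List.mem_cons_of_mem _ hτ))
        hs₁.1 hs₁.2.1 hs₁.2.2).raise hB1 (by simp; omega) le_rfl).imp fun s' hs' => ?_
    have : ({τ | τ ∈ σ :: T} ∪ T₀ : Set (ℕ → ℕ)) = {τ | τ ∈ T} ∪ insert σ T₀ := by
      ext τ
      simp only [Set.mem_union, Set.mem_ofPred_eq, List.mem_cons, Set.mem_insert_iff]
      tauto
    rw [this]
    exact hs'

/-- All tables with values below `k` for the labels up to `κ`. -/
noncomputable def tables (κ k : ℕ) : List (ℕ → ℕ) :=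
  (Finset.univ : Finset (Fin (κ + 1) → Fin k)).toList.map
    fun f l => if h : l < κ + 1 then (f ⟨l, h⟩ : ℕ) else 0

theorem lt_of_mem_tables {κ k : ℕ} (hk : 0 < k) {σ : ℕ → ℕ} (h : σ ∈ tables κ k) (l : ℕ) :
    σ l < k := by
  obtain ⟨f, -, rfl⟩ := List.mem_map.1 h
  dsimp only
  split_ifs with hl
  exacts [(f _).2, hk]

/-- Only labels up to `κ` occur, so this finite list represents every table. -/
theorem exists_mem_tables {κ k : ℕ} {τ : ℕ → ℕ} (h : ∀ l, τ l < k) :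
    ∃ σ ∈ tables κ k, ∀ l ≤ κ, σ l = τ l := by
  refine ⟨_, List.mem_map.2 ⟨fun l => ⟨τ l, h l⟩, by simp, rfl⟩, fun l hl => ?_⟩
  simp [Nat.lt_succ_of_le hl]

/-- A best coloring over all tables. -/
noncomputable def enumProg (κ k : ℕ) : Program :=
  .seq (.assign 19 (const 0) (const (-1))) (
  .seq (.assign 20 (const 0) (const k * var 0)) (bestProg κ (tables κ k)))

theorem enumProg_runs {n : ℕ} {G : SimpleGraph (Fin n)} [DecidableRel G.Adj] {cl : Fin n → ℕ}
    {s : Memory} {B k κ : ℕ} (hn : 0 < n) (hB : n * n ≤ B) (hk : 0 < k) (hkB : k * n ≤ B)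
    (hκB : κ ≤ B) (hcl : ∀ y, cl y ≤ κ) (hs : HoldsGraph G cl s) :
    Runs (enumProg κ k) s ((450 * (tables κ k).length + 20) * B ^ 2) (fun s' =>
      ∃ (σ : ℕ → ℕ) (L : Finset (Fin n)), (∀ l, σ l < k) ∧ IsRounding G (fun x => σ (cl x)) L ∧
        (∀ i < k, ∀ x : Fin n, s' 2 ((i : ℤ) * n + (x : ℤ)) = 1 ↔ x ∈ L ∧ σ (cl x) = i) ∧
        ∀ τ : ℕ → ℕ, (∀ l, τ l < k) → ∃ L', IsRounding G (fun x => τ (cl x)) L' ∧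
          L'.card ≤ L.card) := by
  have hnB : n ≤ B := le_trans (Nat.le_mul_of_pos_left _ hn) hB
  have hB1 : 1 ≤ B := le_trans hn hnB
  have hB2 : B ≤ B ^ 2 := Nat.le_self_pow two_ne_zero B
  refine ((Runs.assign (T := 3 * B ^ 2) (Q := fun s₁ => s₁ 19 0 = -1 ∧
    ∀ b, b ≠ 19 → s₁ b = s b) ?_ ⟨?_, fun b hb => Memory.write_of_ne _ _ _ hb⟩).seqB
    (c' := 450 * (tables κ k).length + 15) fun s₁ hs₁ => ?_).raise hB1 (by omega) le_rfl
  · simp only [time_const]; omega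
  · rw [eval_const, Memory.write_self, eval_const]
  have hG₁ : HoldsGraph G cl s₁ := hs.congr fun b hb => hs₁.2 b (by omega)
  have hbk : bitLength (k : ℤ) ≤ B :=
    bitLength_natCast_le ((Nat.le_mul_of_pos_right _ hn).trans hkB)
  have hbn : bitLength (n : ℤ) ≤ B := bitLength_natCast_le hnB
  refine ((Runs.assign (T := 10 * B ^ 2) (Q := fun s₂ => s₂ 20 0 = ((k * n : ℕ) : ℤ) ∧
    ∀ b, b ≠ 20 → s₂ b = s₁ b) ?_ ⟨?_, fun b hb => Memory.write_of_ne _ _ _ hb⟩).seqB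
    fun s₂ hs₂ => ((bestProg_runs hn hB hkB hκB hcl (tables κ k) ∅ s₂
      (fun σ hσ => lt_of_mem_tables hk hσ) (hG₁.congr fun b hb => hs₂.2 b (by omega)) hs₂.1
      ⟨fun σ hσ => absurd hσ (Set.notMem_empty σ), Or.inl ?_⟩).imp
      fun s' hs' => ?_)).raise hB1 (by omega) le_rfl
  · simp only [time_const, time_mul, time_var, eval_const, eval_var, hG₁.size]; omega
  · rw [eval_const, Memory.write_self, eval_mul, eval_const, eval_var, hG₁.size]; push_cast; rfl
  · rw [hs₂.2 19 (by decide), hs₁.1]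
  have hbest : ∀ τ : ℕ → ℕ, (∀ l, τ l < k) → ∃ L', IsRounding G (fun x => τ (cl x)) L' ∧
      (L'.card : ℤ) ≤ s' 19 0 := fun τ hτ => by
    obtain ⟨σ, hσ, h⟩ := exists_mem_tables (κ := κ) hτ
    obtain ⟨L', h1, h2⟩ := hs'.best σ (Or.inl hσ)
    have : (fun x => τ (cl x)) = fun x => σ (cl x) := funext fun x => (h _ (hcl x)).symm
    exact ⟨L', this ▸ h1, h2⟩
  -- The initial `-1` is below every cardinality; as `0 < k`, the constant table `0` rules out that
  -- it survives.
  rcases hs'.attained with h | ⟨σ, L, h1, h2, h3, h4⟩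
  · obtain ⟨L', -, h'⟩ := hbest (fun _ => 0) fun _ => hk
    omega
  · refine ⟨σ, L, h1, h2, h3, fun τ hτ => ?_⟩
    obtain ⟨L', h5, h6⟩ := hbest τ hτ
    exact ⟨L', h5, by omega⟩

end Programs

/-! ### The coloring algorithm -/

section InputMemory

variable {n : ℕ} (G : SimpleGraph (Fin n)) [DecidableRel G.Adj]

theorem inputMemory_size : inputMemory G 0 0 = n := rfl

theorem inputMemory_matrix : HoldsMatrix (inputMemory G 1) (G.adjMatrix ℤ) := by
  intro x y
  rw [SimpleGraph.adjMatrix_apply]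
  simp only [inputMemory, one_ne_zero, if_false, if_true]
  refine if_congr ⟨?_, fun h => ⟨x, y, h, rfl⟩⟩ rfl rfl
  rintro ⟨u, v, huv, h⟩
  have h' : (u : ℕ) * n + v = x * n + y := by exact_mod_cast h.symm
  obtain ⟨h1, h2⟩ := index_injective h'
  obtain ⟨h3, h4⟩ := index_injective (rfl : (x : ℕ) * n + y = x * n + y)
  rwa [Fin.ext (h1.trans h3.symm), Fin.ext (h2.trans h4.symm)] at huv

theorem inputMemory_of_two_le {a : ℕ} (ha : 2 ≤ a) (i : ℤ) : inputMemory G a i = 0 := by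
  rw [inputMemory, if_neg (by omega), if_neg (by omega)]

end InputMemory

/-- Rounding up to a power of two at most doubles `n * N`, so the exponent in the digit bound is
quadratic in `n`. -/
theorem two_pow_clog_le {m : ℕ} (hm : 0 < m) : 2 ^ Nat.clog 2 m ≤ 2 * m := by
  rcases Nat.lt_or_ge 1 m with h | h
  · have h1 := Nat.pow_pred_clog_lt_self Nat.one_lt_two h
    have h2 : 0 < Nat.clog 2 m := Nat.clog_pos Nat.one_lt_two h
    rw [← Nat.sub_add_cancel h2, pow_succ, mul_comm]
    exact Nat.mul_le_mul_left _ h1.le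
  · obtain rfl : m = 1 := by omega
    simp

/-- The numbers that occur in the filter have polynomially many digits. -/
theorem size_le_mul_pow {n N i : ℕ} (hn : 0 < n) (hN : 0 < N) :
    (2 * (3 * n * n) ^ 2 ^ (1 + i + 2 * Nat.clog 2 (n * N))).size ≤
      (24 * 2 ^ i * N ^ 2 + 2) * n ^ 4 := by
  set m := 2 ^ (1 + i + 2 * Nat.clog 2 (n * N)) with hm
  have h1 : m ≤ 8 * 2 ^ i * N ^ 2 * n ^ 2 := by
    have h := Nat.pow_le_pow_left (two_pow_clog_le (Nat.mul_pos hn hN)) 2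
    calc m = 2 * 2 ^ i * (2 ^ Nat.clog 2 (n * N)) ^ 2 := by
          rw [hm, pow_add, pow_add, pow_mul, ← pow_mul, ← pow_mul, mul_comm 2 (Nat.clog _ _)]; ring
      _ ≤ 2 * 2 ^ i * (2 * (n * N)) ^ 2 := Nat.mul_le_mul_left _ h
      _ = _ := by ring
  have h2 : (3 * n * n) ^ m ≤ 2 ^ (3 * n * n * m) := by
    rw [pow_mul]
    exact Nat.pow_le_pow_left Nat.lt_two_pow_self.le _
  have h3 : (2 * (3 * n * n) ^ m).size ≤ 3 * n * n * m + 2 := by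
    rw [Nat.size_le, pow_add]
    have : 0 < 2 ^ (3 * n * n * m) := by positivity
    omega
  have hn4 : 1 ≤ n ^ 4 := Nat.one_le_pow _ _ hn
  calc _ ≤ 3 * n * n * m + 2 := h3
    _ ≤ 3 * n * n * (8 * 2 ^ i * N ^ 2 * n ^ 2) + 2 * n ^ 4 :=
        add_le_add (Nat.mul_le_mul_left _ h1) (by omega)
    _ = _ := by ring

/-- Filtering, clustering, and rounding of all assignments of classes to clusters. -/
noncomputable def coloringProg (i N P κ k : ℕ) : Program :=
  .seq (filterProg i N) (.seq (clusterProg P κ) (enumProg κ k))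

/-- With `B = K₀ * n ^ 4`, where `n ^ 4` stems from the digits of the filter, the filter takes `O(B
^ 4)` and the other phases no more; this gives the exponent `16`. The number of tables enters only
the constant. -/
theorem coloringProg_runs (i P κ : ℕ) {N k : ℕ} (hN : 0 < N) (hk : 0 < k) :
    ∃ K : ℕ, ∀ {n d : ℕ} {G : SimpleGraph (Fin n)} [DecidableRel G.Adj], 0 < n →
      G.IsRegularOfDegree d → Runs (coloringProg i N P κ k) (inputMemory G) (K * n ^ 16)
      (fun s => ∃ (j : ℕ) (cl : Fin n → ℕ), n * N ≤ 2 ^ j ∧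
        IsClustering (intFilter i j (G.adjMatrix ℤ, (d : ℤ))) P κ cl ∧
        ∃ (σ : ℕ → ℕ) (L : Finset (Fin n)), (∀ l, σ l < k) ∧
          IsRounding G (fun x => σ (cl x)) L ∧
          (∀ a < k, ∀ x : Fin n, s 2 ((a : ℤ) * n + (x : ℤ)) = 1 ↔ x ∈ L ∧ σ (cl x) = a) ∧
          ∀ τ : ℕ → ℕ, (∀ l, τ l < k) → ∃ L', IsRounding G (fun x => τ (cl x)) L' ∧
            L'.card ≤ L.card) := by
  set K₀ : ℕ := 24 * 2 ^ i * N ^ 2 + 2 + N + P + i + κ + k with hK₀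
  refine ⟨(450 * (tables κ k).length + 3420) * K₀ ^ 4, fun {n d G} _ hn hreg => ?_⟩
  set B : ℕ := K₀ * n ^ 4 with hBdef
  have hbound : ∀ {a m : ℕ}, m ≤ K₀ → a ≤ m * n ^ 4 → a ≤ B := fun h1 h2 =>
    h2.trans (Nat.mul_le_mul_right _ h1)
  have hnn : n * n ≤ n ^ 4 := by
    rw [← pow_two]; exact Nat.pow_le_pow_right hn (by norm_num)
  have hn1 : n ≤ n ^ 4 := Nat.le_self_pow (by norm_num) n
  have hn4 : 1 ≤ n ^ 4 := Nat.one_le_pow _ _ hn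
  have hB : n * n ≤ B := hbound (m := 1) (by omega) (by omega)
  have hB1 : 1 ≤ B := le_trans (Nat.mul_pos hn hn) hB
  have hnB : n ≤ B := hbound (m := 1) (by omega) (by omega)
  have hiB : i ≤ B := hbound (m := i) (by omega) (Nat.le_mul_of_pos_right _ hn4)
  have hκB : κ ≤ B := hbound (m := κ) (by omega) (Nat.le_mul_of_pos_right _ hn4)
  have hNB : n * N ≤ B := hbound (m := N) (by omega) (by
    rw [mul_comm]; exact Nat.mul_le_mul_left _ hn1)
  have hPB : n * P ≤ B := hbound (m := P) (by omega) (by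
    rw [mul_comm]; exact Nat.mul_le_mul_left _ hn1)
  have hkB : k * n ≤ B := hbound (m := k) (by omega) (Nat.mul_le_mul_left _ hn1)
  have hE : (2 * (3 * n * n) ^ 2 ^ (1 + i + 2 * Nat.clog 2 (n * N))).size ≤ B :=
    hbound (by omega) (size_le_mul_pow hn hN)
  have hrow : ∀ x, ∑ y, G.adjMatrix ℤ x y = d := fun x => by
    simp only [SimpleGraph.adjMatrix_apply, Finset.sum_boole, ← hreg x,
      ← SimpleGraph.card_neighborFinset_eq_degree, SimpleGraph.neighborFinset_eq_filter]
  have hdn : d ≤ n := by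
    rw [← hreg ⟨0, hn⟩]
    exact (G.degree_lt_card_verts _).le.trans (by simp)
  have hT : (450 * (tables κ k).length + 3420) * K₀ ^ 4 * n ^ 16 =
      (3000 + (450 * (tables κ k).length + 420)) * B ^ 4 := by
    rw [hBdef]; ring
  rw [hT, coloringProg]
  refine (filterProg_runs (i := i) (N := N) (d := d) (s := inputMemory G) hn hB hiB hNB
    ((Nat.size_le_size (Nat.le_mul_of_pos_left _ two_pos)).trans hE) (inputMemory_size G)
    (inputMemory_matrix G) (fun x y => by rw [SimpleGraph.adjMatrix_apply]; split_ifs <;> simp)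
    hrow hdn).seqB (c' := 450 * (tables κ k).length + 420) fun s₁ hs₁ => ?_
  obtain ⟨⟨j, hj, hbd, hfil⟩, hfr₁⟩ := hs₁
  have hc := clusterProg_runs (P := P) (κ := κ) hn hnB hPB hκB hE hbd hfil
    (fun y => by rw [hfr₁ 14 (by decide)]; exact inputMemory_of_two_le G (by norm_num) _)
    (by rw [hfr₁ 15 (by decide)]; exact inputMemory_of_two_le G (by norm_num) _)
  refine ((hc.raise (d' := 4) hB1 le_rfl (by norm_num)).seqB
    (c' := 450 * (tables κ k).length + 20) fun s₂ hs₂ => ?_).raise hB1 (by omega) le_rfl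
  obtain ⟨⟨cl, hcl, hle, hlab⟩, hfr₂⟩ := hs₂
  have hof : ∀ b, b = 0 ∨ b = 1 → s₂ b = inputMemory G b := fun b hb => by
    rcases hb with rfl | rfl
    · rw [hfr₂ 0 (by decide), hfr₁ 0 (by decide)]
    · rw [hfr₂ 1 (by decide), hfr₁ 1 (by decide)]
  have hG : HoldsGraph G cl s₂ := ⟨by rw [hof 0 (by simp), inputMemory_size],
    by rw [hfr₂ 6 (by decide), hfil.sq], by rw [hof 1 (by simp)]; exact inputMemory_matrix G,
    hlab⟩
  exact ((enumProg_runs hn hB hk hkB hκB hle hG).raise hB1 le_rfl (by norm_num)).imp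
    fun s₃ hs₃ => ⟨j, cl, hj, hcl, hs₃⟩

theorem IsRounding.isKColoring {n k : ℕ} {G : SimpleGraph (Fin n)} {col : Fin n → ℕ}
    {L : Finset (Fin n)} {s : Memory} {ε : ℝ} (hL : IsRounding G col L) (hcol : ∀ x, col x < k)
    (hs : ∀ a < k, ∀ x : Fin n, s 2 ((a : ℤ) * n + (x : ℤ)) = 1 ↔ x ∈ L ∧ col x = a)
    (hε : (1 - ε) * n ≤ L.card) : IsKColoring G ε (outputSets n k s) := by
  have hmem : ∀ (a : Fin k) x, x ∈ outputSets n k s a ↔ x ∈ L ∧ col x = a := fun a x => by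
    rw [outputSets, Finset.mem_filter, ← hs a a.2 x]
    simp
  refine ⟨fun a b hab => Finset.disjoint_left.2 fun x hx hy => ?_, fun a x hx y hy hadj => ?_,
    hε.trans ?_⟩
  · exact hab (Fin.ext (((hmem a x).1 hx).2.symm.trans ((hmem b x).1 hy).2))
  · have h1 := (hmem a x).1 hx
    have h2 := (hmem a y).1 hy
    exact hL.indep x h1.1 y h2.1 hadj (h1.2.trans h2.2.symm)
  · have : L ⊆ Finset.univ.biUnion (outputSets n k s) := fun x hx =>
      Finset.mem_biUnion.2 ⟨⟨col x, hcol x⟩, Finset.mem_univ _, (hmem _ x).2 ⟨hx, rfl⟩⟩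
    exact_mod_cast Finset.card_le_card this

theorem IsReversibleRowStochastic.exists_isStationaryDistribution {k : ℕ}
    {M : Matrix (Fin k) (Fin k) ℝ} (hM : IsReversibleRowStochastic M) :
    ∃ π, IsStationaryDistribution M π := by
  obtain ⟨π, hπ, hbal⟩ := hM.detailed_balance
  refine ⟨π, hπ, funext fun b => ?_⟩
  rw [Matrix.vecMul, dotProduct, Finset.sum_congr rfl fun a _ => hbal a b, ← Finset.mul_sum,
    hM.row_sum, mul_one]

theorem isRowPartition_singleton {k : ℕ} {M : Matrix (Fin k) (Fin k) ℝ}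
    (h : Function.Injective M.row) : IsRowPartition M fun a => {a} where
  nonempty a := Finset.singleton_nonempty a
  cover a := ⟨a, Finset.mem_singleton_self a⟩
  row_eq i a ha b hb := by rw [Finset.mem_singleton.1 ha, Finset.mem_singleton.1 hb]
  row_ne i j hij a ha b hb := by
    rw [Finset.mem_singleton.1 ha, Finset.mem_singleton.1 hb]
    exact h.ne hij

theorem mainTheorem2 :
    ∃ c : ℕ, ∀ (k : ℕ) (M : Matrix (Fin k) (Fin k) ℝ),
      IsReversibleRowStochastic M → (∀ a, M a a = 0) → secondEigenvalue M ≤ 0 →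
      ∃ C δ₀ lam₀ : ℝ, 0 < C ∧ 0 < δ₀ ∧ 0 < lam₀ ∧
        ∀ δ lam : ℝ, 0 < δ → δ ≤ δ₀ → 0 < lam → lam ≤ lam₀ →
        ∃ (K : ℕ) (P : Program),
          ∀ (n d : ℕ) (G : SimpleGraph (Fin n)) [DecidableRel G.Adj],
            G.IsRegularOfDegree d → IsModelColorable G M δ → IsOneSidedExpander G lam →
            ∃ (t : ℕ) (s : Memory), Exec P (inputMemory G) t s ∧ t ≤ K * n ^ c ∧
              (∀ (π : Fin k → ℝ) (k' : ℕ) (S : Fin k' → Finset (Fin k)) (aStar : Fin k' → Fin k),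
                IsStationaryDistribution M π → IsRowPartition M S →
                (∀ i, aStar i ∈ S i ∧ ∀ a ∈ S i, π a ≤ π (aStar i)) →
                IsKColoring G
                  (1 - (∑ i, max 0 (π (aStar i) - ∑ a ∈ (S i).erase (aStar i), π a))
                    + C * (√δ + lam + δ / lam))
                  (outputSets n k' s)) ∧
              (Function.Injective M.row →
                IsKColoring G (C * (√δ + lam + δ / lam)) (outputSets n k s)) := by
  refine ⟨16, fun k M hM _ hsec => ?_⟩
  obtain ⟨C, δ₀, lam₀, P, hC, hδ₀, hlam₀, -, hm, hpar⟩ := exists_parameters hM hsec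
  refine ⟨C, δ₀, lam₀, hC, hδ₀, hlam₀, fun δ lam hδ hδ' hlam hlam' => ?_⟩
  obtain ⟨i, N, κ, hN, -, hpar⟩ := hpar lam hlam hlam'
  obtain ⟨K, hK⟩ := coloringProg_runs i P κ hN hm
  refine ⟨K, coloringProg i N P κ (rowCount M), fun n d G _ hreg hcolb hexp => ?_⟩
  obtain ⟨hn, -, hpar⟩ := hpar δ hδ hδ' n d G hreg hcolb hexp
  obtain ⟨t, s, hexec, ht, j, cl, hj, hcl, σ, L, hσ, hL, hout, hbest⟩ := hK hn hreg
  -- The good table `τ` depends on the unknown partition, but the output is at least as large as the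
  -- rounding that the search produces for it.
  obtain ⟨τ, hτ, hround⟩ := hpar j cl hj hcl
  obtain ⟨L', hL', hle⟩ := hbest τ hτ
  have hpart : ∀ (π : Fin k → ℝ) (k' : ℕ) (S : Fin k' → Finset (Fin k)) (aStar : Fin k' → Fin k),
      IsStationaryDistribution M π → IsRowPartition M S → (∀ i, aStar i ∈ S i) →
      IsKColoring G (1 - (∑ i, max 0 (π (aStar i) - ∑ a ∈ (S i).erase (aStar i), π a))
        + C * (√δ + lam + δ / lam)) (outputSets n k' s) := by
    intro π k' S aStar hπ hS haS
    obtain rfl := hS.eq_rowCount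
    refine hL.isKColoring (fun x => hσ _) hout ?_
    have h1 := hround L' hL' π _ S aStar hπ hS haS
    have h2 : (L'.card : ℝ) ≤ L.card := by exact_mod_cast hle
    refine le_trans (le_of_eq ?_) (h1.trans h2)
    ring
  refine ⟨t, s, hexec, ht, fun π k' S aStar hπ hS haS =>
    hpart π k' S aStar hπ hS fun i => (haS i).1, fun hinj => ?_⟩
  obtain ⟨π, hπ⟩ := hM.exists_isStationaryDistribution
  -- For singleton classes nothing is subtracted from `π a`, so the maxima add up to `1`.
  have h := hpart π k (fun a => {a}) id hπ (isRowPartition_singleton hinj) fun a =>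
    Finset.mem_singleton_self a
  simpa [hπ.nonneg, hπ.sum_eq_one] using h
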